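/- **Setting.** All Banach spaces are real. Let $\mathcal D$ be the set of dyadic intervals $[\frac{i}{2^n},\frac{i+1}{2^n})$ ($n\ge 0$, $0\le i<2^n$), $\mathcal D_n=\{I\in\mathcal D:|I|=2^{-n}\}$, $\mathcal D_{\le n}=\bigcup_{k\le n}\mathcal D_k$. For $I\in\mathcal D$ let $I^+$, $I^-$ be its left and right half and $h_I=\chi_{I^+}-\chi_{I^-}$; put $h_\varnothing=\chi_{[0,1)}$, $\mathcal D^+=\mathcal D\cup\{\varnothing\}$, $r_n=\sum_{I\in\mathcal D_n}h_I$ (Rademacher functions), and $\iota(\varnothing)=0$, $\iota([\frac{i}{2^n},\frac{i+1}{2^n}))=2^n+i$. Let $\|\cdot\|_X$ be a norm on $H=\operatorname{span}\{h_I\}_{I\in\mathcal D^+}=\operatorname{span}\{\chi_I\}_{I\in\mathcal D}$ such that $\|f\|_X=\|g\|_X$ whenever $|f|$ and $|g|$ have the same distribution, and $\|\chi_{[0,1)}\|_X=1$. Let $\mathbf r=(r_I)_{I\in\mathcal D^+}$ be either the family $r_I=r_{\iota(I)}$ or the constant family $r_I=r_0$. Let $X(\mathbf r)$ be the completion of $H$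 under $$\Bigl\|\sum_{I} a_Ih_I\Bigr\|_{X(\mathbf r)}=\Bigl\|\,s\mapsto\int_0^1\Bigl|\sum_{I} r_I(u)a_Ih_I(s)\Bigr|\,du\Bigr\|_X ,$$ and let the *Haar system Hardy space* $Y=X_0(\mathbf r)$ be the closure of $\operatorname{span}\{h_I\}_{I\in\mathcal D}$ in $X(\mathbf r)$. Let $(\tau_n)_{n\ge0}$ be pairwise disjoint subsets of $\mathbb N_0$ with $|\tau_n|=n+1$. For each $n$, let $k_0<\dots<k_n$ be the elements of $\tau_n$, put $h^n_{[0,1)}=r_{k_0}$, and recursively, for $I\in\mathcal D_j$, $0\le j<n$, let $h^n_{I^\pm}=\sum\{h_K:K\in\mathcal D_{k_{j+1}},\,K\subset\{h^n_I=\pm1\}\}$. The *independent sum* $Y_\omega$ is the closure in $Y$ of $\operatorname{span}\{h_I^n : n\ge 0,\ I\in\mathcal D_{\le n}\}$; the vectors $h_I^n$ are its canonical basis. For a Banach space $Z$ and a bounded linear operator $T\colon Z\to Z$, the identity $I_Z$ *factors through $T$ with constant $C^+$* if for every $\eta>0$ there are bounded linear operators $A,B\colon Z\to Z$ with $ATB=I_Z$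 and $\|A\|\,\|B\|\le C+\eta$. An operator $T$ on $Y_\omega$ has *$\delta$-large positive diagonal* if $\langle (h_I^n)^*,T h_I^n\rangle\ge\delta$ for all $n\ge 0$ and $I\in\mathcal D_{\le n}$, where $(h_I^n)^*\in Y_\omega^*$ is the coordinate functional of $h_I^n$ (equal to $1$ at $h_I^n$ and to $0$ at all other basis vectors). **Theorem.** Let $Y$ be a Haar system Hardy space such that $(r_n)_{n=0}^\infty$ is weakly null in $Y$. Then: (i) For every bounded linear operator $T\colon Y_\omega\to Y_\omega$, the identity $I_{Y_\omega}$ factors through $T$ with constant $2^+$, or $I_{Y_\omega}$ factors through $I_{Y_\omega}-T$ with constant $2^+$. (ii) For every $\delta>0$ and every bounded linear operator $T\colon Y_\omega\to Y_\omega$ with $\delta$-large positive diagonal, the identity $I_{Y_\omega}$ factors through $T$ with constant $(1/\delta)^+$. -/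

import Mathlib

open MeasureTheory Filter Topology

noncomputable section

namespace HaarHardy

/-! ### Dyadic intervals and the Haar system -/

/-- The collection `𝒟` of dyadic intervals of `[0,1)`: the pair `⟨n, i⟩` with `i < 2 ^ n` stands
for `[i / 2 ^ n, (i + 1) / 2 ^ n)`. -/
abbrev DyadicInterval : Type := Σ n : ℕ, Fin (2 ^ n)

namespace DyadicInterval

/-- The set of points of a dyadic interval. -/
def toSet (I : DyadicInterval) : Set ℝ :=
  Set.Ico ((I.2 : ℝ) / 2 ^ I.1) (((I.2 : ℝ) + 1) / 2 ^ I.1)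

/-- `I⁺`, the left half of `I`. -/
def left (I : DyadicInterval) : DyadicInterval :=
  ⟨I.1 + 1, ⟨2 * I.2, by have := I.2.isLt; rw [pow_succ]; omega⟩⟩

/-- `I⁻`, the right half of `I`. -/
def right (I : DyadicInterval) : DyadicInterval :=
  ⟨I.1 + 1, ⟨2 * I.2 + 1, by have := I.2.isLt; rw [pow_succ]; omega⟩⟩

/-- The characteristic function `χ_I`. -/
def chi (I : DyadicInterval) : ℝ → ℝ := I.toSet.indicator 1

/-- The Haar function `h_I = χ_{I⁺} - χ_{I⁻}`. -/
def haar (I : DyadicInterval) : ℝ → ℝ := I.left.chi - I.right.chi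

/-- The whole interval `[0,1)`. -/
def unit : DyadicInterval := ⟨0, ⟨0, by norm_num⟩⟩

end DyadicInterval

/-- `𝒟⁺ = 𝒟 ∪ {∅}`; the additional index `∅` is `none`. -/
abbrev DyadicPlus : Type := Option DyadicInterval

/-- The Haar system indexed by `𝒟⁺`, with `h_∅ = χ_{[0,1)}`. -/
def haarPlus : DyadicPlus → ℝ → ℝ
  | none => DyadicInterval.unit.chi
  | some I => I.haar

/-- The enumeration `ι` of `𝒟⁺`: `ι(∅) = 0` and `ι([i / 2 ^ n, (i + 1) / 2 ^ n)) = 2 ^ n + i`. -/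
def iota : DyadicPlus → ℕ
  | none => 0
  | some I => 2 ^ I.1 + I.2

/-- The Rademacher function `r_n = ∑_{I ∈ 𝒟_n} h_I`. -/
def rademacher (n : ℕ) : ℝ → ℝ := ∑ i : Fin (2 ^ n), DyadicInterval.haar ⟨n, i⟩

/-- The space `H = span {χ_I : I ∈ 𝒟} = span {h_I : I ∈ 𝒟⁺}` of dyadic step functions. Functions
on `[0,1)` are extended to `ℝ` by `0`. -/
def H : Submodule ℝ (ℝ → ℝ) := Submodule.span ℝ (Set.range DyadicInterval.chi)

/-- `f` and `g`, as random variables on `[0,1)` with Lebesgue measure, have the same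
distribution. -/
def SameDistribution (f g : ℝ → ℝ) : Prop :=
  (volume.restrict (Set.Ico (0 : ℝ) 1)).map f = (volume.restrict (Set.Ico (0 : ℝ) 1)).map g

theorem chi_mem_H (I : DyadicInterval) : I.chi ∈ H := Submodule.subset_span ⟨I, rfl⟩

/-- A norm on `H` whose completion is a Haar system space `X`: a norm which depends only on the
distribution of `|f|`, normalized by `‖χ_{[0,1)}‖ = 1`. -/
structure HaarSystemNorm where
  /-- The underlying absolutely homogeneous, subadditive function. -/
  nrm : Seminorm ℝ H
  eq_zero_of_nrm_eq_zero : ∀ f : H, nrm f = 0 → f = 0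
  nrm_eq_of_sameDistribution : ∀ f g : H,
    SameDistribution (fun s => |(f : ℝ → ℝ) s|) (fun s => |(g : ℝ → ℝ) s|) → nrm f = nrm g
  nrm_unit : nrm ⟨DyadicInterval.unit.chi, chi_mem_H _⟩ = 1

/-- The two admissible kinds of families `𝐫 = (r_I)_{I ∈ 𝒟⁺}`. -/
inductive RademacherKind : Type
  | independent
  | constant

/-- The family `𝐫`: either `(r_{ι(I)})_I`, or `(r_0)_I`. -/
def RademacherKind.family : RademacherKind → DyadicPlus → ℝ → ℝ
  | .independent => fun I => rademacher (iota I)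
  | .constant => fun _ => rademacher 0

/-- For the scalars `a`, the function `s ↦ ∫₀¹ |∑_I r_I(u) a_I h_I(s)| du`. -/
def averagedAbs (r : RademacherKind) (a : DyadicPlus →₀ ℝ) (s : ℝ) : ℝ :=
  ∫ u in Set.Ico (0 : ℝ) 1, |a.sum fun I c => r.family I u * c * haarPlus I s|

/-! ### Auxiliary facts showing that `‖·‖_{X(𝐫)}` is well defined and subadditive -/

theorem mem_toSet_iff (I : DyadicInterval) (s : ℝ) :
    s ∈ I.toSet ↔ ⌊s * 2 ^ I.1⌋ = ((I.2 : ℕ) : ℤ) := by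
  have h2 : (0 : ℝ) < 2 ^ I.1 := by positivity
  rw [DyadicInterval.toSet, Set.mem_Ico, Int.floor_eq_iff, div_le_iff₀ h2, lt_div_iff₀ h2]
  push_cast
  rfl

/-- `f` is constant on the dyadic intervals of level `n` and vanishes off `[0,1)`. -/
def IsStep (n : ℕ) (f : ℝ → ℝ) : Prop :=
  (∀ s t, ⌊s * 2 ^ n⌋ = ⌊t * 2 ^ n⌋ → f s = f t) ∧ ∀ s, s ∉ Set.Ico (0 : ℝ) 1 → f s = 0

theorem floor_eq_of_le {m n : ℕ} (h : m ≤ n) {s t : ℝ} (hst : ⌊s * 2 ^ n⌋ = ⌊t * 2 ^ n⌋) :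
    ⌊s * 2 ^ m⌋ = ⌊t * 2 ^ m⌋ := by
  obtain ⟨k, rfl⟩ := Nat.exists_eq_add_of_le h
  have key : ∀ x : ℝ, ⌊x * 2 ^ m⌋ = ⌊x * 2 ^ (m + k)⌋ / ((2 ^ k : ℕ) : ℤ) := by
    intro x
    rw [← Int.floor_div_natCast]
    congr 1
    push_cast
    rw [pow_add]
    field_simp
  rw [key s, key t, hst]

theorem IsStep.mono {m n : ℕ} (h : m ≤ n) {f : ℝ → ℝ} (hf : IsStep m f) : IsStep n f :=
  ⟨fun s t hst => hf.1 s t (floor_eq_of_le h hst), hf.2⟩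

theorem toSet_subset (I : DyadicInterval) : I.toSet ⊆ Set.Ico (0 : ℝ) 1 := by
  intro s hs
  have h2 : (0 : ℝ) < 2 ^ I.1 := by positivity
  rw [DyadicInterval.toSet, Set.mem_Ico, div_le_iff₀ h2, lt_div_iff₀ h2] at hs
  have h3 : ((I.2 : ℕ) : ℝ) + 1 ≤ 2 ^ I.1 := by exact_mod_cast I.2.isLt
  have h4 : (0 : ℝ) ≤ ((I.2 : ℕ) : ℝ) := by positivity
  constructor
  · by_contra hneg
    push Not at hneg
    nlinarith [hs.1]
  · by_contra hge
    push Not at hge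
    nlinarith [hs.2]

theorem isStep_chi (I : DyadicInterval) : IsStep I.1 I.chi := by
  refine ⟨fun s t hst => ?_, fun s hs => ?_⟩
  · by_cases h : s ∈ I.toSet
    · have h' : t ∈ I.toSet := by rw [mem_toSet_iff] at h ⊢; rw [← hst, h]
      simp [DyadicInterval.chi, h, h']
    · have h' : t ∉ I.toSet := by rw [mem_toSet_iff] at h ⊢; rw [← hst]; exact h
      simp [DyadicInterval.chi, h, h']
  · have h : s ∉ I.toSet := fun h => hs (toSet_subset I h)
    simp [DyadicInterval.chi, h]

theorem exists_isStep_haarPlus (I : DyadicPlus) : ∃ n, IsStep n (haarPlus I) := by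
  rcases I with _ | I
  · exact ⟨_, isStep_chi _⟩
  · refine ⟨I.1 + 1, fun s t hst => ?_, fun s hs => ?_⟩
    · have h1 := (isStep_chi I.left).1 s t hst
      have h2 := (isStep_chi I.right).1 s t hst
      simp [haarPlus, DyadicInterval.haar, h1, h2]
    · have h1 := (isStep_chi I.left).2 s hs
      have h2 := (isStep_chi I.right).2 s hs
      simp [haarPlus, DyadicInterval.haar, h1, h2]

/-- The step function with value `v i` on the `i`-th dyadic interval of level `n`. -/
def stepFun (n : ℕ) (v : Fin (2 ^ n) → ℝ) : H :=
  ⟨∑ i, v i • DyadicInterval.chi ⟨n, i⟩,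
    Submodule.sum_mem _ fun _ _ => Submodule.smul_mem _ _ (chi_mem_H _)⟩

theorem stepFun_apply (n : ℕ) (v : Fin (2 ^ n) → ℝ) (i : Fin (2 ^ n)) {s : ℝ}
    (hs : s ∈ DyadicInterval.toSet ⟨n, i⟩) : (stepFun n v : ℝ → ℝ) s = v i := by
  simp only [stepFun, Finset.sum_apply, Pi.smul_apply, smul_eq_mul]
  rw [Finset.sum_eq_single i]
  · simp [DyadicInterval.chi, hs]
  · intro j _ hj
    have : s ∉ DyadicInterval.toSet ⟨n, j⟩ := by
      intro h
      rw [mem_toSet_iff] at h hs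
      apply hj
      have : ((j : ℕ) : ℤ) = ((i : ℕ) : ℤ) := by rw [← h, ← hs]
      exact Fin.ext (by exact_mod_cast this)
    simp [DyadicInterval.chi, this]
  · simp

theorem stepFun_apply_zero (n : ℕ) (v : Fin (2 ^ n) → ℝ) {s : ℝ} (hs : s ∉ Set.Ico (0 : ℝ) 1) :
    (stepFun n v : ℝ → ℝ) s = 0 := by
  simp only [stepFun, Finset.sum_apply, Pi.smul_apply, smul_eq_mul]
  exact Finset.sum_eq_zero fun i _ => by rw [(isStep_chi _).2 s hs, mul_zero]

theorem exists_mem_toSet (n : ℕ) {s : ℝ} (hs : s ∈ Set.Ico (0 : ℝ) 1) :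
    ∃ i : Fin (2 ^ n), s ∈ DyadicInterval.toSet ⟨n, i⟩ := by
  have h2 : (0 : ℝ) < 2 ^ n := by positivity
  have h0 : 0 ≤ ⌊s * 2 ^ n⌋ := Int.floor_nonneg.2 (mul_nonneg hs.1 h2.le)
  have h1 : ⌊s * 2 ^ n⌋ < 2 ^ n := by
    rw [Int.floor_lt]
    push_cast
    nlinarith [hs.2]
  refine ⟨⟨⌊s * 2 ^ n⌋.toNat, ?_⟩, ?_⟩
  · zify
    rwa [Int.toNat_of_nonneg h0]
  · rw [mem_toSet_iff]
    simp [Int.toNat_of_nonneg h0]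

theorem IsStep.eq_stepFun {n : ℕ} {f : ℝ → ℝ} (hf : IsStep n f) :
    f = stepFun n fun i => f ((i : ℕ) / 2 ^ n) := by
  funext s
  by_cases hs : s ∈ Set.Ico (0 : ℝ) 1
  · obtain ⟨i, hi⟩ := exists_mem_toSet n hs
    rw [stepFun_apply n _ i hi]
    apply hf.1
    rw [mem_toSet_iff] at hi
    have h2 : (0 : ℝ) < 2 ^ n := by positivity
    rw [hi, div_mul_cancel₀ _ h2.ne']
    simp
  · rw [hf.2 s hs, stepFun_apply_zero n _ hs]

theorem IsStep.mem_H {n : ℕ} {f : ℝ → ℝ} (hf : IsStep n f) : f ∈ H := by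
  rw [hf.eq_stepFun]; exact (stepFun n _).2

theorem exists_isStep_of_mem_H {f : ℝ → ℝ} (hf : f ∈ H) : ∃ n, IsStep n f := by
  induction hf using Submodule.span_induction with
  | mem x hx => obtain ⟨I, rfl⟩ := hx; exact ⟨_, isStep_chi I⟩
  | zero => exact ⟨0, fun _ _ _ => rfl, fun _ _ => rfl⟩
  | add x y _ _ hx hy =>
    obtain ⟨m, hm⟩ := hx
    obtain ⟨k, hk⟩ := hy
    have hm' := hm.mono (le_max_left m k)
    have hk' := hk.mono (le_max_right m k)
    exact ⟨max m k, fun s t h => by simp [hm'.1 s t h, hk'.1 s t h],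
      fun s h => by simp [hm'.2 s h, hk'.2 s h]⟩
  | smul c x _ hx =>
    obtain ⟨m, hm⟩ := hx
    exact ⟨m, fun s t h => by simp [hm.1 s t h], fun s h => by simp [hm.2 s h]⟩

theorem HaarSystemNorm.nrm_congr_abs (N : HaarSystemNorm) {f g : H}
    (h : ∀ s, |(f : ℝ → ℝ) s| = |(g : ℝ → ℝ) s|) : N.nrm f = N.nrm g :=
  N.nrm_eq_of_sameDistribution f g (by simp only [h]; rfl)

theorem HaarSystemNorm.nrm_stepFun_abs (N : HaarSystemNorm) (n : ℕ) {v w : Fin (2 ^ n) → ℝ}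
    (h : ∀ i, |v i| = |w i|) : N.nrm (stepFun n v) = N.nrm (stepFun n w) := by
  apply N.nrm_congr_abs
  intro s
  by_cases hs : s ∈ Set.Ico (0 : ℝ) 1
  · obtain ⟨i, hi⟩ := exists_mem_toSet n hs
    rw [stepFun_apply n _ i hi, stepFun_apply n _ i hi, h]
  · rw [stepFun_apply_zero n _ hs, stepFun_apply_zero n _ hs]

theorem stepFun_combo (n : ℕ) (a b : ℝ) (v w : Fin (2 ^ n) → ℝ) :
    stepFun n (fun i => a * v i + b * w i) = a • stepFun n v + b • stepFun n w := by
  apply Subtype.ext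
  simp only [stepFun, Submodule.coe_add, Submodule.coe_smul, Finset.smul_sum, ← Finset.sum_add_distrib,
    add_smul, mul_smul]

theorem HaarSystemNorm.nrm_stepFun_update_le (N : HaarSystemNorm) (n : ℕ) (v : Fin (2 ^ n) → ℝ)
    (i : Fin (2 ^ n)) (c : ℝ) (hc : |c| ≤ |v i|) :
    N.nrm (stepFun n (Function.update v i c)) ≤ N.nrm (stepFun n v) := by
  have hex : ∃ t : ℝ, |t| ≤ 1 ∧ c = t * v i := by
    by_cases h0 : v i = 0
    · exact ⟨0, by simp, by simpa [h0] using hc⟩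
    · refine ⟨c / v i, ?_, by field_simp⟩
      rw [abs_div]
      exact div_le_one_of_le₀ hc (abs_nonneg _)
  obtain ⟨t, ht, hct⟩ := hex
  obtain ⟨ht1, ht2⟩ := abs_le.1 ht
  set w := Function.update v i (-v i) with hw
  have hN : N.nrm (stepFun n w) = N.nrm (stepFun n v) := by
    apply N.nrm_stepFun_abs
    intro j
    by_cases hj : j = i
    · subst hj; simp [hw]
    · simp [hw, hj]
  have heq : Function.update v i c = fun j => (1 + t) / 2 * v j + (1 - t) / 2 * w j := by
    funext j
    by_cases hj : j = i
    · subst hj; simp [hw, hct]; ring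
    · simp [hw, hj]; ring
  rw [heq, stepFun_combo]
  refine (map_add_le_add _ _ _).trans ?_
  rw [map_smul_eq_mul, map_smul_eq_mul, hN, Real.norm_of_nonneg (by linarith),
    Real.norm_of_nonneg (by linarith)]
  apply le_of_eq
  ring

theorem HaarSystemNorm.nrm_stepFun_mono (N : HaarSystemNorm) (n : ℕ) {v w : Fin (2 ^ n) → ℝ}
    (h : ∀ i, |v i| ≤ |w i|) : N.nrm (stepFun n v) ≤ N.nrm (stepFun n w) := by
  classical
  have key : ∀ S : Finset (Fin (2 ^ n)),
      N.nrm (stepFun n (fun i => if i ∈ S then v i else w i)) ≤ N.nrm (stepFun n w) := by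
    intro S
    induction S using Finset.induction_on with
    | empty => simp
    | insert i S hi ih =>
      refine le_trans ?_ ih
      have := N.nrm_stepFun_update_le n (fun j => if j ∈ S then v j else w j) i (v i)
        (by simpa [hi] using h i)
      have heq : (fun j => if j ∈ insert i S then v j else w j)
          = Function.update (fun j => if j ∈ S then v j else w j) i (v i) := by
        funext j
        by_cases hj : j = i
        · subst hj; simp
        · simp [hj]
      rw [heq]
      exact this
  simpa using key Finset.univ

theorem HaarSystemNorm.nrm_mono (N : HaarSystemNorm) {f g : H}
    (h : ∀ s, |(f : ℝ → ℝ) s| ≤ |(g : ℝ → ℝ) s|) : N.nrm f ≤ N.nrm g := by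
  obtain ⟨m, hm⟩ := exists_isStep_of_mem_H f.2
  obtain ⟨k, hk⟩ := exists_isStep_of_mem_H g.2
  have hf : f = stepFun (max m k) _ := Subtype.ext (hm.mono (le_max_left m k)).eq_stepFun
  have hg : g = stepFun (max m k) _ := Subtype.ext (hk.mono (le_max_right m k)).eq_stepFun
  rw [hf, hg]
  exact N.nrm_stepFun_mono _ fun i => h _

theorem averagedAbs_mem_H (r : RademacherKind) (a : DyadicPlus →₀ ℝ) : averagedAbs r a ∈ H := by
  choose lev hlev using exists_isStep_haarPlus
  refine IsStep.mem_H (n := a.support.sup lev) ⟨fun s t hst => ?_, fun s hs => ?_⟩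
  · have : ∀ u, (a.sum fun I c => r.family I u * c * haarPlus I s)
        = a.sum fun I c => r.family I u * c * haarPlus I t := fun u =>
      Finset.sum_congr rfl fun I hI => by
        simp only [((hlev I).mono (Finset.le_sup hI)).1 s t hst]
    simp only [averagedAbs, this]
  · have : ∀ u, (a.sum fun I c => r.family I u * c * haarPlus I s) = 0 := fun u =>
      Finset.sum_eq_zero fun I _ => by simp only [(hlev I).2 s hs, mul_zero]
    simp [averagedAbs, this]

theorem integrable_rademacher (n : ℕ) :
    IntegrableOn (rademacher n) (Set.Ico (0 : ℝ) 1) := by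
  have hchi : ∀ I : DyadicInterval, IntegrableOn I.chi (Set.Ico (0 : ℝ) 1) := fun I => by
    apply Integrable.indicator
    · exact integrable_const (1 : ℝ)
    · exact measurableSet_Ico
  apply integrable_finsetSum'
  intro i _
  exact (hchi _).sub (hchi _)

theorem integrable_averagedAbs (r : RademacherKind) (a : DyadicPlus →₀ ℝ) (s : ℝ) :
    IntegrableOn (fun u => |a.sum fun I c => r.family I u * c * haarPlus I s|)
      (Set.Ico (0 : ℝ) 1) := by
  apply Integrable.abs
  apply integrable_finsetSum
  intro I _
  apply Integrable.mul_const
  apply Integrable.mul_const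
  cases r
  · exact integrable_rademacher _
  · exact integrable_rademacher _

theorem averagedAbs_nonneg (r : RademacherKind) (a : DyadicPlus →₀ ℝ) (s : ℝ) :
    0 ≤ averagedAbs r a s :=
  integral_nonneg fun _ => abs_nonneg _

theorem averagedAbs_add_le (r : RademacherKind) (a b : DyadicPlus →₀ ℝ) (s : ℝ) :
    averagedAbs r (a + b) s ≤ averagedAbs r a s + averagedAbs r b s := by
  unfold averagedAbs
  rw [← integral_add (integrable_averagedAbs r a s) (integrable_averagedAbs r b s)]
  refine integral_mono (integrable_averagedAbs r (a + b) s)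
    ((integrable_averagedAbs r a s).add (integrable_averagedAbs r b s)) fun u => ?_
  simp only
  rw [Finsupp.sum_add_index' (by simp) (by intros; ring)]
  exact abs_add_le _ _

theorem averagedAbs_smul (r : RademacherKind) (c : ℝ) (a : DyadicPlus →₀ ℝ) (s : ℝ) :
    averagedAbs r (c • a) s = |c| * averagedAbs r a s := by
  unfold averagedAbs
  rw [← integral_const_mul]
  congr 1
  funext u
  rw [Finsupp.sum_smul_index' (by simp), ← abs_mul, Finsupp.mul_sum]
  congr 1
  exact Finset.sum_congr rfl fun I _ => by simp only [smul_eq_mul]; ring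

/-! ### Haar system Hardy spaces -/

/-- The norm `‖∑_I a_I h_I‖_{X(𝐫)} = ‖s ↦ ∫₀¹ |∑_I r_I(u) a_I h_I(s)| du‖_X`, as a function of the
finitely supported family of Haar coefficients `(a_I)_{I ∈ 𝒟⁺}`. -/
def hardySeminorm (N : HaarSystemNorm) (r : RademacherKind) : Seminorm ℝ (DyadicPlus →₀ ℝ) :=
  Seminorm.of (fun a => N.nrm ⟨averagedAbs r a, averagedAbs_mem_H r a⟩)
    (fun a b => by
      refine le_trans (N.nrm_mono (g := ⟨averagedAbs r a, averagedAbs_mem_H r a⟩ +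
        ⟨averagedAbs r b, averagedAbs_mem_H r b⟩) fun s => ?_) (map_add_le_add _ _ _)
      simp only [Submodule.coe_add, Pi.add_apply]
      rw [abs_of_nonneg (averagedAbs_nonneg _ _ _), abs_of_nonneg
        (add_nonneg (averagedAbs_nonneg _ _ _) (averagedAbs_nonneg _ _ _))]
      exact averagedAbs_add_le r a b s)
    (fun c a => by
      rw [show (⟨averagedAbs r (c • a), averagedAbs_mem_H r (c • a)⟩ : H)
        = |c| • ⟨averagedAbs r a, averagedAbs_mem_H r a⟩ from
          Subtype.ext (funext fun s => averagedAbs_smul r c a s), map_smul_eq_mul,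
        Real.norm_eq_abs, Real.norm_eq_abs, abs_abs])

/-- The space `H` with the norm `‖·‖_{X(𝐫)}`. As `(h_I)_{I ∈ 𝒟⁺}` is a basis of the vector space
`H`, its elements are represented by their finitely supported families of Haar coefficients. -/
def HardyPre (_N : HaarSystemNorm) (_r : RademacherKind) : Type := DyadicPlus →₀ ℝ

instance (N : HaarSystemNorm) (r : RademacherKind) : AddCommGroup (HardyPre N r) :=
  inferInstanceAs (AddCommGroup (DyadicPlus →₀ ℝ))

instance (N : HaarSystemNorm) (r : RademacherKind) : Module ℝ (HardyPre N r) :=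
  inferInstanceAs (Module ℝ (DyadicPlus →₀ ℝ))

instance (N : HaarSystemNorm) (r : RademacherKind) : SeminormedAddCommGroup (HardyPre N r) :=
  AddGroupSeminorm.toSeminormedAddCommGroup
    (show AddGroupSeminorm (HardyPre N r) from (hardySeminorm N r).toAddGroupSeminorm)

instance (N : HaarSystemNorm) (r : RademacherKind) : NormedSpace ℝ (HardyPre N r) where
  norm_smul_le c a := le_of_eq (map_smul_eq_mul (hardySeminorm N r) c a)

/-- The Banach space `X(𝐫)`, the completion of `H` under `‖·‖_{X(𝐫)}`. -/
def XSpace (N : HaarSystemNorm) (r : RademacherKind) : Type :=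
  UniformSpace.Completion (HardyPre N r)

instance (N : HaarSystemNorm) (r : RademacherKind) : NormedAddCommGroup (XSpace N r) :=
  inferInstanceAs (NormedAddCommGroup (UniformSpace.Completion (HardyPre N r)))

instance (N : HaarSystemNorm) (r : RademacherKind) : NormedSpace ℝ (XSpace N r) :=
  inferInstanceAs (NormedSpace ℝ (UniformSpace.Completion (HardyPre N r)))

instance (N : HaarSystemNorm) (r : RademacherKind) : CompleteSpace (XSpace N r) :=
  inferInstanceAs (CompleteSpace (UniformSpace.Completion (HardyPre N r)))

/-- The canonical isometric linear embedding of `H`, with the norm `‖·‖_{X(𝐫)}`, into `X(𝐫)`. -/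
def toX (N : HaarSystemNorm) (r : RademacherKind) : HardyPre N r →ₗᵢ[ℝ] XSpace N r :=
  UniformSpace.Completion.toComplₗᵢ

/-- The Haar function `h_I`, `I ∈ 𝒟⁺`, as an element of `X(𝐫)`. -/
def haarX (N : HaarSystemNorm) (r : RademacherKind) (I : DyadicPlus) : XSpace N r :=
  toX N r (show HardyPre N r from Finsupp.single I (1 : ℝ))

/-- The subspace `X₀(𝐫)` of `X(𝐫)`, the closure of `H₀ = span {h_I : I ∈ 𝒟}`. -/
def XZero (N : HaarSystemNorm) (r : RademacherKind) : Submodule ℝ (XSpace N r) :=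
  (Submodule.span ℝ (Set.range fun I : DyadicInterval => haarX N r (some I))).topologicalClosure

/-- The Haar system Hardy space `Y = X₀(𝐫)`. -/
def YSpace (N : HaarSystemNorm) (r : RademacherKind) : Type := XZero N r

instance (N : HaarSystemNorm) (r : RademacherKind) : NormedAddCommGroup (YSpace N r) :=
  inferInstanceAs (NormedAddCommGroup (XZero N r))

instance (N : HaarSystemNorm) (r : RademacherKind) : NormedSpace ℝ (YSpace N r) :=
  inferInstanceAs (NormedSpace ℝ (XZero N r))

/-- The Haar function `h_I`, `I ∈ 𝒟`, as an element of `Y`. -/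
def haarY (N : HaarSystemNorm) (r : RademacherKind) (I : DyadicInterval) : YSpace N r :=
  (⟨haarX N r (some I), Submodule.le_topologicalClosure _ (Submodule.subset_span ⟨I, rfl⟩)⟩ :
    XZero N r)

/-- The Rademacher function `r_n = ∑_{I ∈ 𝒟_n} h_I` as an element of `Y`. -/
def rademacherY (N : HaarSystemNorm) (r : RademacherKind) (n : ℕ) : YSpace N r :=
  ∑ i : Fin (2 ^ n), haarY N r ⟨n, i⟩

/-- The sequence `x` tends to `0` weakly. -/
def WeaklyNull {E : Type*} [NormedAddCommGroup E] [NormedSpace ℝ E] (x : ℕ → E) : Prop :=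
  ∀ φ : E →L[ℝ] ℝ, Tendsto (fun n => φ (x n)) atTop (𝓝 0)

/-! ### The independent sum `Y_ω` -/

/-- `𝒟_n`, as a finite set of dyadic intervals. -/
def level (n : ℕ) : Finset DyadicInterval :=
  Finset.univ.map ⟨fun i : Fin (2 ^ n) => (⟨n, i⟩ : DyadicInterval),
    fun _ _ h => eq_of_heq (Sigma.mk.inj h).2⟩

open Classical in
/-- The collection `𝓑_I` for the `i`-th dyadic interval `I` of level `j`, in the finite faithful
Haar system with frequencies `k 0 < k 1 < ⋯`. For `j = 0` it is `𝒟_{k 0}`. The `i`-th interval of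
level `j + 1` is the left (`i` even) or right (`i` odd) half of the interval `J` of level `j` with
number `i / 2`; its collection consists of the `K ∈ 𝒟_{k (j + 1)}` which are contained in
`[ĥ_J = 1]`, respectively in `[ĥ_J = -1]`, where `ĥ_J = ∑_{L ∈ 𝓑_J} h_L`. -/
def blockCollection (k : ℕ → ℕ) : ℕ → ℕ → Finset DyadicInterval
  | 0, _ => level (k 0)
  | j + 1, i => (level (k (j + 1))).filter fun K =>
      ∀ s ∈ K.toSet,
        ∑ L ∈ blockCollection k j (i / 2), L.haar s = if Even i then 1 else -1

/-- `𝒟_ω`, the set of pairs `(n, I)` with `I ∈ 𝒟_{≤ n}`. -/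
abbrev DyadicOmega : Type := Σ n : ℕ, {I : DyadicInterval // I.1 ≤ n}

/-- The function `h_I^n = ∑_{K ∈ 𝓑_I} h_K` as an element of `Y`, where the system `(h_I^n)_I`,
`I ∈ 𝒟_{≤ n}`, has as its frequencies the elements of `τ n` in increasing order
(`Nat.nth (· ∈ τ n) j` is the `j`-th smallest element of `τ n`, starting from `j = 0`). -/
def hY (N : HaarSystemNorm) (r : RademacherKind) (τ : ℕ → Finset ℕ) (p : DyadicOmega) :
    YSpace N r :=
  ∑ K ∈ blockCollection (Nat.nth (· ∈ τ p.1)) p.2.1.1 p.2.1.2, haarY N r K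

/-- The closure of `H_ω = span {h_I^n : (n, I) ∈ 𝒟_ω}` in `Y`. -/
def closedSpanOmega (N : HaarSystemNorm) (r : RademacherKind) (τ : ℕ → Finset ℕ) :
    Submodule ℝ (YSpace N r) :=
  (Submodule.span ℝ (Set.range (hY N r τ))).topologicalClosure

/-- The independent sum `Y_ω`, constructed from the sets `τ n`. -/
def YOmega (N : HaarSystemNorm) (r : RademacherKind) (τ : ℕ → Finset ℕ) : Type :=
  closedSpanOmega N r τ

instance (N : HaarSystemNorm) (r : RademacherKind) (τ : ℕ → Finset ℕ) :
    NormedAddCommGroup (YOmega N r τ) :=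
  inferInstanceAs (NormedAddCommGroup (closedSpanOmega N r τ))

instance (N : HaarSystemNorm) (r : RademacherKind) (τ : ℕ → Finset ℕ) :
    NormedSpace ℝ (YOmega N r τ) :=
  inferInstanceAs (NormedSpace ℝ (closedSpanOmega N r τ))

/-- The basis vector `h_I^n` as an element of `Y_ω`. -/
def hOmega (N : HaarSystemNorm) (r : RademacherKind) (τ : ℕ → Finset ℕ) (p : DyadicOmega) :
    YOmega N r τ :=
  (⟨hY N r τ p, Submodule.le_topologicalClosure _ (Submodule.subset_span ⟨p, rfl⟩)⟩ :
    closedSpanOmega N r τ)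

/-! ### Factorization and diagonals of operators -/

section Operators

variable {E F : Type*} [NormedAddCommGroup E] [NormedSpace ℝ E]
  [NormedAddCommGroup F] [NormedSpace ℝ F]

/-- `S` factors through `T` with constant `C` and error `η`. -/
def FactorsThrough (S : E →L[ℝ] E) (T : F →L[ℝ] F) (C η : ℝ) : Prop :=
  ∃ (B : E →L[ℝ] F) (A : F →L[ℝ] E), ‖A‖ * ‖B‖ ≤ C ∧ ‖S - A ∘L T ∘L B‖ ≤ η

/-- `S` factors through `T` with constant `C⁺` (and error `0`). -/
def FactorsThroughPlus (S : E →L[ℝ] E) (T : F →L[ℝ] F) (C : ℝ) : Prop :=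
  ∀ η : ℝ, 0 < η → FactorsThrough S T (C + η) 0

/-- `φ` is the coordinate functional of `e i` for the basis `e`: it takes the value `1` at `e i`
and `0` at the other basis vectors. (There is only one such bounded functional if the span of `e`
is dense, in particular for a Schauder basis.) -/
def IsCoordinateFunctional {ι : Type*} (e : ι → E) (i : ι) (φ : E →L[ℝ] ℝ) : Prop :=
  φ (e i) = 1 ∧ ∀ j, j ≠ i → φ (e j) = 0

/-- `T` has `δ`-large positive diagonal with respect to the basis `e`: `⟨e_i^*, T e_i⟩ ≥ δ` for
all `i`, where `e_i^*` is the coordinate functional of `e_i`. -/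
def HasLargePositiveDiagonal {ι : Type*} (e : ι → E) (δ : ℝ) (T : E →L[ℝ] E) : Prop :=
  ∀ (i : ι) (φ : E →L[ℝ] ℝ), IsCoordinateFunctional e i φ → δ ≤ φ (T (e i))

end Operators

end HaarHardy

end

/-!
Every operator `T` on `Y_ω` is, up to an arbitrarily small error, a multiple `d` of the identity on
a `1`-complemented isometric copy of `Y_ω`: there are contractions `A`, `B` with `A B = 1` and
`‖A T B - d‖ ≤ ε` (`Model.exists_almost_scalar`). Then also `A (1 - T) B` is close to `1 - d`. One
of `|d|`, `|1 - d|` is at least `1 / 2`, and `d ≥ δ` if the diagonal of `T` is at least `δ`, because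
`d` is a limit of averages of diagonal entries. A Neumann series turns the approximate
factorization into an exact one (`factorsThrough_id`).

Only the following structure of `Y_ω` is used (`Model`, `omegaModel`). The coordinates of a point of
the probability space are the independent binary digits `w (n, j)`, where `w (n, j)` is the value of
the `j`-th Rademacher function of the `n`-th block. For a finite combination of basis vectors, the
values of its parts in the single levels `(n, j)` form a family indexed by the levels. The norm
consists of a norm of this family that is invariant under relabelings of the levels, followed by a
rearrangement invariant norm. For both kinds of families `𝐫` this holds because at a given point
only one Haar function of each level does not vanish. Averages over digit flips, relabelings of
levels and automorphisms of the binary tree therefore act as contractions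
(`Model.rho_average_le`, `Model.rho_relabel`, `Model.norm_twist`).

A copy of `Y_ω` uses for its `n`-th block the levels `k 0 < ⋯ < k n` of the block `m` with some
`m ≥ k n`, twisted by a tree automorphism `θ` (`Place`). The vector of the copy that belongs to a
node `I` of level `j` is the sum, with the signs given by `θ`, of the images under `θ` of the basis
vectors of those nodes of level `k j` whose choices at the levels `k 0, …, k (j - 1)` are those of
`I` (`Model.norm_select`). The coordinates of the copy are signed averages of coordinates
(`Model.norm_avg_le`).

* Different blocks. The Rademacher functions of a fixed level `j` of the blocks are weakly null by
  hypothesis. A functional is therefore small, in the sense of `ℓ¹`, on the level `j` of far blocks,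
  since the signs of its values can be absorbed by a twist (`Model.tendsto_sum_abs`); the
  coordinates of a fixed vector on far blocks are small too (`Model.tendsto_sum_abs_coord`). Hence
  the interaction of a new block with the previous ones is small if `m` is large.
* Off-diagonal entries within a block. For a random `θ`, the entries of `T` between two nodes of the
  copy are signed sums of the entries `t` of `T` between nodes of the levels `k i` and `k j`, and
  their second moments are bounded by `∑ t²` (`FinTree.sum_sq_pair_le`,
  `FinTree.sum_sq_offDiag_le`). With `a k = ‖h_I‖` for `I ∈ 𝒟_k` and `b k = 2⁻ᵏ / a k`, this sum is
  at most `‖T‖² a_l b_k min(2ˡ a_l, 2ᵏ b_k)` (`Model.sum_sq_entry_le`). As `a k b k = 2⁻ᵏ`, at least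
  one of the sequences `a`, `b` tends to `0`, and the levels can be chosen such that all these
  bounds are small (`exists_level_bound`).
* Diagonal entries. For a random `θ`, the diagonal entries of the copy concentrate around the
  average of the diagonal of `T` over the level `k j` of the block `m`
  (`FinTree.sum_sq_average_le`). These averages are bounded. The number `d` is their iterated limit,
  first in `m` and then in `k`, along an ultrafilter.
-/

namespace HaarHardy

/-! ### Binary digits and prefixes -/

/-- The number with binary digits `x 0, …, x (j - 1)`, most significant digit first. It numbers the
dyadic interval of level `j` that consists of the points whose expansion starts with `x`. -/
def num (x : ℕ → Bool) : ℕ → ℕ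
  | 0 => 0
  | j + 1 => 2 * num x j + (x j).toNat

theorem num_lt (x : ℕ → Bool) (j : ℕ) : num x j < 2 ^ j := by
  induction j with
  | zero => simp [num]
  | succ j ih =>
    have : (x j).toNat ≤ 1 := Bool.toNat_le (x j)
    rw [num, pow_succ]; omega

theorem num_eq_iff {x y : ℕ → Bool} {j : ℕ} : num x j = num y j ↔ ∀ l < j, x l = y l := by
  induction j with
  | zero => simp [num]
  | succ j ih =>
    have key : num x (j + 1) = num y (j + 1) ↔ num x j = num y j ∧ x j = y j := by
      simp only [num]
      cases x j <;> cases y j <;> simp <;> omega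
    rw [key, ih]
    constructor
    · rintro ⟨h1, h2⟩ l hl
      rcases Nat.lt_succ_iff_lt_or_eq.1 hl with h | rfl
      exacts [h1 l h, h2]
    · exact fun h => ⟨fun l hl => h l (by omega), h j (by omega)⟩

/-- The digits of the binary expansion of `s ∈ [0,1)`. -/
noncomputable def bitsOf (s : ℝ) : ℕ → Bool := fun l => decide (Odd ⌊s * 2 ^ (l + 1)⌋)

theorem floor_succ (s : ℝ) (j : ℕ) :
    ⌊s * 2 ^ (j + 1)⌋ = 2 * ⌊s * 2 ^ j⌋ + ((bitsOf s j).toNat : ℤ) := by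
  have key : ⌊s * 2 ^ j⌋ = ⌊s * 2 ^ (j + 1)⌋ / 2 := by
    have := Int.floor_div_natCast (s * 2 ^ (j + 1)) 2
    push_cast at this
    rw [← this, pow_succ]
    congr 1
    ring
  rw [key, bitsOf]
  rcases Int.even_or_odd ⌊s * 2 ^ (j + 1)⌋ with h | h
  · have : ¬ Odd ⌊s * 2 ^ (j + 1)⌋ := Int.not_odd_iff_even.2 h
    simp only [this, decide_false, Bool.toNat_false]
    obtain ⟨c, hc⟩ := h
    push_cast; omega
  · simp only [h, decide_true, Bool.toNat_true]
    obtain ⟨c, hc⟩ := h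
    push_cast; omega

theorem floor_eq_num {s : ℝ} (hs : s ∈ Set.Ico (0 : ℝ) 1) (j : ℕ) :
    ⌊s * 2 ^ j⌋ = (num (bitsOf s) j : ℤ) := by
  induction j with
  | zero => simpa [num, Int.floor_eq_zero_iff] using hs
  | succ j ih => rw [floor_succ, ih, num]; push_cast; ring

theorem mem_toSet_iff_num {s : ℝ} (hs : s ∈ Set.Ico (0 : ℝ) 1) (I : DyadicInterval) :
    s ∈ I.toSet ↔ num (bitsOf s) I.1 = I.2 := by
  rw [mem_toSet_iff, floor_eq_num hs]; norm_cast

/-- The sign `±1` encoded by a digit; the digit `0` is the left half, where Haar functions are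
`+1`. -/
def sgn (b : Bool) : ℝ := if b then -1 else 1

@[simp] theorem abs_sgn (b : Bool) : |sgn b| = 1 := by cases b <;> simp [sgn]

theorem sgn_mul_self (b : Bool) : sgn b * sgn b = 1 := by cases b <;> simp [sgn]

theorem sgn_sq (b : Bool) : sgn b ^ 2 = 1 := by cases b <;> simp [sgn]

theorem sgn_xor (a b : Bool) : sgn (xor a b) = sgn a * sgn b := by
  cases a <;> cases b <;> simp [sgn]

theorem sgn_not (b : Bool) : sgn (!b) = - sgn b := by cases b <;> simp [sgn]

/-- The Haar function `h_I`, as a function of the binary digits. -/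
def haarBits (I : DyadicInterval) (x : ℕ → Bool) : ℝ :=
  if num x I.1 = I.2 then sgn (x I.1) else 0

theorem haar_eq_haarBits {s : ℝ} (hs : s ∈ Set.Ico (0 : ℝ) 1) (I : DyadicInterval) :
    I.haar s = haarBits I (bitsOf s) := by
  have h1 : s ∈ I.left.toSet ↔ num (bitsOf s) I.1 = I.2 ∧ bitsOf s I.1 = false := by
    rw [mem_toSet_iff_num hs]
    simp only [DyadicInterval.left, num]
    cases bitsOf s I.1 <;> (simp; try omega)
  have h2 : s ∈ I.right.toSet ↔ num (bitsOf s) I.1 = I.2 ∧ bitsOf s I.1 = true := by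
    rw [mem_toSet_iff_num hs]
    simp only [DyadicInterval.right, num]
    cases bitsOf s I.1 <;> (simp; try omega)
  classical
  simp only [DyadicInterval.haar, Pi.sub_apply, DyadicInterval.chi, haarBits,
    Set.indicator_apply, h1, h2, Pi.one_apply]
  by_cases h : num (bitsOf s) I.1 = I.2 <;> cases hb : bitsOf s I.1 <;> simp [sgn, h]

theorem rademacher_eq {s : ℝ} (hs : s ∈ Set.Ico (0 : ℝ) 1) (n : ℕ) :
    rademacher n s = sgn (bitsOf s n) := by
  rw [rademacher, Finset.sum_apply]
  simp only [haar_eq_haarBits hs, haarBits]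
  rw [Finset.sum_eq_single ⟨num (bitsOf s) n, num_lt _ _⟩]
  · simp
  · intro i _ hi
    rw [if_neg]
    intro h
    exact hi (Fin.ext h.symm)
  · simp

/-! ### Functions of the first digits -/

/-- The digit sequences that vanish from position `N` on. -/
def cube (N : ℕ) : Set (ℕ → Bool) := {x | ∀ l, N ≤ l → x l = false}

/-- The digits of the left endpoint of the `i`-th dyadic interval of level `N`. -/
noncomputable def digits (N : ℕ) (i : Fin (2 ^ N)) : ℕ → Bool := bitsOf ((i : ℕ) / 2 ^ N)

theorem endpoint_mem (N : ℕ) (i : Fin (2 ^ N)) : ((i : ℕ) / 2 ^ N : ℝ) ∈ Set.Ico (0 : ℝ) 1 := by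
  have h2 : (0 : ℝ) < 2 ^ N := by positivity
  refine ⟨by positivity, ?_⟩
  rw [div_lt_one h2]
  exact_mod_cast i.isLt

theorem num_digits (N : ℕ) (i : Fin (2 ^ N)) : num (digits N i) N = i := by
  have h := floor_eq_num (endpoint_mem N i) N
  have h2 : (0 : ℝ) < 2 ^ N := by positivity
  rw [div_mul_cancel₀ _ h2.ne'] at h
  simp only [Int.floor_natCast] at h
  rw [digits]
  exact_mod_cast h.symm

theorem digits_mem_cube (N : ℕ) (i : Fin (2 ^ N)) : digits N i ∈ cube N := by
  intro l hl
  have h2 : (0 : ℝ) < 2 ^ N := by positivity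
  obtain ⟨k, rfl⟩ := Nat.exists_eq_add_of_le hl
  have : ((i : ℕ) / 2 ^ N * 2 ^ (N + k + 1) : ℝ) = (((i : ℕ) * 2 ^ (k + 1) : ℕ) : ℝ) := by
    push_cast
    rw [show N + k + 1 = N + (k + 1) by ring, pow_add]
    field_simp
  simp only [digits, bitsOf, this, Int.floor_natCast, decide_eq_false_iff_not, Int.not_odd_iff_even]
  rw [pow_succ, ← mul_assoc]
  exact_mod_cast even_two.mul_left _

theorem digits_num {N : ℕ} {x : ℕ → Bool} (hx : x ∈ cube N) :
    digits N ⟨num x N, num_lt x N⟩ = x := by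
  have h := num_digits N ⟨num x N, num_lt x N⟩
  have h' := num_eq_iff.1 h
  funext l
  rcases lt_or_ge l N with hl | hl
  · exact h' l hl
  · rw [hx l hl, digits_mem_cube N _ l hl]

theorem digits_injective (N : ℕ) : Function.Injective (digits N) := fun i j h =>
  Fin.ext (by rw [← num_digits N i, ← num_digits N j, h])

/-- A self-map of the finite set `cube N` that is injective there comes from a permutation of the
dyadic intervals of level `N`. -/
theorem exists_perm_digits {N : ℕ} {Ψ : (ℕ → Bool) → ℕ → Bool}
    (hm : Set.MapsTo Ψ (cube N) (cube N)) (hi : Set.InjOn Ψ (cube N)) :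
    ∃ σ : Equiv.Perm (Fin (2 ^ N)), ∀ i, digits N (σ i) = Ψ (digits N i) := by
  let f : Fin (2 ^ N) → Fin (2 ^ N) := fun i => ⟨num (Ψ (digits N i)) N, num_lt _ _⟩
  have hf : ∀ i, digits N (f i) = Ψ (digits N i) := fun i => digits_num (hm (digits_mem_cube N i))
  have hinj : Function.Injective f := fun i j h => by
    apply digits_injective N
    apply hi (digits_mem_cube N i) (digits_mem_cube N j)
    rw [← hf, ← hf, h]
  exact ⟨Equiv.ofBijective f (Finite.injective_iff_bijective.1 hinj), hf⟩

/-! ### The norm of a function of the first digits -/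

theorem iUnion_toSet (N : ℕ) :
    (⋃ i : Fin (2 ^ N), DyadicInterval.toSet ⟨N, i⟩) = Set.Ico (0 : ℝ) 1 := by
  ext s
  simp only [Set.mem_iUnion]
  exact ⟨fun ⟨i, hi⟩ => toSet_subset _ hi, exists_mem_toSet N⟩

theorem pairwise_disjoint_toSet (N : ℕ) :
    Pairwise (Function.onFun Disjoint fun i : Fin (2 ^ N) => DyadicInterval.toSet ⟨N, i⟩) := by
  intro i j hij
  rw [Function.onFun, Set.disjoint_left]
  intro s hs hs'
  rw [mem_toSet_iff] at hs hs'
  apply hij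
  rw [hs] at hs'
  exact Fin.ext (by exact_mod_cast hs')

theorem volume_toSet (I : DyadicInterval) : volume I.toSet = ENNReal.ofReal (1 / 2 ^ I.1) := by
  rw [DyadicInterval.toSet, Real.volume_Ico]
  congr 1
  ring

/-- The distribution of a step function. -/
theorem map_of_const_on {N : ℕ} {f : ℝ → ℝ} {v : Fin (2 ^ N) → ℝ}
    (h : ∀ i, ∀ s ∈ DyadicInterval.toSet ⟨N, i⟩, f s = v i) :
    (volume.restrict (Set.Ico (0 : ℝ) 1)).map f
      = Measure.sum fun i => ENNReal.ofReal (1 / 2 ^ N) • Measure.dirac (v i) := by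
  have hms : ∀ i : Fin (2 ^ N), MeasurableSet (DyadicInterval.toSet ⟨N, i⟩) :=
    fun i => measurableSet_Ico
  have hae : ∀ i : Fin (2 ^ N),
      f =ᵐ[volume.restrict (DyadicInterval.toSet ⟨N, i⟩)] fun _ => v i := fun i =>
    (ae_restrict_iff' (hms i)).2 (Eventually.of_forall (h i))
  have hm : AEMeasurable f (Measure.sum fun i : Fin (2 ^ N) =>
      volume.restrict (DyadicInterval.toSet ⟨N, i⟩)) :=
    AEMeasurable.sum_measure fun i => (aemeasurable_const).congr (hae i).symm
  rw [← iUnion_toSet N, Measure.restrict_iUnion (pairwise_disjoint_toSet N) hms,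
    Measure.map_sum hm]
  congr 1
  funext i
  rw [Measure.map_congr (hae i), Measure.map_const]
  simp [volume_toSet]

theorem HaarSystemNorm.nrm_stepFun_perm (Nm : HaarSystemNorm) (N : ℕ) (v : Fin (2 ^ N) → ℝ)
    (σ : Equiv.Perm (Fin (2 ^ N))) :
    Nm.nrm (stepFun N fun i => v (σ i)) = Nm.nrm (stepFun N v) := by
  apply Nm.nrm_eq_of_sameDistribution
  rw [SameDistribution, map_of_const_on (v := fun i => |v (σ i)|)
    fun i s hs => by rw [stepFun_apply N _ i hs], map_of_const_on (v := fun i => |v i|)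
    fun i s hs => by rw [stepFun_apply N _ i hs]]
  rw [Measure.sum_fintype, Measure.sum_fintype]
  exact Equiv.sum_comp σ fun i => ENNReal.ofReal (1 / 2 ^ N) • Measure.dirac |v i|

/-- The norm of the dyadic step function of level `N` obtained by evaluating `g` at the first `N`
binary digits. -/
noncomputable def digitNorm (Nm : HaarSystemNorm) (N : ℕ) : Seminorm ℝ ((ℕ → Bool) → ℝ) :=
  Seminorm.of (fun g => Nm.nrm (stepFun N fun i => g (digits N i)))
    (fun f g => by
      have := stepFun_combo N 1 1 (fun i => f (digits N i)) (fun i => g (digits N i))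
      simp only [one_mul, one_smul] at this
      simp only [Pi.add_apply, this]
      exact map_add_le_add _ _ _)
    (fun c f => by
      have := stepFun_combo N c 0 (fun i => f (digits N i)) (fun i => f (digits N i))
      simp only [zero_mul, zero_smul, add_zero] at this
      simp only [Pi.smul_apply, smul_eq_mul, this]
      exact map_smul_eq_mul _ _ _)

theorem digitNorm_apply (Nm : HaarSystemNorm) (N : ℕ) (g : (ℕ → Bool) → ℝ) :
    digitNorm Nm N g = Nm.nrm (stepFun N fun i => g (digits N i)) := rfl

theorem digitNorm_mono (Nm : HaarSystemNorm) {N : ℕ} {f g : (ℕ → Bool) → ℝ}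
    (h : ∀ x ∈ cube N, |f x| ≤ |g x|) : digitNorm Nm N f ≤ digitNorm Nm N g :=
  Nm.nrm_stepFun_mono N fun i => h _ (digits_mem_cube N i)

/-- The norm of `X` is invariant under permutations of the dyadic intervals of a level. -/
theorem digitNorm_comp (Nm : HaarSystemNorm) {N : ℕ} {Ψ : (ℕ → Bool) → ℕ → Bool}
    (hm : Set.MapsTo Ψ (cube N) (cube N)) (hi : Set.InjOn Ψ (cube N)) (g : (ℕ → Bool) → ℝ) :
    digitNorm Nm N (fun x => g (Ψ x)) = digitNorm Nm N g := by
  obtain ⟨σ, hσ⟩ := exists_perm_digits hm hi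
  rw [digitNorm_apply, digitNorm_apply, ← Nm.nrm_stepFun_perm N (fun i => g (digits N i)) σ]
  simp only [hσ]

theorem digitNorm_one (Nm : HaarSystemNorm) (N : ℕ) : digitNorm Nm N (fun _ => 1) = 1 := by
  have h1 := ((isStep_chi DyadicInterval.unit).mono (Nat.zero_le N)).eq_stepFun
  have h2 : (fun _ : Fin (2 ^ N) => (1 : ℝ))
      = fun i : Fin (2 ^ N) => DyadicInterval.unit.chi ((i : ℕ) / 2 ^ N) := by
    classical
    funext i
    have h := endpoint_mem N i
    simp only [DyadicInterval.chi, DyadicInterval.unit, DyadicInterval.toSet, Set.indicator_apply]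
    rw [if_pos (by simpa using h)]
    rfl
  refine Eq.trans ?_ Nm.nrm_unit
  rw [digitNorm_apply, h2]
  exact congrArg _ (Subtype.ext h1.symm)

/-- The integral over `[0,1)` of a function of the first `N` digits is an average. -/
theorem integral_digits {N : ℕ} {g : (ℕ → Bool) → ℝ}
    (h : ∀ x y : ℕ → Bool, (∀ l < N, x l = y l) → g x = g y) :
    ∫ u in Set.Ico (0 : ℝ) 1, g (bitsOf u) = (1 / 2 ^ N) * ∑ i, g (digits N i) := by
  have hms : ∀ i : Fin (2 ^ N), MeasurableSet (DyadicInterval.toSet ⟨N, i⟩) :=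
    fun i => measurableSet_Ico
  have hc : ∀ i : Fin (2 ^ N), ∀ s ∈ DyadicInterval.toSet ⟨N, i⟩,
      g (bitsOf s) = g (digits N i) := by
    intro i s hs
    apply h
    rw [← num_eq_iff, num_digits, (mem_toSet_iff_num (toSet_subset _ hs) _).1 hs]
  have hint : ∀ i : Fin (2 ^ N), IntegrableOn (fun u => g (bitsOf u))
      (DyadicInterval.toSet ⟨N, i⟩) := fun i => by
    rw [integrableOn_congr_fun (hc i) (hms i)]
    apply integrableOn_const
    · rw [volume_toSet]
      exact ENNReal.ofReal_ne_top
    · simp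
  rw [← iUnion_toSet N, integral_iUnion_fintype hms (pairwise_disjoint_toSet N) hint,
    Finset.mul_sum]
  apply Finset.sum_congr rfl
  intro i _
  rw [setIntegral_congr_fun (hms i) (hc i), setIntegral_const, Measure.real, volume_toSet,
    ENNReal.toReal_ofReal (by positivity), smul_eq_mul]

/-! ### The norm of `Y` in terms of binary digits -/

/-- An injective relabeling of finitely many digits extends to a bijection of `cube N`. -/
theorem exists_relabel {S : Finset ℕ} {f : ℕ → ℕ} (hf : Set.InjOn f S) {N : ℕ}
    (hS : ∀ l ∈ S, l < N) (hfS : ∀ l ∈ S, f l < N) :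
    ∃ p : ℕ → ℕ, (∀ l ∈ S, p l = f l) ∧
      Set.MapsTo (fun x : ℕ → Bool => x ∘ p) (cube N) (cube N) ∧
      Set.InjOn (fun x : ℕ → Bool => x ∘ p) (cube N) := by
  classical
  obtain ⟨g, hg⟩ := Finset.exists_equiv_extend_of_card_eq (α := Fin N) (t := Finset.range N)
    (by simp) (s := Finset.univ.filter fun i : Fin N => (i : ℕ) ∈ S) (f := fun i => f i)
    (by
      intro y hy
      simp only [Finset.mem_image, Finset.mem_filter, Finset.mem_univ, true_and] at hy
      obtain ⟨i, hi, rfl⟩ := hy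
      exact Finset.mem_range.2 (hfS _ hi))
    (by
      intro i hi j hj hij
      simp only [Finset.coe_filter, Finset.mem_univ, true_and, Set.mem_ofPred_eq] at hi hj
      exact Fin.ext (hf hi hj hij))
  refine ⟨fun l => if h : l < N then g ⟨l, h⟩ else l, fun l hl => ?_, fun x hx l hl => ?_,
    fun x hx y hy hxy => ?_⟩
  · have := hg ⟨l, hS l hl⟩ (by simpa using hl)
    simpa [hS l hl] using this
  · simpa [Nat.not_lt.2 hl] using hx l hl
  · funext c
    rcases lt_or_ge c N with hc | hc
    · have := congrFun hxy (g.symm ⟨c, Finset.mem_range.2 hc⟩)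
      simpa using this
    · rw [hx c hc, hy c hc]

/-- The lattice seminorm on finitely supported sequences which, applied for each `s` to the sequence
of the values at `s` of the level-`k` parts of a function, gives the integrand
`s ↦ ∫₀¹ |∑_I r_I(u) a_I h_I(s)| du` of the norm of `X(𝐫)`. -/
noncomputable def levelNorm : RademacherKind → Seminorm ℝ (ℕ →₀ ℝ)
  | .constant => Seminorm.of (fun v => |v.sum fun _ c => c|)
      (fun v w => by
        rw [Finsupp.sum_add_index' (by simp) (by simp)]
        exact abs_add_le _ _)
      (fun c v => by
        rw [Finsupp.sum_smul_index' (by simp), ← Finsupp.smul_sum, smul_eq_mul, abs_mul,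
          Real.norm_eq_abs])
  | .independent => Seminorm.of
      (fun v => ∫ u in Set.Ico (0 : ℝ) 1, |v.sum fun k c => rademacher k u * c|)
      (fun v w => by
        have hint : ∀ v : ℕ →₀ ℝ, IntegrableOn (fun u => |v.sum fun k c => rademacher k u * c|)
            (Set.Ico (0 : ℝ) 1) := fun v => by
          apply Integrable.abs
          apply integrable_finsetSum
          intro k _
          exact (integrable_rademacher k).mul_const _
        rw [← integral_add (hint v) (hint w)]
        refine integral_mono (hint _) ((hint v).add (hint w)) fun u => ?_
        simp only
        rw [Finsupp.sum_add_index' (by simp) (by intros; ring)]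
        exact abs_add_le _ _)
      (fun c v => by
        rw [← integral_const_mul]
        congr 1
        funext u
        rw [Finsupp.sum_smul_index' (by simp), Real.norm_eq_abs, ← abs_mul, Finsupp.mul_sum]
        congr 1
        exact Finset.sum_congr rfl fun k _ => by simp only [smul_eq_mul]; ring)

theorem levelNorm_constant (v : ℕ →₀ ℝ) :
    levelNorm .constant v = |v.sum fun _ c => c| := rfl

theorem levelNorm_independent (v : ℕ →₀ ℝ) :
    levelNorm .independent v = ∫ u in Set.Ico (0 : ℝ) 1, |v.sum fun k c => rademacher k u * c| :=
  rfl

theorem levelNorm_single (r : RademacherKind) (k : ℕ) (c : ℝ) :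
    levelNorm r (Finsupp.single k c) = |c| := by
  cases r
  · rw [levelNorm_independent]
    have : ∀ u ∈ Set.Ico (0 : ℝ) 1,
        |(Finsupp.single k c).sum fun k c => rademacher k u * c| = |c| := by
      intro u hu
      rw [Finsupp.sum_single_index (by simp), rademacher_eq hu, abs_mul, abs_sgn, one_mul]
    rw [setIntegral_congr_fun measurableSet_Ico this]
    simp
  · rw [levelNorm_constant, Finsupp.sum_single_index rfl]

/-- The joint distribution of finitely many Rademacher functions does not depend on their
numbers. -/
theorem levelNorm_mapDomain (r : RademacherKind) {v : ℕ →₀ ℝ} {f : ℕ → ℕ}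
    (hf : Set.InjOn f v.support) : levelNorm r (v.mapDomain f) = levelNorm r v := by
  cases r
  · rw [levelNorm_independent, levelNorm_independent]
    let N := v.support.sup id + v.support.sup f + 1
    have hS : ∀ l ∈ v.support, l < N := fun l hl => by
      have : id l ≤ v.support.sup id := Finset.le_sup hl
      simp only [id] at this
      omega
    have hfS : ∀ l ∈ v.support, f l < N := fun l hl => by
      have : f l ≤ v.support.sup f := Finset.le_sup hl
      omega
    obtain ⟨p, hp, hm, hi⟩ := exists_relabel hf hS hfS
    obtain ⟨σ, hσ⟩ := exists_perm_digits hm hi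
    have h1 : ∀ u ∈ Set.Ico (0 : ℝ) 1, |(v.mapDomain f).sum fun k c => rademacher k u * c|
        = |∑ k ∈ v.support, sgn (bitsOf u (f k)) * v k| := by
      intro u hu
      rw [Finsupp.sum_mapDomain_index (by simp) (by intros; ring), Finsupp.sum]
      simp only [rademacher_eq hu]
    have h2 : ∀ u ∈ Set.Ico (0 : ℝ) 1, |v.sum fun k c => rademacher k u * c|
        = |∑ k ∈ v.support, sgn (bitsOf u k) * v k| := by
      intro u hu
      rw [Finsupp.sum]
      simp only [rademacher_eq hu]
    rw [setIntegral_congr_fun measurableSet_Ico h1, setIntegral_congr_fun measurableSet_Ico h2]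
    rw [integral_digits (N := N) (g := fun x => |∑ k ∈ v.support, sgn (x (f k)) * v k|),
      integral_digits (N := N) (g := fun x => |∑ k ∈ v.support, sgn (x k) * v k|)]
    · rw [← Equiv.sum_comp σ fun i => |∑ k ∈ v.support, sgn (digits N i k) * v k|]
      congr 1
      apply Finset.sum_congr rfl
      intro i _
      rw [hσ]
      congr 1
      apply Finset.sum_congr rfl
      intro k hk
      simp only [Function.comp, hp k hk]
    · intro x y hxy
      congr 1
      exact Finset.sum_congr rfl fun k hk => by rw [hxy k (hS k hk)]
    · intro x y hxy
      congr 1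
      exact Finset.sum_congr rfl fun k hk => by rw [hxy _ (hfS k hk)]
  · rw [levelNorm_constant, levelNorm_constant, Finsupp.sum_mapDomain_index (by simp) (by simp)]

/-- The sequence of the values, at the point with binary digits `x`, of the level-`k` parts of the
function `∑_K c_K h_K`. -/
noncomputable def levelValues (x : ℕ → Bool) : (DyadicInterval →₀ ℝ) →ₗ[ℝ] ℕ →₀ ℝ :=
  Finsupp.linearCombination ℝ fun K => Finsupp.single K.1 (haarBits K x)

/-- At a fixed point `s`, only one Haar function of each level does not vanish. So the intervals
can be relabeled by their levels, and both kinds of families `𝐫` lead to a norm of the sequence of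
the values of the levels. -/
theorem averagedAbs_eq (r : RademacherKind) (c : DyadicInterval →₀ ℝ) {s : ℝ}
    (hs : s ∈ Set.Ico (0 : ℝ) 1) :
    averagedAbs r (c.mapDomain some) s = levelNorm r (levelValues (bitsOf s) c) := by
  have hsum : ∀ u, ((c.mapDomain some).sum fun I a => r.family I u * a * haarPlus I s)
      = ∑ K ∈ c.support, r.family (some K) u * c K * haarBits K (bitsOf s) := by
    intro u
    rw [Finsupp.sum_mapDomain_index (by simp) (by intros; ring), Finsupp.sum]
    simp only [haarPlus, haar_eq_haarBits hs]
  have hval : ∀ F : ℕ → ℝ, (levelValues (bitsOf s) c).sum (fun k v => F k * v)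
      = ∑ K ∈ c.support, F K.1 * (c K * haarBits K (bitsOf s)) := by
    intro F
    rw [levelValues, Finsupp.linearCombination_apply,
      Finsupp.sum_sum_index (by simp) (by intros; ring)]
    apply Finset.sum_congr rfl
    intro K _
    simp only [Finsupp.smul_single, smul_eq_mul]
    exact Finsupp.sum_single_index (by simp)
  simp only [averagedAbs, hsum]
  cases r
  · -- `f k` is the number `ι(I)` of the interval `I` of level `k` that contains `s`.
    let f : ℕ → ℕ := fun k => 2 ^ k + num (bitsOf s) k
    have hf : Function.Injective f := by
      apply StrictMono.injective
      apply strictMono_nat_of_lt_succ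
      intro k
      have := num_lt (bitsOf s) k
      simp only [f, pow_succ]
      omega
    rw [← levelNorm_mapDomain _ hf.injOn, levelNorm_independent]
    congr 1
    funext u
    rw [Finsupp.sum_mapDomain_index (by simp) (by intros; ring)]
    rw [hval fun k => rademacher (f k) u]
    congr 1
    apply Finset.sum_congr rfl
    intro K _
    by_cases h : num (bitsOf s) K.1 = K.2
    · simp only [RademacherKind.family, iota, f, h]; ring
    · simp [haarBits, h]
  · have := hval fun _ => 1
    simp only [one_mul] at this
    rw [levelNorm_constant, this]
    have h2 : ∀ u ∈ Set.Ico (0 : ℝ) 1, |∑ K ∈ c.support,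
        RademacherKind.constant.family (some K) u * c K * haarBits K (bitsOf s)|
        = |∑ K ∈ c.support, c K * haarBits K (bitsOf s)| := by
      intro u hu
      simp only [RademacherKind.family, mul_assoc, ← Finset.mul_sum, abs_mul, rademacher_eq hu,
        abs_sgn, one_mul]
    rw [setIntegral_congr_fun measurableSet_Ico h2]
    simp

/-- The inclusion of `Y` into `X(𝐫)`. -/
noncomputable def YSpace.incl (Nm : HaarSystemNorm) (r : RademacherKind) :
    YSpace Nm r →ₗᵢ[ℝ] XSpace Nm r :=
  (XZero Nm r).subtypeₗᵢ

/-- The norm of a finite combination of Haar functions in `Y`, computed on the dyadic intervals of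
any level `N` that is fine enough. -/
theorem norm_sum_haarY (Nm : HaarSystemNorm) (r : RademacherKind) (c : DyadicInterval →₀ ℝ) :
    ∀ᶠ N in atTop, ‖Finsupp.linearCombination ℝ (haarY Nm r) c‖
      = digitNorm Nm N fun x => levelNorm r (levelValues x c) := by
  have h1 : ‖Finsupp.linearCombination ℝ (haarY Nm r) c‖
      = hardySeminorm Nm r (c.mapDomain some) := by
    have h2 : YSpace.incl Nm r (Finsupp.linearCombination ℝ (haarY Nm r) c)
        = toX Nm r (show HardyPre Nm r from c.mapDomain some) := by
      induction c using Finsupp.induction_linear with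
      | zero =>
        rw [map_zero, map_zero, Finsupp.mapDomain_zero]
        exact (map_zero (toX Nm r)).symm
      | add c d hc hd =>
        rw [map_add, map_add, hc, hd, Finsupp.mapDomain_add]
        exact (map_add (toX Nm r) _ _).symm
      | single K a =>
        rw [Finsupp.linearCombination_single, map_smul, Finsupp.mapDomain_single]
        change a • toX Nm r _ = _
        rw [← map_smul]
        congr 1
        change a • Finsupp.single (some K) (1 : ℝ) = Finsupp.single (some K) a
        rw [Finsupp.smul_single_one]
    rw [← (YSpace.incl Nm r).norm_map, h2, LinearIsometry.norm_map]
    rfl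
  obtain ⟨n, hn⟩ := exists_isStep_of_mem_H (averagedAbs_mem_H r (c.mapDomain some))
  filter_upwards [eventually_ge_atTop n] with N hN
  rw [h1, digitNorm_apply]
  change Nm.nrm ⟨_, _⟩ = _
  congr 1
  apply Subtype.ext
  refine (hn.mono hN).eq_stepFun.trans ?_
  congr 2
  funext i
  exact averagedAbs_eq r c (endpoint_mem N i)

/-! ### The abstract model of an independent sum -/

/-- The node of level `j` of the binary tree below which the path `x` runs. -/
def pre (x : ℕ → Bool) (j : ℕ) : Fin j → Bool := fun i => x i

/-- A node of the binary tree, continued to a path by zeros. -/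
def ext {j : ℕ} (K : Fin j → Bool) : ℕ → Bool := fun l => if h : l < j then K ⟨l, h⟩ else false

@[simp] theorem pre_ext {j : ℕ} (K : Fin j → Bool) : pre (ext K) j = K := by
  funext i
  simp [pre, ext]

theorem pre_eq_pre {x y : ℕ → Bool} {j : ℕ} : pre x j = pre y j ↔ ∀ l < j, x l = y l :=
  ⟨fun h l hl => congrFun h ⟨l, hl⟩, fun h => funext fun i => h i i.2⟩

theorem num_ext_eq_iff {x : ℕ → Bool} {j : ℕ} {K : Fin j → Bool} :
    num x j = num (ext K) j ↔ pre x j = K := by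
  rw [num_eq_iff, ← pre_eq_pre, pre_ext]

/-- The index `(n, I)` of a basis vector `h_I^n`, where `I ∈ 𝒟_j`, `j ≤ n`, is given as the
sequence `K` of left-right choices that lead from `[0,1)` to `I`. -/
structure Idx where
  n : ℕ
  j : ℕ
  le : j ≤ n
  K : Fin j → Bool

/-- A point of the probability space on which the independent sum is modelled: the digit
`w (n, j)` is the value of the `j`-th Rademacher function of the `n`-th block. -/
abbrev Bits : Type := ℕ × ℕ → Bool

/-- The digits of the `n`-th block. -/
def Bits.block (w : Bits) (n : ℕ) : ℕ → Bool := fun i => w (n, i)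

/-- The Haar function of a node, as a function of the path. -/
def haarNode {j : ℕ} (K : Fin j → Bool) (x : ℕ → Bool) : ℝ :=
  if pre x j = K then sgn (x j) else 0

/-- For the scalars `a`, the family of the values at `w` of the parts of `∑ a_q h_q` that belong to
the single levels of the blocks. -/
noncomputable def values (w : Bits) : (Idx →₀ ℝ) →ₗ[ℝ] ℕ × ℕ →₀ ℝ :=
  Finsupp.linearCombination ℝ fun q => Finsupp.single (q.n, q.j) (haarNode q.K (w.block q.n))

/-- Finite exhaustion of `Bits` by cubes. -/
def bcube (N : ℕ) : Set Bits := {w | ∀ c, N ≤ Nat.pair c.1 c.2 → w c = false}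

/-- The structure of the norm of an independent sum: a rearrangement invariant function norm on the
probability space `Bits`, truncated to finite cubes, applied to a norm of the family of the values
of the single levels which is invariant under relabelings of the levels. -/
structure Model {E : Type*} [NormedAddCommGroup E] [NormedSpace ℝ E] (e : Idx → E) where
  rho : ℕ → Seminorm ℝ (Bits → ℝ)
  rho_mono : ∀ {N : ℕ} {f g : Bits → ℝ}, (∀ w ∈ bcube N, |f w| ≤ |g w|) → rho N f ≤ rho N g
  rho_one : ∀ N, rho N (fun _ => 1) = 1
  rho_comp : ∀ {N : ℕ} {Ψ : Bits → Bits}, Set.MapsTo Ψ (bcube N) (bcube N) →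
    Set.InjOn Ψ (bcube N) → ∀ g : Bits → ℝ, rho N (fun w => g (Ψ w)) = rho N g
  G : Seminorm ℝ (ℕ × ℕ →₀ ℝ)
  G_single : ∀ c a, G (Finsupp.single c a) = |a|
  G_mapDomain : ∀ {v : ℕ × ℕ →₀ ℝ} {f : ℕ × ℕ → ℕ × ℕ}, Set.InjOn f v.support →
    G (v.mapDomain f) = G v
  norm_eq : ∀ a : Idx →₀ ℝ, ∀ᶠ N in atTop,
    ‖Finsupp.linearCombination ℝ e a‖ = rho N fun w => G (values w a)

/-! ### The model of `Y_ω` -/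

theorem mem_level_iff {n : ℕ} {K : DyadicInterval} : K ∈ level n ↔ K.1 = n := by
  simp only [level, Finset.mem_map, Finset.mem_univ, true_and]
  constructor
  · rintro ⟨i, rfl⟩; rfl
  · rintro rfl; exact ⟨K.2, rfl⟩

/-- The function `∑_{K ∈ 𝓑_I} h_K` in terms of binary digits. -/
theorem sum_haar_of_mem_iff {k : ℕ → ℕ} {j i : ℕ} (hk : ∀ l < j, k l < k j)
    {B : Finset DyadicInterval}
    (hB : ∀ K, K ∈ B ↔ K.1 = k j ∧ ∀ s ∈ K.toSet, num (bitsOf s ∘ k) j = i)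
    {s : ℝ} (hs : s ∈ Set.Ico (0 : ℝ) 1) :
    ∑ K ∈ B, K.haar s = if num (bitsOf s ∘ k) j = i then sgn (bitsOf s (k j)) else 0 := by
  classical
  let K₀ : DyadicInterval := ⟨k j, ⟨num (bitsOf s) (k j), num_lt _ _⟩⟩
  have hs0 : s ∈ K₀.toSet := (mem_toSet_iff_num hs K₀).2 rfl
  have h0 : ∀ K ∈ B, K ≠ K₀ → K.haar s = 0 := by
    rintro ⟨n, m⟩ hK hne
    obtain ⟨rfl, -⟩ : n = k j ∧ _ := (hB _).1 hK
    rw [haar_eq_haarBits hs, haarBits, if_neg]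
    intro h
    exact hne (by simp only [K₀]; congr 1; exact Fin.ext h.symm)
  have hval : K₀.haar s = sgn (bitsOf s (k j)) := by
    rw [haar_eq_haarBits hs, haarBits, if_pos rfl]
  have hmem : K₀ ∈ B ↔ num (bitsOf s ∘ k) j = i := by
    rw [hB]
    refine ⟨fun h => h.2 s hs0, fun h => ⟨rfl, fun t ht => ?_⟩⟩
    rw [← h, num_eq_iff]
    intro l hl
    have := (mem_toSet_iff_num (toSet_subset _ ht) K₀).1 ht
    exact num_eq_iff.1 this _ (hk l hl)
  split_ifs with h
  · rw [Finset.sum_eq_single_of_mem K₀ (hmem.2 h) h0, hval]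
  · exact Finset.sum_eq_zero fun K hK => h0 K hK fun hKK => h (hmem.1 (hKK ▸ hK))

/-- The collection of the `i`-th interval of level `j` consists of the intervals of level `k j` on
which the digits number `k 0, …, k (j - 1)` are the binary digits of `i`. -/
theorem mem_blockCollection_iff {k : ℕ → ℕ} {j : ℕ} (hk : ∀ l < j, k l < k (l + 1)) :
    ∀ i < 2 ^ j, ∀ K, K ∈ blockCollection k j i ↔
      K.1 = k j ∧ ∀ s ∈ K.toSet, num (bitsOf s ∘ k) j = i := by
  classical
  induction j with
  | zero =>
    intro i hi K
    have : i = 0 := by simpa using hi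
    subst this
    simp [blockCollection, mem_level_iff, num]
  | succ j ih =>
    intro i hi K
    have hmono : ∀ l < j, k l < k j := by
      intro l hl
      have key : ∀ m, l < m → m ≤ j → k l < k m := by
        intro m hm
        induction m, hm using Nat.le_induction with
        | base => exact fun h => hk l (by omega)
        | succ m hm ih' => exact fun h => (ih' (by omega)).trans (hk m (by omega))
      exact key j hl le_rfl
    have hB := ih (fun l hl => hk l (by omega)) (i / 2) (by rw [pow_succ] at hi; omega)
    rw [blockCollection, Finset.mem_filter, mem_level_iff]
    refine and_congr_right fun hK => forall_congr' fun s => forall_congr' fun hs => ?_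
    rw [sum_haar_of_mem_iff hmono hB (toSet_subset _ hs)]
    simp only [num, Function.comp]
    by_cases h : num (bitsOf s ∘ k) j = i / 2
    · rw [if_pos h, h]
      rcases Nat.even_or_odd i with he | ho
      · rw [if_pos he]
        obtain ⟨c, rfl⟩ := he
        cases bitsOf s (k j) <;> simp [sgn] <;> norm_num <;> omega
      · rw [if_neg (Nat.not_even_iff_odd.2 ho)]
        obtain ⟨c, rfl⟩ := ho
        cases bitsOf s (k j) <;> simp [sgn] <;> norm_num <;> omega
    · rw [if_neg h]
      constructor
      · split_ifs <;> norm_num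
      · intro h'
        exfalso
        have := Bool.toNat_le (bitsOf s (k j))
        omega

/-- The position in `τ n`, hence the level in the Haar system, of the `j`-th Rademacher function of
the `n`-th block. -/
noncomputable def freq (τ : ℕ → Finset ℕ) (n j : ℕ) : ℕ := Nat.nth (· ∈ τ n) j

theorem freq_lt {τ : ℕ → Finset ℕ} (hτ_card : ∀ n, (τ n).card = n + 1) {n i j : ℕ} (hij : i < j)
    (hj : j ≤ n) :
    freq τ n i < freq τ n j := by
  have hf : (Set.ofPred (· ∈ τ n)).Finite := (τ n).finite_toSet
  apply Nat.nth_lt_nth_of_lt_card hf hij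
  have : hf.toFinset = τ n := by ext; simp
  rw [this, hτ_card]
  omega

theorem freq_mem {τ : ℕ → Finset ℕ} (hτ_card : ∀ n, (τ n).card = n + 1) {n j : ℕ} (hj : j ≤ n) :
    freq τ n j ∈ τ n := by
  have hf : (Set.ofPred (· ∈ τ n)).Finite := (τ n).finite_toSet
  have := Nat.nth_mem (p := (· ∈ τ n)) j
  apply this
  intro hf'
  have : hf'.toFinset = τ n := by ext; simp
  rw [this, hτ_card]
  omega

theorem freq_inj {τ : ℕ → Finset ℕ} (hτ_card : ∀ n, (τ n).card = n + 1)
    (hτ_disj : ∀ m n, m ≠ n → Disjoint (τ m) (τ n)) {m n i j : ℕ} (hi : i ≤ m) (hj : j ≤ n)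
    (h : freq τ m i = freq τ n j) :
    m = n ∧ i = j := by
  have hmn : m = n := by
    by_contra hne
    exact Finset.disjoint_left.1 (hτ_disj m n hne) (freq_mem hτ_card hi)
      (h ▸ freq_mem hτ_card hj)
  subst hmn
  refine ⟨rfl, ?_⟩
  rcases lt_trichotomy i j with hij | hij | hij
  · exact absurd h (freq_lt hτ_card hij hj).ne
  · exact hij
  · exact absurd h (freq_lt hτ_card hij hi).ne'

theorem digitNorm_congr (Nm : HaarSystemNorm) {N : ℕ} {f g : (ℕ → Bool) → ℝ}
    (h : ∀ x ∈ cube N, f x = g x) : digitNorm Nm N f = digitNorm Nm N g :=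
  le_antisymm (digitNorm_mono Nm fun x hx => by rw [h x hx])
    (digitNorm_mono Nm fun x hx => by rw [h x hx])

/-- The index `(n, I)` in the notation by dyadic intervals. -/
def omegaIdx (q : Idx) : DyadicOmega :=
  ⟨q.n, ⟨⟨q.j, ⟨num (ext q.K) q.j, num_lt _ _⟩⟩, q.le⟩⟩

theorem exists_num_eq {j i : ℕ} (hi : i < 2 ^ j) : ∃ x, num x j = i :=
  ⟨digits j ⟨i, hi⟩, num_digits j ⟨i, hi⟩⟩

theorem omegaIdx_surjective : Function.Surjective omegaIdx := by
  rintro ⟨n, ⟨⟨j, ⟨i, hi⟩⟩, hj⟩⟩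
  obtain ⟨x, rfl⟩ := exists_num_eq hi
  refine ⟨⟨n, j, hj, pre x j⟩, ?_⟩
  have : num (ext (pre x j)) j = num x j := (num_ext_eq_iff.2 rfl).symm
  simp [omegaIdx, this]

section OmegaBasis

variable (Nm : HaarSystemNorm) (r : RademacherKind) (τ : ℕ → Finset ℕ)

/-- The canonical basis of `Y_ω`. -/
noncomputable def omegaBasis (q : Idx) : YOmega Nm r τ := hOmega Nm r τ (omegaIdx q)

/-- The inclusion of `Y_ω` into `Y`. -/
noncomputable def YOmega.incl : YOmega Nm r τ →ₗᵢ[ℝ] YSpace Nm r :=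
  (closedSpanOmega Nm r τ).subtypeₗᵢ

instance : CompleteSpace (YSpace Nm r) :=
  (Submodule.isClosed_topologicalClosure _).completeSpace_coe

instance : CompleteSpace (YOmega Nm r τ) :=
  (Submodule.isClosed_topologicalClosure _).completeSpace_coe

theorem denseRange_linearCombination_omegaBasis :
    DenseRange (Finsupp.linearCombination ℝ (omegaBasis Nm r τ)) := by
  have h1 : Set.range (Finsupp.linearCombination ℝ (omegaBasis Nm r τ))
      = YOmega.incl Nm r τ ⁻¹' (Submodule.span ℝ (Set.range (hY Nm r τ)) : Set (YSpace Nm r)) := by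
    rw [← LinearMap.coe_range, Finsupp.range_linearCombination]
    have h2 : Set.range (hY Nm r τ) = YOmega.incl Nm r τ '' Set.range (omegaBasis Nm r τ) := by
      rw [← Set.range_comp]
      change _ = Set.range (hY Nm r τ ∘ omegaIdx)
      rw [omegaIdx_surjective.range_comp]
    rw [h2]
    change _ = YOmega.incl Nm r τ ⁻¹' (Submodule.span ℝ
      ((YOmega.incl Nm r τ).toLinearMap '' Set.range (omegaBasis Nm r τ)))
    rw [Submodule.span_image, Submodule.map_coe]
    exact (Set.preimage_image_eq _ (YOmega.incl Nm r τ).injective).symm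
  rw [DenseRange, h1]
  intro x
  rw [(YOmega.incl Nm r τ).isometry.isUniformInducing.isInducing.closure_eq_preimage_closure_image,
    Set.mem_preimage, Set.image_preimage_eq_of_subset]
  · exact x.2
  · intro y hy
    exact ⟨(⟨y, Submodule.le_topologicalClosure _ hy⟩ : closedSpanOmega Nm r τ), rfl⟩

/-- The coefficients of `h_I^n` with respect to the Haar system. -/
noncomputable def haarCoeff : (Idx →₀ ℝ) →ₗ[ℝ] DyadicInterval →₀ ℝ :=
  Finsupp.linearCombination ℝ fun q =>
    ∑ L ∈ blockCollection (freq τ q.n) q.j (num (ext q.K) q.j), Finsupp.single L 1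

theorem incl_linearCombination (a : Idx →₀ ℝ) :
    YOmega.incl Nm r τ (Finsupp.linearCombination ℝ (omegaBasis Nm r τ) a)
      = Finsupp.linearCombination ℝ (haarY Nm r) (haarCoeff τ a) := by
  induction a using Finsupp.induction_linear with
  | zero => simp
  | add c d hc hd => rw [map_add, map_add, hc, hd, map_add, map_add]
  | single K a =>
    rw [Finsupp.linearCombination_single, map_smul, haarCoeff, Finsupp.linearCombination_single,
      map_smul, map_sum]
    simp only [Finsupp.linearCombination_single, one_smul]
    rfl

variable {τ}

theorem sum_haarBits_block (hτ_card : ∀ n, (τ n).card = n + 1) (q : Idx) {N : ℕ} {x : ℕ → Bool}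
    (hx : x ∈ cube N) :
    ∑ L ∈ blockCollection (freq τ q.n) q.j (num (ext q.K) q.j), haarBits L x
      = haarNode q.K (x ∘ freq τ q.n) := by
  have hs := endpoint_mem N ⟨num x N, num_lt x N⟩
  have hbits : bitsOf ((((⟨num x N, num_lt x N⟩ : Fin (2 ^ N)) : ℕ) : ℝ) / 2 ^ N) = x :=
    digits_num hx
  have hle := q.le
  have h1 : ∀ l < q.j, freq τ q.n l < freq τ q.n q.j := fun l hl => freq_lt hτ_card hl hle
  have h2 := mem_blockCollection_iff (k := freq τ q.n) (j := q.j)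
    (fun l hl => freq_lt hτ_card (Nat.lt_succ_self l) (by omega)) _ (num_lt (ext q.K) q.j)
  have h3 := sum_haar_of_mem_iff h1 h2 hs
  simp only [haar_eq_haarBits hs, hbits] at h3
  rw [h3, haarNode]
  simp only [num_ext_eq_iff, Function.comp]

theorem levelValues_haarCoeff (hτ_card : ∀ n, (τ n).card = n + 1) (a : Idx →₀ ℝ) {N : ℕ}
    {x : ℕ → Bool} (hx : x ∈ cube N) :
    levelValues x (haarCoeff τ a) = Finsupp.linearCombination ℝ
      (fun q => Finsupp.single (freq τ q.n q.j) (haarNode q.K (x ∘ freq τ q.n))) a := by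
  induction a using Finsupp.induction_linear with
  | zero => simp
  | add c d hc hd => rw [map_add, map_add, hc, hd, map_add]
  | single q a =>
    rw [haarCoeff, Finsupp.linearCombination_single, Finsupp.linearCombination_single, map_smul,
      map_sum, ← sum_haarBits_block hτ_card q hx]
    congr 1
    rw [Finsupp.single_finsetSum]
    refine Finset.sum_congr rfl fun L hL => ?_
    rw [levelValues, Finsupp.linearCombination_single, one_smul]
    have hle := q.le
    have h2 := mem_blockCollection_iff (k := freq τ q.n) (j := q.j)
      (fun l hl => freq_lt hτ_card (Nat.lt_succ_self l) (by omega)) _ (num_lt (ext q.K) q.j)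
    rw [((h2 L).1 hL).1]

theorem sum_haarNode (j : ℕ) (x : ℕ → Bool) : ∑ K : Fin j → Bool, haarNode K x = sgn (x j) := by
  simp [haarNode]

/-- The sum of the vectors `h_I^n`, `I ∈ 𝒟_j`, is a Rademacher function. -/
theorem incl_sum_omegaBasis (hτ_card : ∀ n, (τ n).card = n + 1) {n j : ℕ} (hj : j ≤ n) :
    YOmega.incl Nm r τ (∑ K : Fin j → Bool, omegaBasis Nm r τ ⟨n, j, hj, K⟩)
      = rademacherY Nm r (freq τ n j) := by
  let a : Idx →₀ ℝ := ∑ K : Fin j → Bool, Finsupp.single ⟨n, j, hj, K⟩ 1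
  let c : DyadicInterval →₀ ℝ := ∑ i, Finsupp.single ⟨freq τ n j, i⟩ 1
  have ha : Finsupp.linearCombination ℝ (omegaBasis Nm r τ) a
      = ∑ K : Fin j → Bool, omegaBasis Nm r τ ⟨n, j, hj, K⟩ := by
    simp [a]
  have hc : Finsupp.linearCombination ℝ (haarY Nm r) c = rademacherY Nm r (freq τ n j) := by
    simp [c, rademacherY]
  rw [← ha, ← hc, incl_linearCombination, ← sub_eq_zero, ← map_sub, ← norm_eq_zero]
  obtain ⟨N, hN⟩ := (norm_sum_haarY Nm r (haarCoeff τ a - c)).exists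
  rw [hN, ← map_zero (digitNorm Nm N)]
  apply digitNorm_congr
  intro x hx
  have h1 : levelValues x (haarCoeff τ a) = Finsupp.single (freq τ n j) (sgn (x (freq τ n j))) := by
    rw [levelValues_haarCoeff hτ_card a hx, map_sum]
    simp only [Finsupp.linearCombination_single, one_smul]
    rw [← Finsupp.single_finsetSum, sum_haarNode]
    rfl
  have h2 : levelValues x c = Finsupp.single (freq τ n j) (sgn (x (freq τ n j))) := by
    simp only [c, map_sum, levelValues, Finsupp.linearCombination_single, one_smul]
    rw [← Finsupp.single_finsetSum]
    congr 1
    rw [Finset.sum_eq_single ⟨num x _, num_lt x _⟩]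
    · simp [haarBits]
    · intro i _ hi
      rw [haarBits, if_neg]
      exact fun h => hi (Fin.ext h.symm)
    · simp
  rw [map_sub, h1, h2, sub_self, map_zero]
  rfl

/-- The Rademacher functions of a fixed level of the blocks form a weakly null sequence. -/
theorem tendsto_sum_omegaBasis (hτ_card : ∀ n, (τ n).card = n + 1)
    (hτ_disj : ∀ m n, m ≠ n → Disjoint (τ m) (τ n)) (hr : WeaklyNull (rademacherY Nm r)) (j : ℕ)
    (φ : YOmega Nm r τ →L[ℝ] ℝ) :
    Tendsto (fun m => φ (∑ K : Fin j → Bool,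
      omegaBasis Nm r τ ⟨j + m, j, Nat.le_add_right j m, K⟩)) atTop (𝓝 0) := by
  obtain ⟨ψ, hψ, -⟩ := exists_extension_norm_eq (𝕜 := ℝ) (closedSpanOmega Nm r τ) φ
  have hinj : Function.Injective fun m => freq τ (j + m) j := fun m m' h => by
    have := (freq_inj hτ_card hτ_disj (Nat.le_add_right j m) (Nat.le_add_right j m') h).1
    omega
  have h := (hr ψ).comp hinj.nat_tendsto_atTop
  refine h.congr fun m => ?_
  simp only [Function.comp]
  rw [← incl_sum_omegaBasis Nm r hτ_card (Nat.le_add_right j m)]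
  exact hψ _

theorem unpair_mem_cube_iff (N : ℕ) (w : Bits) :
    (fun k => w (Nat.unpair k)) ∈ cube N ↔ w ∈ bcube N := by
  constructor
  · intro h c hc
    have := h _ hc
    simpa using this
  · intro h l hl
    exact h _ (by simpa using hl)

/-- `Y_ω` with its canonical basis fits the abstract model: the sets `τ n` are disjoint, so the
Rademacher functions of all levels of all blocks are different, and they can be relabeled. -/
noncomputable def omegaModel (hτ_card : ∀ n, (τ n).card = n + 1)
    (hτ_disj : ∀ m n, m ≠ n → Disjoint (τ m) (τ n)) : Model (omegaBasis Nm r τ) where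
  rho N := (digitNorm Nm N).comp
    (LinearMap.funLeft ℝ ℝ fun (x : ℕ → Bool) (c : ℕ × ℕ) => x (Nat.pair c.1 c.2))
  rho_mono h := digitNorm_mono Nm fun x hx => h _ fun c hc => hx _ hc
  rho_one N := digitNorm_one Nm N
  rho_comp {N Ψ} hm hi g := by
    have key : ∀ x : ℕ → Bool, x ∈ cube N → (fun c : ℕ × ℕ => x (Nat.pair c.1 c.2)) ∈ bcube N :=
      fun x hx c hc => hx _ hc
    have := digitNorm_comp Nm (N := N) (Ψ := fun x k =>
      Ψ (fun c => x (Nat.pair c.1 c.2)) (Nat.unpair k))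
      (fun x hx => (unpair_mem_cube_iff N _).2 (hm (key x hx)))
      (fun x hx y hy hxy => by
        have h1 : Ψ (fun c => x (Nat.pair c.1 c.2)) = Ψ (fun c => y (Nat.pair c.1 c.2)) := by
          funext c
          have := congrFun hxy (Nat.pair c.1 c.2)
          simpa using this
        have h2 := hi (key x hx) (key y hy) h1
        funext k
        have := congrFun h2 (Nat.unpair k)
        simpa using this)
      (fun x => g fun c => x (Nat.pair c.1 c.2))
    simp only [Nat.unpair_pair] at this
    exact this
  G := (levelNorm r).comp (Finsupp.lmapDomain ℝ ℝ fun c => Nat.pair c.1 c.2)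
  G_single c a := by
    rw [Seminorm.comp_apply, Finsupp.lmapDomain_apply, Finsupp.mapDomain_single, levelNorm_single]
  G_mapDomain {v f} hf := by
    have hp : Function.Injective fun c : ℕ × ℕ => Nat.pair c.1 c.2 := fun c d h => by
      have := Nat.pair_eq_pair.1 h
      exact Prod.ext this.1 this.2
    rw [Seminorm.comp_apply, Seminorm.comp_apply, Finsupp.lmapDomain_apply,
      Finsupp.lmapDomain_apply]
    have h1 : (v.mapDomain f).mapDomain (fun c => Nat.pair c.1 c.2)
        = (v.mapDomain fun c => Nat.pair c.1 c.2).mapDomain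
          fun k => Nat.pair (f (Nat.unpair k)).1 (f (Nat.unpair k)).2 := by
      rw [← Finsupp.mapDomain_comp, ← Finsupp.mapDomain_comp]
      congr 1
      funext c
      simp
    rw [h1, levelNorm_mapDomain]
    intro k hk l hl hkl
    obtain ⟨c, hc, rfl⟩ := Finset.mem_image.1 (Finsupp.mapDomain_support hk)
    obtain ⟨d, hd, rfl⟩ := Finset.mem_image.1 (Finsupp.mapDomain_support hl)
    simp only [Nat.unpair_pair] at hkl
    rw [hf hc hd (hp hkl)]
  norm_eq a := by
    classical
    have h0 := norm_sum_haarY Nm r (haarCoeff τ a)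
    simp only [← incl_linearCombination, LinearIsometry.norm_map] at h0
    let n₀ := a.support.sup Idx.n
    let C : Finset (ℕ × ℕ) :=
      (Finset.range (n₀ + 1) ×ˢ Finset.range (n₀ + 1)).filter fun c => c.2 ≤ c.1
    have hC : ∀ n j, (n, j) ∈ C ↔ n ≤ n₀ ∧ j ≤ n := by
      intro n j
      simp only [C, Finset.mem_filter, Finset.mem_product, Finset.mem_range]
      omega
    let S : Finset ℕ := C.image fun c => Nat.pair c.1 c.2
    let f : ℕ → ℕ := fun k => freq τ (Nat.unpair k).1 (Nat.unpair k).2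
    have hf : Set.InjOn f S := by
      intro k hk l hl hkl
      obtain ⟨⟨n, j⟩, hc, rfl⟩ := Finset.mem_image.1 hk
      obtain ⟨⟨n', j'⟩, hd, rfl⟩ := Finset.mem_image.1 hl
      simp only [f, Nat.unpair_pair] at hkl
      obtain ⟨h1, h2⟩ := freq_inj hτ_card hτ_disj ((hC _ _).1 hc).2 ((hC _ _).1 hd).2 hkl
      simp [h1, h2]
    filter_upwards [h0, eventually_gt_atTop (S.sup id), eventually_gt_atTop (S.sup f)]
      with N hN hN1 hN2
    obtain ⟨p, hp, hm, hi⟩ := exists_relabel hf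
      (fun l hl => (Finset.le_sup (f := id) hl).trans_lt hN1)
      (fun l hl => (Finset.le_sup (f := f) hl).trans_lt hN2)
    rw [hN, Seminorm.comp_apply]
    let g : (ℕ → Bool) → ℝ := fun x => levelNorm r
      ((values (fun c => x (Nat.pair c.1 c.2)) a).mapDomain fun c => Nat.pair c.1 c.2)
    change _ = digitNorm Nm N g
    rw [← digitNorm_comp Nm hm hi g]
    apply digitNorm_congr
    intro x hx
    rw [levelValues_haarCoeff hτ_card a hx]
    have hmem : ∀ q ∈ a.support, ∀ i ≤ q.j, Nat.pair q.n i ∈ S := fun q hq i hi => by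
      have h1 : q.n ≤ n₀ := Finset.le_sup hq
      have h2 := q.le
      exact Finset.mem_image.2 ⟨(q.n, i), (hC _ _).2 ⟨h1, by omega⟩, rfl⟩
    have h2 : Finsupp.linearCombination ℝ
        (fun q : Idx => Finsupp.single (freq τ q.n q.j) (haarNode q.K (x ∘ freq τ q.n))) a
        = ((values (fun c => (x ∘ p) (Nat.pair c.1 c.2)) a).mapDomain
            fun c => Nat.pair c.1 c.2).mapDomain f := by
      rw [← Finsupp.mapDomain_comp, ← Finsupp.lmapDomain_apply ℝ ℝ, values,
        Finsupp.linearCombination_apply, Finsupp.linearCombination_apply, Finsupp.sum, Finsupp.sum,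
        map_sum]
      refine Finset.sum_congr rfl fun q hq => ?_
      rw [map_smul, Finsupp.lmapDomain_apply, Finsupp.mapDomain_single]
      simp only [Function.comp, f, Nat.unpair_pair]
      congr 2
      have hpi : ∀ i ≤ q.j, p (Nat.pair q.n i) = freq τ q.n i := fun i hi => by
        rw [hp _ (hmem q hq i hi)]
        simp [f]
      have h3 : pre (x ∘ freq τ q.n) q.j
          = pre (Bits.block (fun c => x (p (Nat.pair c.1 c.2))) q.n) q.j :=
        pre_eq_pre.2 fun l hl => by simp [Bits.block, hpi l hl.le]
      have h4 : x (freq τ q.n q.j) = Bits.block (fun c => x (p (Nat.pair c.1 c.2))) q.n q.j := by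
        simp [Bits.block, hpi q.j le_rfl]
      change haarNode q.K (x ∘ freq τ q.n) = _
      rw [haarNode, haarNode, h3, ← h4]
      rfl
    rw [h2, levelNorm_mapDomain]
    refine hf.mono fun k hk => ?_
    obtain ⟨c, hc, rfl⟩ := Finset.mem_image.1 (Finsupp.mapDomain_support hk)
    rw [values, Finsupp.linearCombination_apply] at hc
    obtain ⟨q, hq, hc'⟩ := Finset.mem_biUnion.1 (Finsupp.support_sum hc)
    have hc'' := Finsupp.support_single_subset (Finsupp.support_smul hc')
    rw [Finset.mem_singleton] at hc''
    subst hc''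
    exact hmem q hq _ le_rfl

end OmegaBasis

/-! ### Digit flips and averages over them -/

theorem seminorm_sum_le {V ι : Type*} [AddCommGroup V] [Module ℝ V] (p : Seminorm ℝ V)
    (s : Finset ι) (f : ι → V) : p (∑ i ∈ s, f i) ≤ ∑ i ∈ s, p (f i) :=
  Finset.le_sum_of_subadditive p (map_zero p).le (map_add_le_add p) s f

/-- Pointwise exclusive or: the digits marked by `y` are flipped. -/
def flip (w y : Bits) : Bits := fun c => xor (w c) (y c)

theorem flip_flip (w y z : Bits) : flip w (flip y z) = flip (flip w y) z := by
  funext c; simp [flip]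

theorem flip_self_right (w y : Bits) : flip (flip w y) y = w := by
  funext c; simp [flip]

theorem finite_bcube (N : ℕ) : (bcube N).Finite := by
  apply Set.Finite.of_injOn (f := fun w : Bits => fun i : Fin N => w (Nat.unpair i))
    (t := Set.univ) (fun _ _ => Set.mem_univ _) _ Set.finite_univ
  intro w hw v hv h
  funext c
  rcases lt_or_ge (Nat.pair c.1 c.2) N with hc | hc
  · have := congrFun h ⟨Nat.pair c.1 c.2, hc⟩
    simpa using this
  · rw [hw c hc, hv c hc]

open Classical in
/-- The flips within `bcube N` that do not touch the digits in `U`. -/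
noncomputable def frees (N : ℕ) (U : Set (ℕ × ℕ)) : Finset Bits :=
  (finite_bcube N).toFinset.filter fun y => ∀ c ∈ U, y c = false

theorem mem_frees {N : ℕ} {U : Set (ℕ × ℕ)} {y : Bits} :
    y ∈ frees N U ↔ y ∈ bcube N ∧ ∀ c ∈ U, y c = false := by
  simp [frees]

theorem frees_nonempty (N : ℕ) (U : Set (ℕ × ℕ)) : (frees N U).Nonempty :=
  ⟨fun _ => false, mem_frees.2 ⟨fun _ _ => rfl, fun _ _ => rfl⟩⟩

theorem card_frees_pos (N : ℕ) (U : Set (ℕ × ℕ)) : (0 : ℝ) < (frees N U).card := by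
  exact_mod_cast (frees_nonempty N U).card_pos

theorem flip_mem_bcube {N : ℕ} {w y : Bits} (hw : w ∈ bcube N) (hy : y ∈ bcube N) :
    flip w y ∈ bcube N := fun c hc => by simp [flip, hw c hc, hy c hc]

theorem flip_mem_frees {N : ℕ} {U : Set (ℕ × ℕ)} {y z : Bits} (hy : y ∈ frees N U)
    (hz : z ∈ frees N U) : flip y z ∈ frees N U := by
  rw [mem_frees] at *
  exact ⟨flip_mem_bcube hy.1 hz.1, fun c hc => by simp [flip, hy.2 c hc, hz.2 c hc]⟩

theorem sum_frees_flip {N : ℕ} {U : Set (ℕ × ℕ)} {z : Bits} (hz : z ∈ frees N U) (f : Bits → ℝ) :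
    ∑ y ∈ frees N U, f (flip y z) = ∑ y ∈ frees N U, f y :=
  Finset.sum_nbij' (fun y => flip y z) (fun y => flip y z) (fun _ hy => flip_mem_frees hy hz)
    (fun _ hy => flip_mem_frees hy hz) (fun y _ => flip_self_right y z)
    (fun y _ => flip_self_right y z) fun _ _ => rfl

/-- The flip of the single digit `c`. -/
def toggle (c : ℕ × ℕ) : Bits := fun d => decide (d = c)

theorem toggle_mem_frees {N : ℕ} {U : Set (ℕ × ℕ)} {c : ℕ × ℕ} (hN : Nat.pair c.1 c.2 < N)
    (hU : c ∉ U) : toggle c ∈ frees N U := by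
  rw [mem_frees]
  constructor
  · intro d hd
    simp only [toggle, decide_eq_false_iff_not]
    rintro rfl
    omega
  · intro d hd
    simp only [toggle, decide_eq_false_iff_not]
    rintro rfl
    exact hU hd

theorem sum_frees_eq_zero {N : ℕ} {U : Set (ℕ × ℕ)} {z : Bits} (hz : z ∈ frees N U)
    {f : Bits → ℝ} (hf : ∀ y ∈ frees N U, f (flip y z) = - f y) : ∑ y ∈ frees N U, f y = 0 := by
  have h := sum_frees_flip hz f
  rw [Finset.sum_congr rfl hf, Finset.sum_neg_distrib] at h
  linarith

theorem haarNode_flip_toggle {j : ℕ} (K : Fin j → Bool) (w : Bits) (n : ℕ) :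
    haarNode K ((flip w (toggle (n, j))).block n) = - haarNode K (w.block n) := by
  have h1 : pre ((flip w (toggle (n, j))).block n) j = pre (w.block n) j := by
    rw [pre_eq_pre]
    intro l hl
    simp [Bits.block, flip, toggle, hl.ne]
  have h2 : (flip w (toggle (n, j))).block n j = ! (w.block n j) := by
    simp [Bits.block, flip, toggle]
  rw [haarNode, haarNode, h1, h2, sgn_not]
  split_ifs <;> simp

/-- The average over the flips of the digits outside of `U` annihilates all Haar functions whose
own digit lies outside of `U`. -/
theorem sum_frees_haarNode {N : ℕ} {U : Set (ℕ × ℕ)} {n j : ℕ} (K : Fin j → Bool) (w : Bits)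
    (hN : Nat.pair n j < N) (hU : (n, j) ∉ U) {σ : Bits → ℝ}
    (hσ : ∀ y, σ (flip y (toggle (n, j))) = σ y) :
    ∑ y ∈ frees N U, σ y * haarNode K ((flip w y).block n) = 0 := by
  refine sum_frees_eq_zero (toggle_mem_frees (c := (n, j)) hN hU) fun y _ => ?_
  rw [hσ, flip_flip, haarNode_flip_toggle, mul_neg]

/-- All digits on which the combination with coefficients `a` depends are among the first `N`. -/
def Covers (N : ℕ) (a : Idx →₀ ℝ) : Prop := ∀ q ∈ a.support, ∀ i ≤ q.j, Nat.pair q.n i < N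

theorem eventually_covers (a : Idx →₀ ℝ) : ∀ᶠ N in atTop, Covers N a := by
  simp only [Covers]
  rw [Filter.eventually_all_finset]
  intro q _
  have : ∀ᶠ N in atTop, ∀ i ∈ Finset.range (q.j + 1), Nat.pair q.n i < N := by
    rw [Filter.eventually_all_finset]
    intro i _
    exact eventually_gt_atTop _
  filter_upwards [this] with N hN i hi
  exact hN i (Finset.mem_range.2 (by omega))

theorem values_eq_sum (w : Bits) (a : Idx →₀ ℝ) :
    values w a = ∑ q ∈ a.support,
      a q • Finsupp.single (q.n, q.j) (haarNode q.K (w.block q.n)) := by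
  rw [values, Finsupp.linearCombination_apply, Finsupp.sum]

@[simp] theorem values_single (w : Bits) (q : Idx) (c : ℝ) :
    values w (Finsupp.single q c) = Finsupp.single (q.n, q.j) (c * haarNode q.K (w.block q.n)) := by
  rw [values, Finsupp.linearCombination_single, Finsupp.smul_single, smul_eq_mul]

namespace Model

variable {E : Type*} [NormedAddCommGroup E] [NormedSpace ℝ E] {e : Idx → E} (M : Model e)

theorem rho_mono_of_nonneg {N : ℕ} {f g : Bits → ℝ} (hf : ∀ w, 0 ≤ f w)
    (h : ∀ w ∈ bcube N, f w ≤ g w) : M.rho N f ≤ M.rho N g :=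
  M.rho_mono fun w hw => by
    rw [abs_of_nonneg (hf w), abs_of_nonneg ((hf w).trans (h w hw))]; exact h w hw

theorem rho_flip {N : ℕ} {y : Bits} (hy : y ∈ bcube N) (g : Bits → ℝ) :
    M.rho N (fun w => g (flip w y)) = M.rho N g := by
  refine M.rho_comp (Ψ := fun w => flip w y) (fun w hw => flip_mem_bcube hw hy) ?_ g
  intro w _ v _ h
  have := congrArg (fun u => flip u y) h
  simpa only [flip_self_right] using this

/-- Averaging over digit flips, possibly with signs, is a contraction. -/
theorem rho_average_le (N : ℕ) (U : Set (ℕ × ℕ)) (σ : Bits → ℝ) (hσ : ∀ y, |σ y| = 1)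
    (v : Bits → ℕ × ℕ →₀ ℝ) :
    M.rho N (fun w => M.G (((frees N U).card : ℝ)⁻¹ • ∑ y ∈ frees N U, σ y • v (flip w y)))
      ≤ M.rho N fun w => M.G (v w) := by
  have hc := card_frees_pos N U
  have h1 : M.rho N (fun w => M.G (((frees N U).card : ℝ)⁻¹ •
        ∑ y ∈ frees N U, σ y • v (flip w y)))
      ≤ M.rho N (((frees N U).card : ℝ)⁻¹ • ∑ y ∈ frees N U, fun w => M.G (v (flip w y))) := by
    apply M.rho_mono_of_nonneg (fun w => apply_nonneg _ _)
    intro w _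
    rw [map_smul_eq_mul, Real.norm_of_nonneg (inv_nonneg.2 hc.le)]
    simp only [Pi.smul_apply, Finset.sum_apply, smul_eq_mul]
    refine mul_le_mul_of_nonneg_left ?_ (inv_nonneg.2 hc.le)
    refine (seminorm_sum_le M.G _ _).trans (Finset.sum_le_sum fun y _ => ?_)
    rw [map_smul_eq_mul, Real.norm_eq_abs, hσ, one_mul]
  refine h1.trans ?_
  rw [map_smul_eq_mul, Real.norm_of_nonneg (inv_nonneg.2 hc.le)]
  have h2 : M.rho N (∑ y ∈ frees N U, fun w => M.G (v (flip w y)))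
      ≤ (frees N U).card * M.rho N fun w => M.G (v w) := by
    refine (seminorm_sum_le (M.rho N) _ _).trans ?_
    rw [← nsmul_eq_mul, ← Finset.sum_const]
    refine Finset.sum_le_sum fun y hy => ?_
    exact (M.rho_flip (mem_frees.1 hy).1 fun w => M.G (v w)).le
  calc _ ≤ ((frees N U).card : ℝ)⁻¹ * ((frees N U).card * M.rho N fun w => M.G (v w)) :=
        mul_le_mul_of_nonneg_left h2 (inv_nonneg.2 hc.le)
    _ = _ := by rw [← mul_assoc, inv_mul_cancel₀ hc.ne', one_mul]

/-- An injective relabeling of the levels of the blocks does not change `rho`. -/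
theorem rho_relabel {κ : ℕ × ℕ → ℕ × ℕ} (hκ : Function.Injective κ) (C : Finset (ℕ × ℕ)) :
    ∀ᶠ N in atTop, ∀ g : Bits → ℝ, (∀ w v : Bits, (∀ c ∈ C, w c = v c) → g w = g v) →
      M.rho N (fun w => g (w ∘ κ)) = M.rho N g := by
  let S : Finset ℕ := C.image fun c => Nat.pair c.1 c.2
  let f : ℕ → ℕ := fun k => Nat.pair (κ (Nat.unpair k)).1 (κ (Nat.unpair k)).2
  have hf : Set.InjOn f S := by
    intro k _ l _ h
    obtain ⟨h1, h2⟩ := Nat.pair_eq_pair.1 h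
    have h3 := hκ (Prod.ext h1 h2)
    rw [← Nat.pair_unpair k, h3, Nat.pair_unpair]
  filter_upwards [eventually_gt_atTop (S.sup id), eventually_gt_atTop (S.sup f)]
    with N hN1 hN2 g hg
  obtain ⟨p, hp, hm, hi⟩ := exists_relabel hf
    (fun l hl => (Finset.le_sup (f := id) hl).trans_lt hN1)
    (fun l hl => (Finset.le_sup (f := f) hl).trans_lt hN2)
  have h1 := M.rho_comp (N := N)
    (Ψ := fun w c => w (Nat.unpair (p (Nat.pair c.1 c.2)))) ?_ ?_ g
  · rw [← h1]
    congr 1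
    funext w
    apply hg
    intro c hc
    simp only [Function.comp]
    rw [hp _ (Finset.mem_image_of_mem _ hc)]
    simp [f]
  · intro w hw c hc
    exact hm ((unpair_mem_cube_iff N w).2 hw) _ hc
  · intro w hw v hv h
    have h2 := hi ((unpair_mem_cube_iff N w).2 hw) ((unpair_mem_cube_iff N v).2 hv) (by
      funext k
      have := congrFun h (Nat.unpair k)
      simpa using this)
    funext c
    have := congrFun h2 (Nat.pair c.1 c.2)
    simpa using this

theorem norm_le_of_rho_le {a b : Idx →₀ ℝ}
    (h : ∀ᶠ N in atTop, M.rho N (fun w => M.G (values w b)) ≤ M.rho N fun w => M.G (values w a)) :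
    ‖Finsupp.linearCombination ℝ e b‖ ≤ ‖Finsupp.linearCombination ℝ e a‖ := by
  obtain ⟨N, h1, h2, h3⟩ := (h.and ((M.norm_eq a).and (M.norm_eq b))).exists
  rwa [h2, h3]

end Model

/-! ### Twists of the binary tree -/

/-- A choice of the left-right orientation at each node of the binary tree. -/
abbrev Tree : Type := (l : ℕ) → (Fin l → Bool) → Bool

/-- The automorphism of the binary tree that interchanges the successors of the nodes marked by
`t`, acting on paths. -/
def twistPath (t : Tree) (x : ℕ → Bool) : ℕ → Bool := fun l => xor (x l) (t l (pre x l))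

theorem pre_twistPath_eq_iff (t : Tree) {x y : ℕ → Bool} {j : ℕ} :
    pre (twistPath t x) j = pre (twistPath t y) j ↔ pre x j = pre y j := by
  induction j with
  | zero => exact ⟨fun _ => funext fun i => i.elim0, fun _ => funext fun i => i.elim0⟩
  | succ j ih =>
    have key : ∀ u v : ℕ → Bool, pre u (j + 1) = pre v (j + 1) ↔ pre u j = pre v j ∧ u j = v j := by
      intro u v
      simp only [pre_eq_pre]
      constructor
      · exact fun h => ⟨fun l hl => h l (by omega), h j (by omega)⟩
      · rintro ⟨h1, h2⟩ l hl
        rcases Nat.lt_succ_iff_lt_or_eq.1 hl with h | rfl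
        exacts [h1 l h, h2]
    rw [key, key, ih]
    refine and_congr_right fun h => ?_
    simp [twistPath, h]

/-- The action of a tree automorphism on nodes. -/
def twistNode (t : Tree) {j : ℕ} (K : Fin j → Bool) : Fin j → Bool := pre (twistPath t (ext K)) j

theorem pre_twistPath (t : Tree) (x : ℕ → Bool) (j : ℕ) :
    pre (twistPath t x) j = twistNode t (pre x j) := by
  rw [twistNode, pre_twistPath_eq_iff, pre_ext]

theorem twistNode_injective (t : Tree) (j : ℕ) :
    Function.Injective (twistNode t : (Fin j → Bool) → Fin j → Bool) := by
  intro K L h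
  rw [twistNode, twistNode, pre_twistPath_eq_iff, pre_ext, pre_ext] at h
  exact h

theorem twistNode_bijective (t : Tree) (j : ℕ) :
    Function.Bijective (twistNode t : (Fin j → Bool) → Fin j → Bool) :=
  Finite.injective_iff_bijective.1 (twistNode_injective t j)

theorem haarNode_twist (t : Tree) {j : ℕ} (K : Fin j → Bool) (x : ℕ → Bool) :
    haarNode (twistNode t K) (twistPath t x) = sgn (t j K) * haarNode K x := by
  rw [haarNode, haarNode, pre_twistPath]
  simp only [(twistNode_injective t j).eq_iff]
  split_ifs with h
  · rw [twistPath, h, sgn_xor, mul_comm]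
  · simp

/-- The action of a family of tree automorphisms, one for each block, on indices. -/
def twistIdx (θ : ℕ → Tree) (q : Idx) : Idx := ⟨q.n, q.j, q.le, twistNode (θ q.n) q.K⟩

/-- The sign that appears when the Haar function with index `q` is twisted. -/
def twistSign (θ : ℕ → Tree) (q : Idx) : ℝ := sgn (θ q.n q.j q.K)

namespace Model

variable {E : Type*} [NormedAddCommGroup E] [NormedSpace ℝ E] {e : Idx → E} (M : Model e)

include M in
/-- Tree automorphisms of the blocks act isometrically. -/
theorem norm_twist (θ : ℕ → Tree) (a : Idx →₀ ℝ) :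
    ‖Finsupp.linearCombination ℝ (fun q => twistSign θ q • e (twistIdx θ q)) a‖
      = ‖Finsupp.linearCombination ℝ e a‖ := by
  let F : (Idx →₀ ℝ) →ₗ[ℝ] Idx →₀ ℝ :=
    Finsupp.linearCombination ℝ fun q => Finsupp.single (twistIdx θ q) (twistSign θ q)
  have hF : Finsupp.linearCombination ℝ (fun q => twistSign θ q • e (twistIdx θ q)) a
      = Finsupp.linearCombination ℝ e (F a) := by
    simp only [F, Finsupp.linearCombination_apply ℝ a, Finsupp.sum, map_sum, map_smul,
      Finsupp.linearCombination_single]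
  rw [hF]
  obtain ⟨N, hN, h1, h2⟩ := ((eventually_covers a).and
    ((M.norm_eq a).and (M.norm_eq (F a)))).exists
  rw [h1, h2]
  let Ψ : Bits → Bits := fun w c =>
    if Nat.pair c.1 c.2 < N then twistPath (θ c.1) (w.block c.1) c.2 else false
  have hm : Set.MapsTo Ψ (bcube N) (bcube N) := fun w _ c hc => if_neg (by omega)
  have hmono : ∀ n {i j : ℕ}, i < j → Nat.pair n i < Nat.pair n j :=
    fun n _ _ h => Nat.pair_lt_pair_right n h
  have hblock : ∀ (w : Bits) (n j : ℕ), Nat.pair n j < N →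
      pre ((Ψ w).block n) j = pre (twistPath (θ n) (w.block n)) j := by
    intro w n j hj
    rw [pre_eq_pre]
    intro l hl
    exact if_pos ((hmono n hl).trans hj)
  have hi : Set.InjOn Ψ (bcube N) := by
    intro w hw v hv h
    funext c
    rcases lt_or_ge (Nat.pair c.1 c.2) N with hc | hc
    · have h3 : pre (w.block c.1) c.2 = pre (v.block c.1) c.2 := by
        rw [← pre_twistPath_eq_iff (θ c.1), ← hblock w _ _ hc, ← hblock v _ _ hc, h]
      have h4 := congrFun h c
      simp only [Ψ, if_pos hc, twistPath, h3] at h4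
      simpa [Bits.block] using h4
    · rw [hw c hc, hv c hc]
  rw [← M.rho_comp hm hi fun w => M.G (values w (F a))]
  congr 1
  funext w
  congr 1
  simp only [F, Finsupp.linearCombination_apply ℝ a, Finsupp.sum, map_sum, map_smul, values_single]
  rw [values_eq_sum]
  refine Finset.sum_congr rfl fun q hq => ?_
  congr 2
  have h3 : haarNode (twistNode (θ q.n) q.K) ((Ψ w).block q.n)
      = haarNode (twistNode (θ q.n) q.K) (twistPath (θ q.n) (w.block q.n)) := by
    rw [haarNode, haarNode, hblock w _ _ (hN q hq _ le_rfl)]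
    congr 2
    exact if_pos (hN q hq _ le_rfl)
  change twistSign θ q * haarNode (twistNode (θ q.n) q.K) ((Ψ w).block q.n) = _
  rw [h3, haarNode_twist, twistSign, ← mul_assoc, sgn_mul_self, one_mul]

end Model

/-! ### Copies of the independent sum on selected levels -/

/-- The node of level `j` obtained from a node of level `k j` by keeping the choices at the levels
`k 0, …, k (j - 1)`. -/
def selNode (k : ℕ → ℕ) (j : ℕ) {l : ℕ} (K : Fin l → Bool) : Fin j → Bool := pre (ext K ∘ k) j

/-- The nodes of level `k j` from which `I` is obtained by keeping the choices at the levels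
`k 0, …, k (j - 1)`. -/
def fiber (k : ℕ → ℕ) {j : ℕ} (I : Fin j → Bool) : Finset (Fin (k j) → Bool) :=
  Finset.univ.filter fun K => selNode k j K = I

theorem mem_fiber {k : ℕ → ℕ} {j : ℕ} {I : Fin j → Bool} {K : Fin (k j) → Bool} :
    K ∈ fiber k I ↔ selNode k j K = I := by simp [fiber]

theorem selNode_pre {k : ℕ → ℕ} (hk : StrictMono k) (j : ℕ) (x : ℕ → Bool) :
    selNode k j (pre x (k j)) = pre (x ∘ k) j := by
  rw [selNode, pre_eq_pre]
  intro l hl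
  simp [ext, pre, hk hl]

theorem selNode_surjective {k : ℕ → ℕ} (hk : StrictMono k) {j : ℕ} (I : Fin j → Bool) :
    ∃ K : Fin (k j) → Bool, selNode k j K = I := by
  refine ⟨pre (Function.extend k (ext I) fun _ => false) (k j), ?_⟩
  rw [selNode_pre hk]
  have : Function.extend k (ext I) (fun _ => false) ∘ k = ext I :=
    funext fun l => hk.injective.extend_apply _ _ _
  rw [this, pre_ext]

theorem selNode_xor {k : ℕ → ℕ} (hk : StrictMono k) {j : ℕ} (K L : Fin (k j) → Bool) :
    selNode k j (fun i => xor (K i) (L i)) = fun i => xor (selNode k j K i) (selNode k j L i) := by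
  funext i
  simp [selNode, pre, ext, hk i.2]

theorem card_fiber {k : ℕ → ℕ} (hk : StrictMono k) {j : ℕ} (I : Fin j → Bool) :
    (fiber k I).card * 2 ^ j = 2 ^ k j := by
  have hle : ∀ I I' : Fin j → Bool, (fiber k I).card ≤ (fiber k I').card := by
    intro I I'
    obtain ⟨Z, hZ⟩ := selNode_surjective hk fun i => xor (I i) (I' i)
    refine Finset.card_le_card_of_injOn (fun K i => xor (K i) (Z i)) ?_ ?_
    · intro K hK
      have hK' := mem_fiber.1 (Finset.mem_coe.1 hK)
      simp only [Finset.mem_coe, mem_fiber]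
      rw [selNode_xor hk, hK', hZ]
      funext i
      simp
    · intro K _ L _ h
      funext i
      have := congrFun h i
      simpa using this
  have heq : ∀ I', (fiber k I').card = (fiber k I).card := fun I' => (hle _ _).antisymm (hle _ _)
  have hsum := Finset.card_eq_sum_card_fiberwise (s := (Finset.univ : Finset (Fin (k j) → Bool)))
    (t := Finset.univ) (f := selNode k j) fun _ _ => Finset.mem_coe.2 (Finset.mem_univ _)
  have h3 : ∀ I' : Fin j → Bool, (Finset.univ.filter fun K : Fin (k j) → Bool =>
    selNode k j K = I').card = (fiber k I).card := heq
  simp only [h3, Finset.sum_const, Finset.card_univ, Fintype.card_fun, Fintype.card_bool,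
    Fintype.card_fin, smul_eq_mul] at hsum
  rw [hsum, mul_comm]

theorem sum_fiber_haarNode {k : ℕ → ℕ} (hk : StrictMono k) {j : ℕ} (I : Fin j → Bool)
    (x : ℕ → Bool) : ∑ K ∈ fiber k I, haarNode K x = haarNode I (x ∘ k) := by
  simp only [haarNode, fiber, Finset.sum_filter]
  rw [Finset.sum_eq_single (pre x (k j))]
  · rw [selNode_pre hk, if_pos rfl]
    rfl
  · intro K _ hK
    rw [if_neg (Ne.symm hK)]
    simp
  · simp

/-- A choice of levels: the `j`-th level of the `n`-th block is sent to the level `k n j` of the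
block `m n`. Only the blocks with numbers in `S` are used. -/
structure Selection where
  S : Set ℕ
  m : ℕ → ℕ
  k : ℕ → ℕ → ℕ
  m_inj : Function.Injective m
  k_mono : ∀ n, StrictMono (k n)
  le : ∀ n ∈ S, k n n ≤ m n

namespace Selection

variable (D : Selection)

theorem le_of_le {n j : ℕ} (hn : n ∈ D.S) (hj : j ≤ n) : D.k n j ≤ D.m n :=
  ((D.k_mono n).monotone hj).trans (D.le n hn)

/-- The relabeling of levels. -/
def map (c : ℕ × ℕ) : ℕ × ℕ := (D.m c.1, D.k c.1 c.2)

theorem map_injective : Function.Injective D.map := by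
  rintro ⟨n, j⟩ ⟨n', j'⟩ h
  simp only [map, Prod.mk.injEq] at h
  obtain rfl := D.m_inj h.1
  rw [(D.k_mono n).injective h.2]

/-- The levels that are used. -/
def used : Set (ℕ × ℕ) := {c | ∃ n ∈ D.S, ∃ j ≤ n, c = D.map (n, j)}

/-- The index of a node of a selected level. -/
def idx {n j : ℕ} (hn : n ∈ D.S) (hj : j ≤ n) (K : Fin (D.k n j) → Bool) : Idx :=
  ⟨D.m n, D.k n j, D.le_of_le hn hj, K⟩

open Classical in
/-- The coefficients of the image of a basis vector under the averaging operator: the coefficients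
of the nodes in each fiber of `selNode` are averaged, and the levels that are not used are
dropped. -/
noncomputable def avgCoeff (q : Idx) : Idx →₀ ℝ :=
  if h : ∃ c : ℕ × ℕ, c.1 ∈ D.S ∧ c.2 ≤ c.1 ∧ (q.n, q.j) = D.map c then
    ((2 : ℝ) ^ h.choose.2 / 2 ^ q.j) • Finsupp.single
      (⟨h.choose.1, h.choose.2, h.choose_spec.2.1, selNode (D.k h.choose.1) h.choose.2 q.K⟩ : Idx) 1
  else 0

theorem avgCoeff_of_notMem {q : Idx} (h : (q.n, q.j) ∉ D.used) : D.avgCoeff q = 0 := by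
  rw [avgCoeff, dif_neg]
  rintro ⟨⟨n, j⟩, hn, hj, h'⟩
  exact h ⟨n, hn, j, hj, h'⟩

theorem avgCoeff_idx {n j : ℕ} (hn : n ∈ D.S) (hj : j ≤ n) (K : Fin (D.k n j) → Bool) :
    D.avgCoeff (D.idx hn hj K)
      = ((2 : ℝ) ^ j / 2 ^ D.k n j) • Finsupp.single (⟨n, j, hj, selNode (D.k n) j K⟩ : Idx) 1 := by
  have h : ∃ c : ℕ × ℕ, c.1 ∈ D.S ∧ c.2 ≤ c.1 ∧
      ((D.idx hn hj K).n, (D.idx hn hj K).j) = D.map c := ⟨(n, j), hn, hj, rfl⟩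
  rw [avgCoeff, dif_pos h]
  have hc : h.choose = (n, j) := D.map_injective h.choose_spec.2.2.symm
  have hidx : (⟨h.choose.1, h.choose.2, h.choose_spec.2.1,
      selNode (D.k h.choose.1) h.choose.2 (D.idx hn hj K).K⟩ : Idx)
      = ⟨n, j, hj, selNode (D.k n) j K⟩ := by
    have : ∀ c : ℕ × ℕ, ∀ hc' : c.2 ≤ c.1, c = (n, j) →
        (⟨c.1, c.2, hc', selNode (D.k c.1) c.2 (D.idx hn hj K).K⟩ : Idx)
          = ⟨n, j, hj, selNode (D.k n) j K⟩ := by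
      rintro c hc' rfl; rfl
    exact this _ _ hc
  rw [hidx, hc]
  rfl

/-- The average over the flips of the unused digits turns a Haar function of a selected level into
a multiple of a Haar function of the original system: the number of flips that lead to a given node
does not depend on the node, as long as it is compatible with the used digits. -/
theorem sum_frees_haarNode_idx {n j : ℕ} (hn : n ∈ D.S) (hj : j ≤ n) (K : Fin (D.k n j) → Bool)
    {N : ℕ} (hN : Nat.pair (D.m n) (D.k n j) < N) (w : Bits) :
    ∑ y ∈ frees N D.used, haarNode K ((flip w y).block (D.m n))
      = (frees N D.used).card * ((2 : ℝ) ^ j / 2 ^ D.k n j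
        * haarNode (selNode (D.k n) j K) (Bits.block (w ∘ D.map) n)) := by
  classical
  have hk := D.k_mono n
  have hfix : ∀ y ∈ frees N D.used, ∀ i ≤ j, y (D.m n, D.k n i) = false := fun y hy i hi =>
    (mem_frees.1 hy).2 _ ⟨n, hn, i, hi.trans hj, rfl⟩
  have hblock : ∀ y ∈ frees N D.used, ∀ i ≤ j,
      (flip w y).block (D.m n) (D.k n i) = Bits.block (w ∘ D.map) n i := by
    intro y hy i hi
    simp [Bits.block, flip, hfix y hy i hi, map]
  have hsel : ∀ y ∈ frees N D.used,
      selNode (D.k n) j (pre ((flip w y).block (D.m n)) (D.k n j))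
        = pre (Bits.block (w ∘ D.map) n) j := by
    intro y hy
    rw [selNode_pre hk, pre_eq_pre]
    exact fun l hl => hblock y hy l hl.le
  let cnt : (Fin (D.k n j) → Bool) → ℝ := fun L =>
    ∑ y ∈ frees N D.used, if pre ((flip w y).block (D.m n)) (D.k n j) = L then (1 : ℝ) else 0
  have h1 : ∑ y ∈ frees N D.used, haarNode K ((flip w y).block (D.m n))
      = cnt K * sgn (Bits.block (w ∘ D.map) n j) := by
    rw [Finset.sum_mul]
    refine Finset.sum_congr rfl fun y hy => ?_
    rw [haarNode, hblock y hy j le_rfl]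
    split_ifs <;> simp
  rw [h1, haarNode]
  by_cases hK : pre (Bits.block (w ∘ D.map) n) j = selNode (D.k n) j K
  · rw [if_pos hK]
    have hconst : ∀ L ∈ fiber (D.k n) (selNode (D.k n) j K), cnt L = cnt K := by
      intro L hL
      rw [mem_fiber] at hL
      let z : Bits := fun c => decide (c.1 = D.m n) && (xor (ext K c.2) (ext L c.2))
      have hz0 : ∀ i, D.k n j ≤ i → z (D.m n, i) = false := by
        intro i hi
        simp [z, ext, Nat.not_lt.2 hi]
      have hz : z ∈ frees N D.used := by
        rw [mem_frees]
        constructor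
        · rintro ⟨n', i⟩ hi
          by_cases hn' : n' = D.m n
          · subst hn'
            apply hz0
            by_contra hlt
            have := Nat.pair_lt_pair_right (D.m n) (not_le.1 hlt)
            simp only at hi
            omega
          · simp [z, hn']
        · rintro c ⟨n', hn', i, hi, rfl⟩
          by_cases hnn : n' = n
          · subst hnn
            rcases lt_or_ge i j with hij | hij
            · have := congrFun hL ⟨i, hij⟩
              simp only [selNode, pre, Function.comp] at this
              simp [z, map, this]
            · exact hz0 _ (hk.monotone hij)
          · have : D.m n' ≠ D.m n := fun h => hnn (D.m_inj h)
            simp [z, map, this]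
      have := sum_frees_flip hz fun y =>
        if pre ((flip w y).block (D.m n)) (D.k n j) = L then (1 : ℝ) else 0
      simp only [cnt]
      rw [← this]
      refine Finset.sum_congr rfl fun y _ => ?_
      congr 1
      have hzl : ∀ i : Fin (D.k n j), z (D.m n, i) = xor (K i) (L i) := fun i => by
        simp [z, ext]
      rw [eq_iff_iff]
      constructor
      · intro h
        funext i
        have h2 := congrFun h i
        simp only [pre, Bits.block, flip, hzl] at h2 ⊢
        rw [← Bool.xor_assoc] at h2
        revert h2
        generalize xor (w _) (y _) = b
        cases b <;> cases K i <;> cases L i <;> simp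
      · intro h
        funext i
        have h2 := congrFun h i
        simp only [pre, Bits.block, flip, hzl] at h2 ⊢
        rw [← Bool.xor_assoc, h2]
        cases K i <;> cases L i <;> simp
    have htot : ∑ L ∈ fiber (D.k n) (selNode (D.k n) j K), cnt L = (frees N D.used).card := by
      simp only [cnt]
      rw [Finset.sum_comm]
      rw [Finset.card_eq_sum_ones, Nat.cast_sum]
      refine Finset.sum_congr rfl fun y hy => ?_
      rw [Finset.sum_ite_eq, if_pos]
      · simp
      · rw [mem_fiber, hsel y hy, hK]
    rw [Finset.sum_congr rfl hconst, Finset.sum_const, nsmul_eq_mul] at htot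
    have hcard : ((fiber (D.k n) (selNode (D.k n) j K)).card : ℝ) * 2 ^ j = 2 ^ D.k n j := by
      exact_mod_cast card_fiber hk (selNode (D.k n) j K)
    rw [← htot, ← hcard]
    have hpos : ((fiber (D.k n) (selNode (D.k n) j K)).card : ℝ) ≠ 0 := by
      intro h0
      rw [h0, zero_mul] at hcard
      exact absurd hcard.symm (by positivity)
    field_simp
  · rw [if_neg hK]
    have : cnt K = 0 := by
      refine Finset.sum_eq_zero fun y hy => if_neg fun h => hK ?_
      rw [← hsel y hy, h]
    rw [this]
    simp

end Selection

namespace Model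

variable {E : Type*} [NormedAddCommGroup E] [NormedSpace ℝ E] {e : Idx → E} (M : Model e)

/-- The values of a finite combination depend only on the digits that occur in it. -/
theorem values_congr {a : Idx →₀ ℝ} {w v : Bits}
    (h : ∀ q ∈ a.support, ∀ i ≤ q.j, w (q.n, i) = v (q.n, i)) : values w a = values v a := by
  rw [values_eq_sum, values_eq_sum]
  refine Finset.sum_congr rfl fun q hq => ?_
  have h1 : pre (w.block q.n) q.j = pre (v.block q.n) q.j :=
    pre_eq_pre.2 fun l hl => h q hq l hl.le
  have h2 : w.block q.n q.j = v.block q.n q.j := h q hq _ le_rfl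
  rw [haarNode, haarNode, h1, h2]

/-- A relabeling of the digits does not change the norm of a finite combination. -/
theorem rho_values_relabel {κ : ℕ × ℕ → ℕ × ℕ} (hκ : Function.Injective κ) (a : Idx →₀ ℝ) :
    ∀ᶠ N in atTop, M.rho N (fun w => M.G (values (w ∘ κ) a))
      = M.rho N fun w => M.G (values w a) := by
  classical
  filter_upwards [M.rho_relabel hκ (a.support.biUnion fun q =>
    (Finset.range (q.j + 1)).image fun i => (q.n, i))] with N hN
  refine hN (fun w => M.G (values w a)) fun w v h => ?_
  rw [values_congr]
  intro q hq i hi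
  exact h _ (Finset.mem_biUnion.2 ⟨q, hq,
    Finset.mem_image.2 ⟨i, Finset.mem_range.2 (by omega), rfl⟩⟩)

include M in
/-- The averaging operator is a contraction, being the average over the flips of the unused
digits. -/
theorem norm_avg_le (D : Selection) (a : Idx →₀ ℝ) :
    ‖Finsupp.linearCombination ℝ (fun q => Finsupp.linearCombination ℝ e (D.avgCoeff q)) a‖
      ≤ ‖Finsupp.linearCombination ℝ e a‖ := by
  let b : Idx →₀ ℝ := Finsupp.linearCombination ℝ D.avgCoeff a
  have hb : Finsupp.linearCombination ℝ (fun q => Finsupp.linearCombination ℝ e (D.avgCoeff q)) a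
      = Finsupp.linearCombination ℝ e b := by
    simp only [b, Finsupp.linearCombination_apply ℝ a, Finsupp.sum, map_sum, map_smul]
  rw [hb]
  apply M.norm_le_of_rho_le
  filter_upwards [M.rho_values_relabel D.map_injective b, eventually_covers a] with N h1 hN
  rw [← h1]
  refine le_trans (le_of_eq ?_)
    (M.rho_average_le N D.used (fun _ => 1) (fun _ => abs_one) fun w => values w a)
  congr 1
  funext w
  rw [← M.G_mapDomain D.map_injective.injOn]
  congr 1
  have hc := card_frees_pos N D.used
  rw [eq_inv_smul_iff₀ hc.ne']
  simp only [one_smul, values_eq_sum _ a]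
  rw [Finset.sum_comm]
  simp only [b, Finsupp.linearCombination_apply ℝ a, Finsupp.sum, map_sum, map_smul,
    Finset.smul_sum, ← Finsupp.lmapDomain_apply ℝ ℝ]
  refine Finset.sum_congr rfl fun q hq => ?_
  rw [← Finset.smul_sum, smul_comm]
  congr 1
  rw [← Finsupp.single_finsetSum]
  by_cases hq' : (q.n, q.j) ∈ D.used
  · obtain ⟨n, hn, j, hj, h2⟩ := hq'
    obtain ⟨n', j', hj', K⟩ := q
    simp only [Selection.map, Prod.mk.injEq] at h2
    obtain ⟨rfl, rfl⟩ := h2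
    have h3 := D.avgCoeff_idx hn hj K
    simp only [Selection.idx] at h3
    rw [h3, D.sum_frees_haarNode_idx hn hj K (hN _ hq _ le_rfl), map_smul, values_single, map_smul,
      Finsupp.lmapDomain_apply, Finsupp.mapDomain_single, one_mul, Finsupp.smul_single,
      Finsupp.smul_single]
    rfl
  · rw [D.avgCoeff_of_notMem hq', map_zero, map_zero, smul_zero]
    have := sum_frees_haarNode q.K w (hN q hq _ le_rfl) hq' (σ := fun _ => 1) fun _ => rfl
    simp only [one_mul] at this
    rw [this, Finsupp.single_zero]

include M in
/-- Selecting levels gives an isometric copy of the independent sum. -/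
theorem norm_select (D : Selection) (hS : ∀ n, n ∈ D.S) (a : Idx →₀ ℝ) :
    ‖Finsupp.linearCombination ℝ
        (fun q => ∑ K ∈ fiber (D.k q.n) q.K, e (D.idx (hS q.n) q.le K)) a‖
      = ‖Finsupp.linearCombination ℝ e a‖ := by
  let b : Idx →₀ ℝ := Finsupp.linearCombination ℝ
    (fun q => ∑ K ∈ fiber (D.k q.n) q.K, Finsupp.single (D.idx (hS q.n) q.le K) 1) a
  have hb : Finsupp.linearCombination ℝ
      (fun q => ∑ K ∈ fiber (D.k q.n) q.K, e (D.idx (hS q.n) q.le K)) a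
      = Finsupp.linearCombination ℝ e b := by
    simp only [b, Finsupp.linearCombination_apply ℝ a, Finsupp.sum, map_sum, map_smul,
      Finsupp.linearCombination_single, one_smul]
  rw [hb]
  obtain ⟨N, h1, h2, h3⟩ := ((M.rho_values_relabel D.map_injective a).and
    ((M.norm_eq a).and (M.norm_eq b))).exists
  rw [h2, h3, ← h1]
  congr 1
  funext w
  rw [← M.G_mapDomain (v := values (w ∘ D.map) a) D.map_injective.injOn]
  congr 1
  rw [← Finsupp.lmapDomain_apply ℝ ℝ, values_eq_sum _ a, map_sum]
  simp only [b, Finsupp.linearCombination_apply ℝ a, Finsupp.sum, map_sum, map_smul, values_single,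
    one_mul]
  refine Finset.sum_congr rfl fun q _ => ?_
  congr 1
  rw [Finsupp.lmapDomain_apply, Finsupp.mapDomain_single]
  simp only [Selection.idx, ← Finsupp.single_finsetSum]
  rw [sum_fiber_haarNode (D.k_mono q.n)]
  rfl

end Model

/-! ### Coordinate functionals and the norms of the basis vectors -/

/-- The coordinate functional of the basis vector with index `q`. -/
noncomputable def coord {E : Type*} [NormedAddCommGroup E] [NormedSpace ℝ E] (e : Idx → E)
    (q : Idx) : E →L[ℝ] ℝ :=
  (Finsupp.lapply q : (Idx →₀ ℝ) →ₗ[ℝ] ℝ).extendOfNorm (Finsupp.linearCombination ℝ e)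

section Dense

variable {E F : Type*} [NormedAddCommGroup E] [NormedSpace ℝ E] [NormedAddCommGroup F]
  [NormedSpace ℝ F] {e : Idx → E}

/-- A bounded linear map can be prescribed on a family of vectors with dense span. -/
theorem exists_clm [CompleteSpace F] (hd : DenseRange (Finsupp.linearCombination ℝ e)) (f : Idx → F)
    {C : ℝ} (hC : 0 ≤ C)
    (h : ∀ a, ‖Finsupp.linearCombination ℝ f a‖ ≤ C * ‖Finsupp.linearCombination ℝ e a‖) :
    ∃ T : E →L[ℝ] F, (∀ q, T (e q) = f q) ∧ ‖T‖ ≤ C := by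
  refine ⟨(Finsupp.linearCombination ℝ f).extendOfNorm (Finsupp.linearCombination ℝ e),
    fun q => ?_, LinearMap.opNorm_extendOfNorm_le hd hC h⟩
  have := LinearMap.extendOfNorm_eq hd ⟨C, h⟩ (Finsupp.single q 1)
  simpa using this

theorem clm_ext (hd : DenseRange (Finsupp.linearCombination ℝ e)) {S T : E →L[ℝ] F}
    (h : ∀ q, S (e q) = T (e q)) : S = T := by
  apply ContinuousLinearMap.coeFn_injective
  refine hd.equalizer S.continuous T.continuous (funext fun a => ?_)
  simp [Finsupp.linearCombination_apply, Finsupp.sum, h]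

end Dense

/-- A tree twist that depends only on the level moves any node to any other node. -/
theorem exists_twistNode_eq {j : ℕ} (K L : Fin j → Bool) : ∃ t : Tree, twistNode t K = L := by
  refine ⟨fun l _ => xor (ext K l) (ext L l), ?_⟩
  funext i
  simp [twistNode, pre, twistPath, ext]

namespace Model

variable {E : Type*} [NormedAddCommGroup E] [NormedSpace ℝ E] {e : Idx → E} (M : Model e)

theorem norm_basis (q : Idx) : ∀ᶠ N in atTop,
    ‖e q‖ = M.rho N fun w => if pre (w.block q.n) q.j = q.K then 1 else 0 := by
  filter_upwards [M.norm_eq (Finsupp.single q 1)] with N hN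
  rw [Finsupp.linearCombination_single, one_smul] at hN
  rw [hN]
  congr 1
  funext w
  rw [values_single, M.G_single, haarNode]
  split_ifs <;> simp

/-- The common norm of the basis vectors of level `j`. It is defined by a particular vector; see
`norm_basis_eq`. -/
noncomputable def levelSize (_M : Model e) (j : ℕ) : ℝ := ‖e ⟨j, j, le_rfl, fun _ => false⟩‖

theorem norm_basis_eq (q : Idx) : ‖e q‖ = M.levelSize q.j := by
  obtain ⟨n, j, hj, K⟩ := q
  obtain ⟨t, ht⟩ := exists_twistNode_eq K fun _ => false
  have h1 := M.norm_twist (fun _ => t) (Finsupp.single ⟨n, j, hj, K⟩ 1)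
  simp only [Finsupp.linearCombination_single, one_smul, norm_smul, twistIdx, ht, twistSign,
    Real.norm_eq_abs, abs_sgn, one_mul] at h1
  rw [← h1]
  let D : Selection :=
    { S := Set.univ
      m := fun i => i + (n - j)
      k := fun _ => id
      m_inj := fun a b h => by simpa using h
      k_mono := fun _ => strictMono_id
      le := fun n _ => by simp }
  have h2 := M.norm_select D (fun _ => trivial)
    (Finsupp.single ⟨j, j, le_rfl, fun _ => false⟩ 1)
  simp only [Finsupp.linearCombination_single, one_smul] at h2
  rw [levelSize, ← h2]
  have h3 : fiber (D.k j) (fun _ : Fin j => false) = {fun _ => false} := by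
    ext L
    rw [mem_fiber, Finset.mem_singleton]
    change pre (ext L ∘ id) j = _ ↔ _
    rw [Function.comp_id]
    exact ⟨fun h => (pre_ext L).symm.trans h, fun h => (pre_ext L).trans h⟩
  have h4 : D.idx (n := j) (j := j) (Set.mem_univ j) le_rfl (fun _ => false)
      = ⟨n, j, hj, fun _ => false⟩ := by
    have : j + (n - j) = n := by omega
    simp only [Selection.idx, Idx.mk.injEq]
    exact ⟨this, rfl, HEq.rfl⟩
  rw [← h4]
  change _ = ‖∑ L ∈ fiber (D.k j) (fun _ : Fin j => false), e (D.idx (Set.mem_univ j) le_rfl L)‖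
  rw [h3, Finset.sum_singleton]

theorem levelSize_nonneg (j : ℕ) : 0 ≤ M.levelSize j := norm_nonneg _

theorem levelSize_zero : M.levelSize 0 = 1 := by
  obtain ⟨N, hN⟩ := (M.norm_basis ⟨0, 0, le_rfl, fun _ => false⟩).exists
  rw [levelSize, hN]
  refine Eq.trans ?_ (M.rho_one N)
  congr 1

theorem pre_false_succ_iff {x : ℕ → Bool} {j : ℕ} {b : Bool} :
    pre x (j + 1) = (fun i : Fin (j + 1) => if (i : ℕ) < j then false else b) ↔
      pre x j = (fun _ => false) ∧ x j = b := by
  constructor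
  · intro h
    refine ⟨funext fun i => ?_, ?_⟩
    · have := congrFun h ⟨i, by omega⟩
      simpa [pre] using this
    · have := congrFun h ⟨j, by omega⟩
      simpa [pre] using this
  · rintro ⟨h1, h2⟩
    funext ⟨i, hi⟩
    rcases Nat.lt_succ_iff_lt_or_eq.1 hi with h | rfl
    · have := congrFun h1 ⟨i, h⟩
      simpa [pre, h] using this
    · simpa [pre] using h2

theorem levelSize_succ_le (j : ℕ) : M.levelSize (j + 1) ≤ M.levelSize j := by
  obtain ⟨N, h1, h2⟩ := ((M.norm_basis
    ⟨j + 1, j + 1, le_rfl, fun i : Fin (j + 1) => if (i : ℕ) < j then false else false⟩).and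
    (M.norm_basis ⟨j + 1, j, by omega, fun _ => false⟩)).exists
  rw [M.norm_basis_eq] at h1 h2
  simp only at h1 h2
  rw [h1, h2]
  apply M.rho_mono_of_nonneg (fun w => by split_ifs <;> simp)
  intro w _
  simp only [pre_false_succ_iff]
  split_ifs <;> simp_all

theorem levelSize_antitone : Antitone M.levelSize := antitone_nat_of_succ_le M.levelSize_succ_le

theorem levelSize_le_one (j : ℕ) : M.levelSize j ≤ 1 :=
  (M.levelSize_antitone (Nat.zero_le j)).trans M.levelSize_zero.le

/-- An interval is the union of its halves. -/
theorem levelSize_le_two_mul (j : ℕ) : M.levelSize j ≤ 2 * M.levelSize (j + 1) := by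
  obtain ⟨N, h1, h2, h3⟩ := ((M.norm_basis
    ⟨j + 1, j + 1, le_rfl, fun i : Fin (j + 1) => if (i : ℕ) < j then false else false⟩).and
    ((M.norm_basis
    ⟨j + 1, j + 1, le_rfl, fun i : Fin (j + 1) => if (i : ℕ) < j then false else true⟩).and
    (M.norm_basis ⟨j + 1, j, by omega, fun _ => false⟩))).exists
  rw [M.norm_basis_eq] at h1 h2 h3
  simp only at h1 h2 h3
  rw [two_mul]
  nth_rw 1 [h1]
  rw [h2, h3]
  refine le_trans (M.rho_mono_of_nonneg (fun w => by split_ifs <;> simp) ?_)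
    (map_add_le_add (M.rho N) _ _)
  intro w _
  simp only [Pi.add_apply, pre_false_succ_iff]
  cases w.block (j + 1) j <;> simp

theorem one_le_two_pow_mul_levelSize (j : ℕ) : 1 ≤ 2 ^ j * M.levelSize j := by
  induction j with
  | zero => simp [M.levelSize_zero]
  | succ j ih =>
    refine ih.trans ?_
    rw [pow_succ, mul_assoc]
    exact mul_le_mul_of_nonneg_left (M.levelSize_le_two_mul j) (by positivity)

theorem levelSize_pos (j : ℕ) : 0 < M.levelSize j := by
  by_contra h
  have := M.one_le_two_pow_mul_levelSize j
  rw [le_antisymm (not_lt.1 h) (M.levelSize_nonneg j)] at this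
  norm_num at this

include M in
/-- Sums with signs over a level of a block are twisted Rademacher functions. -/
theorem norm_sum_signs {n j : ℕ} (hj : j ≤ n) (σ : (Fin j → Bool) → ℝ) (hσ : ∀ K, |σ K| = 1) :
    ‖∑ K, σ K • e ⟨n, j, hj, K⟩‖ = 1 := by
  have h0 : ∑ K, σ K • e ⟨n, j, hj, K⟩ = Finsupp.linearCombination ℝ e
      (∑ K, Finsupp.single (⟨n, j, hj, K⟩ : Idx) (σ K)) := by
    simp
  obtain ⟨N, hN⟩ := (M.norm_eq (∑ K, Finsupp.single (⟨n, j, hj, K⟩ : Idx) (σ K))).exists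
  rw [h0, hN, ← M.rho_one N]
  congr 1
  funext w
  simp only [map_sum, values_single]
  rw [← Finsupp.single_finsetSum, M.G_single]
  simp only [haarNode, mul_ite, mul_zero]
  simp [abs_mul, hσ]

include M in
/-- The coordinate projections are contractions. -/
theorem abs_mul_norm_le (q : Idx) (a : Idx →₀ ℝ) :
    |a q| * ‖e q‖ ≤ ‖Finsupp.linearCombination ℝ e a‖ := by
  classical
  have h0 : |a q| * ‖e q‖ = ‖Finsupp.linearCombination ℝ e (Finsupp.single q (a q))‖ := by
    rw [Finsupp.linearCombination_single, norm_smul, Real.norm_eq_abs]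
  rw [h0]
  apply M.norm_le_of_rho_le
  filter_upwards [eventually_covers a, eventually_covers (Finsupp.single q 1)] with N hN hN'
  have hqN : ∀ i ≤ q.j, Nat.pair q.n i < N := hN' q (by simp)
  let U : Set (ℕ × ℕ) := {c | c.1 = q.n ∧ c.2 < q.j}
  let σ : Bits → ℝ := fun y => sgn (y (q.n, q.j))
  refine le_trans ?_ (M.rho_average_le N U σ (fun _ => abs_sgn _) fun w => values w a)
  apply M.rho_mono_of_nonneg (fun w => apply_nonneg _ _)
  intro w _
  have hc := card_frees_pos N U
  have hqU : (q.n, q.j) ∉ U := fun h => (lt_irrefl _ h.2)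
  have key : values w (Finsupp.single q (a q))
      = (if pre (w.block q.n) q.j = q.K then (1 : ℝ) else 0) • (((frees N U).card : ℝ)⁻¹ •
          ∑ y ∈ frees N U, σ y • values (flip w y) a) := by
    have h1 : ∑ y ∈ frees N U, σ y • values (flip w y) a
        = ∑ q' ∈ a.support, a q' • Finsupp.single (q'.n, q'.j)
          (∑ y ∈ frees N U, σ y * haarNode q'.K ((flip w y).block q'.n)) := by
      simp only [values_eq_sum _ a, Finset.smul_sum]
      rw [Finset.sum_comm]
      refine Finset.sum_congr rfl fun q' _ => ?_
      rw [Finsupp.single_finsetSum, Finset.smul_sum]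
      refine Finset.sum_congr rfl fun y _ => ?_
      rw [smul_comm, Finsupp.smul_single, smul_eq_mul]
    rw [h1, Finset.smul_sum, Finset.smul_sum, values_single]
    have h2 : ∀ q' ∈ a.support, (if pre (w.block q.n) q.j = q.K then (1 : ℝ) else 0) •
        (((frees N U).card : ℝ)⁻¹ • a q' • Finsupp.single (q'.n, q'.j)
          (∑ y ∈ frees N U, σ y * haarNode q'.K ((flip w y).block q'.n)))
        = if q' = q then Finsupp.single (q.n, q.j) (a q * haarNode q.K (w.block q.n)) else 0 := by
      intro q' hq'
      by_cases hlev : (q'.n, q'.j) = (q.n, q.j)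
      · obtain ⟨n, j, hj, K⟩ := q
        obtain ⟨n', j', hj', K'⟩ := q'
        simp only [Prod.mk.injEq] at hlev
        obtain ⟨rfl, rfl⟩ := hlev
        have h3 : ∀ y ∈ frees N U, σ y * haarNode K' ((flip w y).block n')
            = haarNode K' (w.block n') := by
          intro y hy
          have h4 : pre ((flip w y).block n') j' = pre (w.block n') j' := by
            rw [pre_eq_pre]
            intro l hl
            simp [Bits.block, flip, (mem_frees.1 hy).2 (n', l) ⟨rfl, hl⟩]
          have h5 : (flip w y).block n' j' = xor (w.block n' j') (y (n', j')) := rfl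
          rw [haarNode, haarNode, h4, h5, sgn_xor]
          simp only [σ]
          split_ifs
          · rw [mul_comm, mul_assoc, sgn_mul_self, mul_one]
          · simp
        rw [Finset.sum_congr rfl h3, Finset.sum_const, nsmul_eq_mul]
        have h6 : ((⟨n', j', hj', K'⟩ : Idx) = ⟨n', j', hj, K⟩) ↔ K' = K := by
          simp
        simp only [h6]
        by_cases hKK : K' = K
        · subst hKK
          rw [if_pos rfl]
          simp only [haarNode, Finsupp.smul_single, smul_eq_mul]
          congr 1
          split_ifs
          · field_simp
          · simp
        · rw [if_neg hKK]
          simp only [haarNode]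
          by_cases h7 : pre (w.block n') j' = K
          · have h9 : ¬ pre (w.block n') j' = K' := fun h => hKK (h.symm.trans h7)
            rw [if_neg h9]
            simp
          · rw [if_neg h7, zero_smul]
      · have h3 : ∑ y ∈ frees N U, σ y * haarNode q'.K ((flip w y).block q'.n) = 0 := by
          by_cases hU : (q'.n, q'.j) ∈ U
          · refine sum_frees_eq_zero (toggle_mem_frees (c := (q.n, q.j)) (hqN _ le_rfl) hqU)
              fun y _ => ?_
            have h4 : σ (flip y (toggle (q.n, q.j))) = - σ y := by
              simp [σ, flip, toggle, sgn_not]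
            have h5 : ∀ i ≤ q'.j, (flip w (flip y (toggle (q.n, q.j)))).block q'.n i
                = (flip w y).block q'.n i := by
              intro i hi
              have : i ≠ q.j := (hi.trans_lt hU.2).ne
              simp [Bits.block, flip, toggle, this]
            rw [h4, haarNode, haarNode, h5 _ le_rfl,
              pre_eq_pre.2 fun l hl => h5 l (le_of_lt hl), neg_mul]
          · refine sum_frees_haarNode q'.K w (hN q' hq' _ le_rfl) hU fun y => ?_
            have : (q.n, q.j) ≠ (q'.n, q'.j) := fun h => hlev h.symm
            simp only [σ, flip, toggle, decide_eq_false this, Bool.xor_false]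
        have hne : ¬ q' = q := fun h => hlev (by rw [h])
        rw [h3, if_neg hne]
        simp
    rw [Finset.sum_congr rfl h2, Finset.sum_ite_eq']
    split_ifs with h
    · rfl
    · rw [Finsupp.notMem_support_iff.1 h]; simp
  rw [key, map_smul_eq_mul]
  have h8 : ‖(if pre (w.block q.n) q.j = q.K then (1 : ℝ) else 0)‖ ≤ 1 := by
    split_ifs <;> simp
  exact mul_le_of_le_one_left (apply_nonneg _ _) h8

section Coord

variable (hd : DenseRange (Finsupp.linearCombination ℝ e))

include M in
theorem norm_coord_bound (q : Idx) (a : Idx →₀ ℝ) :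
    ‖(Finsupp.lapply q : (Idx →₀ ℝ) →ₗ[ℝ] ℝ) a‖
      ≤ ‖e q‖⁻¹ * ‖Finsupp.linearCombination ℝ e a‖ := by
  have hpos : 0 < ‖e q‖ := by rw [M.norm_basis_eq]; exact M.levelSize_pos _
  rw [inv_mul_eq_div, le_div_iff₀ hpos]
  exact M.abs_mul_norm_le q a

include M hd

theorem coord_linearCombination (q : Idx) (a : Idx →₀ ℝ) :
    coord e q (Finsupp.linearCombination ℝ e a) = a q :=
  LinearMap.extendOfNorm_eq hd ⟨_, M.norm_coord_bound q⟩ a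

open Classical in
theorem coord_basis (q p : Idx) : coord e q (e p) = if p = q then 1 else 0 := by
  have := M.coord_linearCombination hd q (Finsupp.single p 1)
  rwa [Finsupp.linearCombination_single, one_smul, Finsupp.single_apply] at this

theorem norm_coord_le (q : Idx) : ‖coord e q‖ ≤ (M.levelSize q.j)⁻¹ := by
  rw [← M.norm_basis_eq]
  exact LinearMap.opNorm_extendOfNorm_le hd (inv_nonneg.2 (norm_nonneg _)) (M.norm_coord_bound q)

theorem exists_twist [CompleteSpace E] (θ : ℕ → Tree) : ∃ S : E →L[ℝ] E,
    (∀ q, S (e q) = twistSign θ q • e (twistIdx θ q)) ∧ ‖S‖ ≤ 1 :=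
  exists_clm hd _ zero_le_one fun a => by rw [M.norm_twist, one_mul]

/-- The coordinates of an element along a level of a block are summable, weighted by the lengths of
the intervals, uniformly in the level. -/
theorem sum_abs_coord_le [CompleteSpace E] {m k : ℕ} (hk : k ≤ m) (y : E) :
    ∑ K, |coord e ⟨m, k, hk, K⟩ y| ≤ 2 ^ k * ‖y‖ := by
  classical
  let D : Selection :=
    { S := {0}
      m := fun i => m + i
      k := fun _ j => k + j
      m_inj := fun a b h => by simpa using h
      k_mono := fun _ => fun a b h => by simpa using h
      le := fun n hn => by
        rw [Set.mem_singleton_iff] at hn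
        subst hn
        simpa using hk }
  obtain ⟨A, hA, hA1⟩ := exists_clm hd
    (fun q => Finsupp.linearCombination ℝ e (D.avgCoeff q)) zero_le_one
    fun a => by rw [one_mul]; exact M.norm_avg_le D a
  -- The signs of the coordinates are absorbed by a twist at the level `k` of the block `m`.
  let s : (Fin k → Bool) → Bool := fun K => decide (coord e ⟨m, k, hk, K⟩ y < 0)
  have hs : ∀ K, sgn (s K) * coord e ⟨m, k, hk, K⟩ y = |coord e ⟨m, k, hk, K⟩ y| := by
    intro K
    by_cases h : coord e ⟨m, k, hk, K⟩ y < 0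
    · simp [s, h, sgn, abs_of_neg h]
    · simp [s, h, sgn, abs_of_nonneg (not_lt.1 h)]
  let t : Tree := fun l K => if h : l = k then s (h ▸ K) else false
  have ht : ∀ K : Fin k → Bool, twistNode t K = K := by
    intro K
    funext i
    simp [twistNode, twistPath, pre, t, i.2.ne, ext]
  let θ : ℕ → Tree := fun _ => t
  obtain ⟨S, hS, hS1⟩ := M.exists_twist hd θ
  let q₀ : Idx := ⟨0, 0, le_rfl, fun _ => false⟩
  have key : (coord e q₀).comp (A.comp S)
      = ∑ K, ((2 : ℝ) ^ k)⁻¹ • sgn (s K) • coord e ⟨m, k, hk, K⟩ := by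
    refine clm_ext hd fun q => ?_
    simp only [ContinuousLinearMap.comp_apply, hS, map_smul, hA, _root_.sum_apply,
      _root_.smul_apply, M.coord_linearCombination hd, M.coord_basis hd, smul_eq_mul]
    by_cases hq : q.n = m ∧ q.j = k
    · obtain ⟨n, j, hj, K⟩ := q
      obtain ⟨rfl, rfl⟩ := hq
      rw [Finset.sum_eq_single K]
      · have h0 : (0 : ℕ) ∈ D.S := Set.mem_singleton 0
        have h1 : twistIdx θ ⟨n, j, hj, K⟩ = ⟨n, j, hj, K⟩ := by
          simp only [twistIdx, θ, ht]
        have h2 : (⟨0, 0, le_rfl, selNode (D.k 0) 0 K⟩ : Idx) = q₀ := by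
          simp only [q₀, Idx.mk.injEq, true_and, heq_eq_eq]
          exact funext fun i => i.elim0
        have h4 : D.avgCoeff ⟨n, j, hj, K⟩ = ((2 : ℝ) ^ 0 / 2 ^ j) • Finsupp.single q₀ 1 := by
          rw [← h2]
          exact D.avgCoeff_idx h0 le_rfl K
        rw [h1, h4]
        have h3 : twistSign θ ⟨n, j, hj, K⟩ = sgn (s K) := by simp [twistSign, θ, t]
        rw [h3]
        simp
        ring
      · intro L _ hL
        rw [if_neg]
        · ring
        · intro h
          exact hL (by simpa using h.symm)
      · simp
    · have h1 : D.avgCoeff (twistIdx θ q) = 0 := by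
        apply D.avgCoeff_of_notMem
        rintro ⟨n, hn, j, hj, h⟩
        have hn' : n = 0 := hn
        subst hn'
        obtain rfl : j = 0 := by omega
        simp only [twistIdx, Selection.map, Prod.mk.injEq, D] at h
        exact hq ⟨by simpa using h.1, by simpa using h.2⟩
      rw [h1]
      rw [Finset.sum_eq_zero]
      · simp
      · intro K _
        rw [if_neg]
        · ring
        · rintro rfl
          exact hq ⟨rfl, rfl⟩
  have h1 : ∑ K, |coord e ⟨m, k, hk, K⟩ y| = 2 ^ k * (coord e q₀ (A (S y))) := by
    have := congrArg (fun f => f y) key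
    simp only [ContinuousLinearMap.comp_apply, _root_.sum_apply,
      _root_.smul_apply, smul_eq_mul] at this
    rw [this, Finset.mul_sum]
    refine Finset.sum_congr rfl fun K _ => ?_
    rw [← hs, ← mul_assoc, mul_inv_cancel₀ (by positivity), one_mul]
  rw [h1]
  refine mul_le_mul_of_nonneg_left ?_ (by positivity)
  have h2 : ‖coord e q₀‖ ≤ 1 := by
    have := M.norm_coord_le hd q₀
    rwa [M.levelSize_zero, inv_one] at this
  calc coord e q₀ (A (S y)) ≤ ‖coord e q₀ (A (S y))‖ := le_abs_self _
    _ ≤ 1 * (1 * (1 * ‖y‖)) := by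
        refine (ContinuousLinearMap.le_of_opNorm_le _ h2 _).trans ?_
        refine mul_le_mul_of_nonneg_left ?_ zero_le_one
        refine (ContinuousLinearMap.le_of_opNorm_le _ hA1 _).trans ?_
        exact mul_le_mul_of_nonneg_left (ContinuousLinearMap.le_of_opNorm_le _ hS1 _) zero_le_one
    _ = ‖y‖ := by ring

end Coord

end Model

/-! ### Smallness of functionals and coordinates on far blocks -/

/-- The indices of the `n`-th block. -/
noncomputable def blockIdx (n : ℕ) : Finset Idx :=
  (Finset.univ : Finset (Σ j : Fin (n + 1), Fin j → Bool)).map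
    ⟨fun s => ⟨n, s.1, Nat.lt_succ_iff.1 s.1.2, s.2⟩, by
      rintro ⟨⟨j, hj⟩, K⟩ ⟨⟨j', hj'⟩, K'⟩ h
      simp only [Idx.mk.injEq, true_and] at h
      obtain ⟨rfl, h⟩ := h
      rw [eq_of_heq h]⟩

theorem mem_blockIdx {n : ℕ} {q : Idx} : q ∈ blockIdx n ↔ q.n = n := by
  simp only [blockIdx, Finset.mem_map, Finset.mem_univ, true_and]
  constructor
  · rintro ⟨s, rfl⟩; rfl
  · rintro rfl
    exact ⟨⟨⟨q.j, Nat.lt_succ_iff.2 q.le⟩, q.K⟩, rfl⟩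

theorem card_blockIdx_le (n : ℕ) : (blockIdx n).card ≤ 2 ^ (n + 1) := by
  rw [blockIdx, Finset.card_map, Finset.card_univ, Fintype.card_sigma]
  simp only [Fintype.card_fun, Fintype.card_bool, Fintype.card_fin]
  rw [Fin.sum_univ_eq_sum_range fun j => 2 ^ j]
  have := Nat.geomSum_eq (le_refl 2) (n + 1)
  rw [this]
  simp

namespace Model

variable {E : Type*} [NormedAddCommGroup E] [NormedSpace ℝ E] {e : Idx → E} (M : Model e)
  (hd : DenseRange (Finsupp.linearCombination ℝ e)) [CompleteSpace E]

include M hd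

theorem exists_blockProjection (B : ℕ) : ∃ P : E →L[ℝ] E,
    (∀ q, P (e q) = if q.n < B then e q else 0) ∧ ‖P‖ ≤ 1 := by
  let D : Selection :=
    { S := {n | n < B}
      m := id
      k := fun _ => id
      m_inj := Function.injective_id
      k_mono := fun _ => strictMono_id
      le := fun n _ => le_rfl }
  obtain ⟨A, hA, hA1⟩ := exists_clm hd
    (fun q => Finsupp.linearCombination ℝ e (D.avgCoeff q)) zero_le_one
    fun a => by rw [one_mul]; exact M.norm_avg_le D a
  refine ⟨A, fun q => ?_, hA1⟩
  rw [hA]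
  split_ifs with h
  · have h1 : D.avgCoeff q = ((2 : ℝ) ^ q.j / 2 ^ q.j) • Finsupp.single q 1 := by
      have h2 := D.avgCoeff_idx (n := q.n) (j := q.j) h q.le q.K
      have h3 : selNode (D.k q.n) q.j q.K = q.K := pre_ext q.K
      rw [h3] at h2
      exact h2
    rw [h1, div_self (by positivity), one_smul]
    simp
  · rw [D.avgCoeff_of_notMem, map_zero]
    rintro ⟨n, hn, j, _, h'⟩
    simp only [Selection.map, D, Prod.mk.injEq, id] at h'
    exact h (h'.1 ▸ hn)

/-- The norm is controlled by the absolute sum of the coordinates. -/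
theorem norm_le_of_sum_coord_le {y : E} {C : ℝ}
    (h : ∀ F : Finset Idx, ∑ p ∈ F, |coord e p y| ≤ C) : ‖y‖ ≤ C := by
  classical
  choose P hP hP1 using M.exists_blockProjection hd
  have hle : ∀ B, ‖P B y‖ ≤ C := by
    intro B
    have h1 : P B = ∑ p ∈ (Finset.range B).biUnion blockIdx, (coord e p).smulRight (e p) := by
      refine clm_ext hd fun q => ?_
      simp only [_root_.sum_apply, ContinuousLinearMap.smulRight_apply, M.coord_basis hd, hP,
        ite_smul, one_smul, zero_smul]
      rw [Finset.sum_ite_eq]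
      simp [mem_blockIdx]
    rw [h1]
    simp only [_root_.sum_apply, ContinuousLinearMap.smulRight_apply]
    refine (norm_sum_le _ _).trans (le_trans (Finset.sum_le_sum fun p _ => ?_) (h _))
    rw [norm_smul, Real.norm_eq_abs, M.norm_basis_eq]
    exact mul_le_of_le_one_right (abs_nonneg _) (M.levelSize_le_one _)
  have htend : Tendsto (fun B => P B y) atTop (𝓝 y) := by
    rw [Metric.tendsto_atTop]
    intro ε hε
    obtain ⟨a, ha⟩ := hd.exists_dist_lt y (half_pos hε)
    refine ⟨a.support.sup Idx.n + 1, fun B hB => ?_⟩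
    have h1 : P B (Finsupp.linearCombination ℝ e a) = Finsupp.linearCombination ℝ e a := by
      simp only [Finsupp.linearCombination_apply, Finsupp.sum, map_sum, map_smul]
      refine Finset.sum_congr rfl fun q hq => ?_
      have : q.n ≤ a.support.sup Idx.n := Finset.le_sup hq
      rw [hP, if_pos (by omega)]
    calc dist (P B y) y ≤ dist (P B y) (P B (Finsupp.linearCombination ℝ e a))
          + dist (Finsupp.linearCombination ℝ e a) y := by
            conv_rhs => rw [← h1]
            rw [h1]
            nth_rw 2 [← h1]
            exact dist_triangle _ _ _
      _ < ε / 2 + ε / 2 := by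
            refine add_lt_add_of_le_of_lt ?_ (by rwa [dist_comm])
            rw [dist_eq_norm, ← map_sub]
            refine (ContinuousLinearMap.le_of_opNorm_le _ (hP1 B) _).trans ?_
            rw [one_mul, ← dist_eq_norm]
            exact ha.le
      _ = ε := add_halves ε
  exact le_of_tendsto htend.norm (Eventually.of_forall hle)

theorem exists_sign_twist (k : ℕ) (s : ℕ → (Fin k → Bool) → Bool) : ∃ S : E →L[ℝ] E,
    (∀ n (hk : k ≤ n) (K : Fin k → Bool), S (e ⟨n, k, hk, K⟩) = sgn (s n K) • e ⟨n, k, hk, K⟩)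
      ∧ ‖S‖ ≤ 1 := by
  let θ : ℕ → Tree := fun n l K => if h : l = k then s n (h ▸ K) else false
  obtain ⟨S, hS, hS1⟩ := M.exists_twist hd θ
  refine ⟨S, fun n hk K => ?_, hS1⟩
  have ht : twistNode (θ n) K = K := by
    funext i
    simp [twistNode, twistPath, pre, θ, i.2.ne, ext]
  rw [hS]
  simp only [twistSign, twistIdx, ht]
  simp [θ]

/-- If the Rademacher functions of a fixed level of the blocks are weakly null, then every
functional is small, in the sense of `ℓ¹`, on this level of the far blocks. The signs of the values
are absorbed by a twist, which is an isometry. -/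
theorem tendsto_sum_abs {j : ℕ}
    (hw : ∀ φ : E →L[ℝ] ℝ, Tendsto (fun m => φ (∑ K : Fin j → Bool,
      e ⟨j + m, j, Nat.le_add_right j m, K⟩)) atTop (𝓝 0)) (φ : E →L[ℝ] ℝ) :
    Tendsto (fun m => ∑ K : Fin j → Bool, |φ (e ⟨j + m, j, Nat.le_add_right j m, K⟩)|) atTop
      (𝓝 0) := by
  obtain ⟨S, hS, -⟩ := M.exists_sign_twist hd j fun n K =>
    if h : j ≤ n then decide (φ (e ⟨n, j, h, K⟩) < 0) else false
  refine (hw (φ.comp S)).congr fun m => ?_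
  rw [ContinuousLinearMap.comp_apply, map_sum, map_sum]
  refine Finset.sum_congr rfl fun K _ => ?_
  rw [hS, map_smul, dif_pos (Nat.le_add_right j m), smul_eq_mul]
  by_cases h : φ (e ⟨j + m, j, Nat.le_add_right j m, K⟩) < 0
  · simp [h, sgn, abs_of_neg h]
  · simp [h, sgn, abs_of_nonneg (not_lt.1 h)]

/-- The coordinates of a fixed element on far blocks are small, in the sense of `ℓ¹`. -/
theorem tendsto_sum_abs_coord (j : ℕ) (y : E) :
    Tendsto (fun m => ∑ K : Fin j → Bool, |coord e ⟨j + m, j, Nat.le_add_right j m, K⟩ y|) atTop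
      (𝓝 0) := by
  rw [Metric.tendsto_atTop]
  intro ε hε
  have h2 : (0 : ℝ) < 2 ^ j := by positivity
  obtain ⟨a, ha⟩ := hd.exists_dist_lt y (div_pos hε h2)
  refine ⟨a.support.sup Idx.n + 1, fun m hm => ?_⟩
  have h1 : ∀ K : Fin j → Bool, coord e ⟨j + m, j, Nat.le_add_right j m, K⟩ y
      = coord e ⟨j + m, j, Nat.le_add_right j m, K⟩ (y - Finsupp.linearCombination ℝ e a) := by
    intro K
    rw [map_sub, M.coord_linearCombination hd, Finsupp.notMem_support_iff.1, sub_zero]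
    intro h
    have : j + m ≤ a.support.sup Idx.n := Finset.le_sup (f := Idx.n) h
    omega
  simp only [h1]
  rw [Real.dist_eq, sub_zero, abs_of_nonneg (Finset.sum_nonneg fun _ _ => abs_nonneg _)]
  refine (M.sum_abs_coord_le hd (Nat.le_add_right j m) _).trans_lt ?_
  rw [dist_eq_norm, lt_div_iff₀ h2, mul_comm] at ha
  exact ha

end Model

/-! ### Second moments of random signs -/

section Signs

variable {ι : Type*} [Fintype ι] [DecidableEq ι]

theorem sum_signs_eq_zero (i : ι) (g : (ι → Bool) → ℝ)
    (hg : ∀ z, g (Function.update z i (!z i)) = - g z) : ∑ z, g z = 0 := by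
  have h : ∑ z, g (Function.update z i (!z i)) = ∑ z, g z := by
    refine Finset.sum_nbij' (fun z => Function.update z i (!z i))
      (fun z => Function.update z i (!z i)) ?_ ?_ ?_ ?_ ?_ <;> intros <;> simp
  simp only [hg, Finset.sum_neg_distrib] at h
  linarith

theorem sum_signs_sq (a : ι → ℝ) :
    ∑ z : ι → Bool, (∑ i, sgn (z i) * a i) ^ 2 = Fintype.card (ι → Bool) * ∑ i, a i ^ 2 := by
  have h1 : ∀ i j, ∑ z : ι → Bool, (sgn (z i) * a i) * (sgn (z j) * a j)
      = if i = j then Fintype.card (ι → Bool) * a i ^ 2 else 0 := by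
    intro i j
    split_ifs with h
    · subst h
      have : ∀ z : ι → Bool, (sgn (z i) * a i) * (sgn (z i) * a i) = a i ^ 2 := fun z => by
        rw [mul_mul_mul_comm, sgn_mul_self, one_mul, sq]
      simp only [this, Finset.sum_const, Finset.card_univ, nsmul_eq_mul]
    · apply sum_signs_eq_zero i
      intro z
      simp only [Function.update_self, Function.update_of_ne (Ne.symm h), sgn_not]
      ring
  simp only [sq (∑ i, _), Finset.sum_mul_sum]
  rw [Finset.sum_comm, Finset.mul_sum]
  refine Finset.sum_congr rfl fun i _ => ?_
  rw [Finset.sum_comm]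
  simp [h1]

theorem sum_signs_offDiag_sq_le (a : ι → ι → ℝ) :
    ∑ z : ι → Bool, (∑ p ∈ (Finset.univ : Finset ι).offDiag,
        sgn (z p.1) * sgn (z p.2) * a p.1 p.2) ^ 2
      ≤ Fintype.card (ι → Bool) * (2 * ∑ i, ∑ j, a i j ^ 2) := by
  have h0 : ∀ p ∈ (Finset.univ : Finset ι).offDiag, ∀ p' ∈ (Finset.univ : Finset ι).offDiag,
      ∑ z : ι → Bool, (sgn (z p.1) * sgn (z p.2) * a p.1 p.2)
        * (sgn (z p'.1) * sgn (z p'.2) * a p'.1 p'.2)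
      ≤ if p' = p then Fintype.card (ι → Bool) * a p.1 p.2 ^ 2
        else if p' = p.swap then
          Fintype.card (ι → Bool) * ((a p.1 p.2 ^ 2 + a p.2 p.1 ^ 2) / 2) else 0 := by
    rintro ⟨i, j⟩ hp ⟨i', j'⟩ hp'
    have hij : i ≠ j := by simpa using hp
    have hij' : i' ≠ j' := by simpa using hp'
    have hs : ∀ z : ι → Bool, ∀ x, sgn (z x) * sgn (z x) = 1 := fun z x => sgn_mul_self _
    split_ifs with h1 h2
    · obtain ⟨rfl, rfl⟩ := Prod.mk.inj h1
      have : ∀ z : ι → Bool, (sgn (z i') * sgn (z j') * a i' j')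
          * (sgn (z i') * sgn (z j') * a i' j') = a i' j' ^ 2 := fun z => by
        linear_combination (a i' j' ^ 2 * (sgn (z j') * sgn (z j'))) * hs z i'
          + a i' j' ^ 2 * hs z j'
      simp only [this, Finset.sum_const, Finset.card_univ, nsmul_eq_mul, le_refl]
    · obtain ⟨rfl, rfl⟩ := Prod.mk.inj h2
      have : ∀ z : ι → Bool, (sgn (z j') * sgn (z i') * a j' i')
          * (sgn (z i') * sgn (z j') * a i' j') = a j' i' * a i' j' := fun z => by
        linear_combination (a j' i' * a i' j' * (sgn (z i') * sgn (z i'))) * hs z j'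
          + a j' i' * a i' j' * hs z i'
      simp only [this, Finset.sum_const, Finset.card_univ, nsmul_eq_mul]
      refine mul_le_mul_of_nonneg_left ?_ (Nat.cast_nonneg _)
      nlinarith [sq_nonneg (a j' i' - a i' j')]
    · refine le_of_eq ?_
      -- One of the four indices differs from the other three.
      have hcase : (i ≠ i' ∧ i ≠ j') ∨ (j ≠ i' ∧ j ≠ j') := by
        by_contra hcon
        simp only [Prod.mk.injEq, Prod.swap_prod_mk] at h1 h2
        grind
      rcases hcase with ⟨h3, h4⟩ | ⟨h3, h4⟩
      · apply sum_signs_eq_zero i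
        intro z
        simp only [Function.update_self, Function.update_of_ne hij.symm,
          Function.update_of_ne h3.symm, Function.update_of_ne h4.symm, sgn_not]
        ring
      · apply sum_signs_eq_zero j
        intro z
        simp only [Function.update_self, Function.update_of_ne hij,
          Function.update_of_ne h3.symm, Function.update_of_ne h4.symm, sgn_not]
        ring
  set c : ℝ := ((Fintype.card (ι → Bool) : ℕ) : ℝ) with hc
  have hc0 : 0 ≤ c := Nat.cast_nonneg _
  simp only [sq (∑ p ∈ _, _), Finset.sum_mul_sum]
  rw [Finset.sum_comm]
  have h1 : ∀ p ∈ (Finset.univ : Finset ι).offDiag,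
      ∑ z : ι → Bool, ∑ p' ∈ (Finset.univ : Finset ι).offDiag,
        (sgn (z p.1) * sgn (z p.2) * a p.1 p.2) * (sgn (z p'.1) * sgn (z p'.2) * a p'.1 p'.2)
      ≤ c * (a p.1 p.2 ^ 2 + (a p.1 p.2 ^ 2 + a p.2 p.1 ^ 2) / 2) := by
    intro p hp
    rw [Finset.sum_comm]
    refine (Finset.sum_le_sum fun p' hp' => h0 p hp p' hp').trans ?_
    have h2 : ∀ p' ∈ (Finset.univ : Finset ι).offDiag,
        (if p' = p then c * a p.1 p.2 ^ 2 else if p' = p.swap then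
          c * ((a p.1 p.2 ^ 2 + a p.2 p.1 ^ 2) / 2) else 0)
        ≤ (if p' = p then c * a p.1 p.2 ^ 2 else 0) + if p' = p.swap then
          c * ((a p.1 p.2 ^ 2 + a p.2 p.1 ^ 2) / 2) else 0 := by
      intro p' _
      have h4 : 0 ≤ c * ((a p.1 p.2 ^ 2 + a p.2 p.1 ^ 2) / 2) := by positivity
      split_ifs <;> linarith
    refine (Finset.sum_le_sum h2).trans ?_
    rw [Finset.sum_add_distrib, Finset.sum_ite_eq', Finset.sum_ite_eq', mul_add]
    refine add_le_add ?_ ?_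
    · rw [if_pos hp]
    · split_ifs
      · exact le_rfl
      · positivity
  refine (Finset.sum_le_sum h1).trans ?_
  rw [← Finset.mul_sum]
  refine mul_le_mul_of_nonneg_left ?_ hc0
  refine (Finset.sum_le_univ_sum_of_nonneg fun p => by positivity).trans ?_
  rw [Fintype.sum_prod_type]
  simp only [Finset.sum_add_distrib, ← Finset.sum_div]
  rw [Finset.sum_comm (f := fun i j => a j i ^ 2)]
  apply le_of_eq
  ring

end Signs

/-! ### Random tree twists -/

/-- The orientations of the nodes up to level `M`. -/
abbrev FinTree (M : ℕ) : Type := (l : Fin (M + 1)) → (Fin l → Bool) → Bool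

/-- A finite tree, extended trivially to the deeper levels. -/
def FinTree.toTree {M : ℕ} (θ : FinTree M) : Tree := fun l K =>
  if h : l < M + 1 then θ ⟨l, h⟩ K else false

/-- Change of the orientations of the level `l` of a tree. -/
def FinTree.act {M : ℕ} (l : Fin (M + 1)) (z : (Fin l → Bool) → Bool) (θ : FinTree M) : FinTree M :=
  Function.update θ l fun K => xor (θ l K) (z K)

namespace FinTree

variable {M : ℕ}

theorem act_act (l : Fin (M + 1)) (z : (Fin l → Bool) → Bool) (θ : FinTree M) :
    act l z (act l z θ) = θ := by
  simp [act]

theorem sum_act (l : Fin (M + 1)) (z : (Fin l → Bool) → Bool) (f : FinTree M → ℝ) :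
    ∑ θ, f (act l z θ) = ∑ θ, f θ := by
  refine Finset.sum_nbij' (act l z) (act l z) ?_ ?_ ?_ ?_ ?_ <;> intros <;> simp [act_act]

theorem toTree_act_self (l : Fin (M + 1)) (z : (Fin l → Bool) → Bool) (θ : FinTree M)
    (K : Fin l → Bool) : (act l z θ).toTree l K = xor (θ.toTree l K) (z K) := by
  have h : (l : ℕ) < M + 1 := l.2
  simp only [toTree, dif_pos h, act]
  simp

theorem toTree_act_of_ne {l : Fin (M + 1)} {l' : ℕ} (h : l' ≠ l) (z : (Fin l → Bool) → Bool)
    (θ : FinTree M) (K : Fin l' → Bool) : (act l z θ).toTree l' K = θ.toTree l' K := by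
  simp only [toTree]
  split_ifs with h1
  · rw [act, Function.update_of_ne]
    exact fun h2 => h (congrArg Fin.val h2)
  · rfl

end FinTree

theorem twistNode_congr {t t' : Tree} {j : ℕ} (h : ∀ l < j, ∀ K : Fin l → Bool, t l K = t' l K)
    (K : Fin j → Bool) : twistNode t K = twistNode t' K := by
  rw [twistNode, twistNode, pre_eq_pre]
  intro l hl
  rw [twistPath, twistPath, h l hl]

namespace FinTree

variable {M : ℕ}

theorem twistNode_act {l : Fin (M + 1)} {j : ℕ} (h : j ≤ l) (z : (Fin l → Bool) → Bool)
    (θ : FinTree M) (K : Fin j → Bool) :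
    twistNode (act l z θ).toTree K = twistNode θ.toTree K :=
  twistNode_congr (fun l' hl' K => toTree_act_of_ne (by omega) z θ K) K

/-- Averaging over the orientations of a level first. -/
theorem card_mul_sum (l : Fin (M + 1)) (f : FinTree M → ℝ) :
    Fintype.card ((Fin l → Bool) → Bool) * ∑ θ, f θ
      = ∑ θ, ∑ z : (Fin l → Bool) → Bool, f (act l z θ) := by
  rw [Finset.sum_comm]
  simp only [sum_act]
  rw [Finset.sum_const, Finset.card_univ, nsmul_eq_mul]

theorem card_signs_pos (l : Fin (M + 1)) :
    (0 : ℝ) < Fintype.card ((Fin l → Bool) → Bool) := by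
  exact_mod_cast Fintype.card_pos

/-- The signs of the nodes of level `l` are orthogonal with respect to coefficients that do not
depend on them. -/
theorem sum_sq_signs {l : ℕ} (hl : l ≤ M) (c : FinTree M → (Fin l → Bool) → ℝ)
    (hc : ∀ z θ K, c (act ⟨l, Nat.lt_succ_of_le hl⟩ z θ) K = c θ K) :
    ∑ θ : FinTree M, (∑ K, sgn (θ.toTree l K) * c θ K) ^ 2 = ∑ θ : FinTree M, ∑ K, c θ K ^ 2 := by
  let l' : Fin (M + 1) := ⟨l, Nat.lt_succ_of_le hl⟩
  have hpos := card_signs_pos l'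
  apply mul_left_cancel₀ hpos.ne'
  rw [card_mul_sum l', Finset.mul_sum]
  refine Finset.sum_congr rfl fun θ _ => ?_
  have h1 : ∀ z : (Fin l → Bool) → Bool,
      (∑ K, sgn ((act l' z θ).toTree l K) * c (act l' z θ) K)
        = ∑ K, sgn (z K) * (sgn (θ.toTree l K) * c θ K) := by
    intro z
    refine Finset.sum_congr rfl fun K _ => ?_
    have h2 := toTree_act_self l' z θ K
    rw [show (act l' z θ).toTree l K = xor (θ.toTree l K) (z K) from h2, hc z θ K, sgn_xor]
    ring
  have h3 := sum_signs_sq fun K : Fin l → Bool => sgn (θ.toTree l K) * c θ K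
  simp only [mul_pow, sgn_sq, one_mul] at h3
  rw [← h3]
  exact Finset.sum_congr rfl fun z _ => by rw [← h1 z]

/-- First order: a random signed sum over some nodes of a level. -/
theorem sum_sq_single_le {l : ℕ} (hl : l ≤ M) (B : Finset (Fin l → Bool))
    (W : (Fin l → Bool) → ℝ) :
    ∑ θ : FinTree M, (∑ K ∈ B, sgn (θ.toTree l K) * W (twistNode θ.toTree K)) ^ 2
      ≤ Fintype.card (FinTree M) * ∑ K, W K ^ 2 := by
  have h1 := sum_sq_signs hl (fun θ K => if K ∈ B then W (twistNode θ.toTree K) else 0)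
    fun z θ K => by rw [twistNode_act le_rfl]
  have h2 : ∀ θ : FinTree M, ∑ K ∈ B, sgn (θ.toTree l K) * W (twistNode θ.toTree K)
      = ∑ K, sgn (θ.toTree l K) * (if K ∈ B then W (twistNode θ.toTree K) else 0) := fun θ => by
    simp
  simp only [h2, h1]
  rw [← nsmul_eq_mul, ← Finset.card_univ, ← Finset.sum_const]
  refine Finset.sum_le_sum fun θ _ => ?_
  rw [← (twistNode_bijective θ.toTree l).sum_comp fun K => W K ^ 2]
  refine Finset.sum_le_sum fun K _ => ?_
  split_ifs
  · exact le_rfl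
  · rw [zero_pow two_ne_zero]; positivity

/-- Second order, different levels. -/
theorem sum_sq_pair_le {k l : ℕ} (hk : k ≤ M) (hlk : l < k) (B : Finset (Fin k → Bool))
    (B' : Finset (Fin l → Bool)) (t : (Fin k → Bool) → (Fin l → Bool) → ℝ) :
    ∑ θ : FinTree M, (∑ K ∈ B, ∑ L ∈ B', sgn (θ.toTree k K) * sgn (θ.toTree l L)
        * t (twistNode θ.toTree K) (twistNode θ.toTree L)) ^ 2
      ≤ Fintype.card (FinTree M) * ∑ K, ∑ L, t K L ^ 2 := by
  have h1 := sum_sq_signs hk (fun θ K => if K ∈ B then ∑ L ∈ B', sgn (θ.toTree l L)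
      * t (twistNode θ.toTree K) (twistNode θ.toTree L) else 0)
    fun z θ K => by
      simp only [twistNode_act (l := ⟨k, Nat.lt_succ_of_le hk⟩) (j := k) le_rfl]
      simp only [twistNode_act (l := ⟨k, Nat.lt_succ_of_le hk⟩) (j := l) hlk.le]
      simp only [toTree_act_of_ne (l := ⟨k, Nat.lt_succ_of_le hk⟩) (l' := l) hlk.ne]
  have h2 : ∀ θ : FinTree M, ∑ K ∈ B, ∑ L ∈ B', sgn (θ.toTree k K) * sgn (θ.toTree l L)
        * t (twistNode θ.toTree K) (twistNode θ.toTree L)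
      = ∑ K, sgn (θ.toTree k K) * (if K ∈ B then ∑ L ∈ B', sgn (θ.toTree l L)
        * t (twistNode θ.toTree K) (twistNode θ.toTree L) else 0) := fun θ => by
    simp [Finset.mul_sum, mul_assoc]
  simp only [h2, h1]
  have h3 : ∀ θ : FinTree M, ∑ K, (if K ∈ B then ∑ L ∈ B', sgn (θ.toTree l L)
        * t (twistNode θ.toTree K) (twistNode θ.toTree L) else 0) ^ 2
      ≤ ∑ K, (∑ L ∈ B', sgn (θ.toTree l L) * t K (twistNode θ.toTree L)) ^ 2 := by
    intro θ
    rw [← (twistNode_bijective θ.toTree k).sum_comp fun K =>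
      (∑ L ∈ B', sgn (θ.toTree l L) * t K (twistNode θ.toTree L)) ^ 2]
    refine Finset.sum_le_sum fun K _ => ?_
    split_ifs
    · exact le_rfl
    · rw [zero_pow two_ne_zero]; positivity
  refine (Finset.sum_le_sum fun θ _ => h3 θ).trans ?_
  rw [Finset.sum_comm, Finset.mul_sum]
  exact Finset.sum_le_sum fun K _ => sum_sq_single_le (hlk.le.trans hk) B' (t K)

/-- Second order, same level. -/
theorem sum_sq_offDiag_le {k : ℕ} (hk : k ≤ M) (B B' : Finset (Fin k → Bool))
    (t : (Fin k → Bool) → (Fin k → Bool) → ℝ) :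
    ∑ θ : FinTree M, (∑ p ∈ (B ×ˢ B').filter fun p => p.1 ≠ p.2,
        sgn (θ.toTree k p.1) * sgn (θ.toTree k p.2)
        * t (twistNode θ.toTree p.1) (twistNode θ.toTree p.2)) ^ 2
      ≤ Fintype.card (FinTree M) * (2 * ∑ K, ∑ L, t K L ^ 2) := by
  let l' : Fin (M + 1) := ⟨k, Nat.lt_succ_of_le hk⟩
  have hpos := card_signs_pos l'
  refine le_of_mul_le_mul_left ?_ hpos
  rw [card_mul_sum l', mul_left_comm, ← nsmul_eq_mul (Fintype.card (FinTree M)),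
    ← Finset.card_univ (α := FinTree M), ← Finset.sum_const]
  refine Finset.sum_le_sum fun θ _ => ?_
  let a : (Fin k → Bool) → (Fin k → Bool) → ℝ := fun K L =>
    if K ∈ B ∧ L ∈ B' then sgn (θ.toTree k K) * sgn (θ.toTree k L)
      * t (twistNode θ.toTree K) (twistNode θ.toTree L) else 0
  have h1 : ∀ z : (Fin k → Bool) → Bool, (∑ p ∈ (B ×ˢ B').filter fun p => p.1 ≠ p.2,
        sgn ((act l' z θ).toTree k p.1) * sgn ((act l' z θ).toTree k p.2)
        * t (twistNode (act l' z θ).toTree p.1) (twistNode (act l' z θ).toTree p.2))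
      = ∑ p ∈ (Finset.univ : Finset (Fin k → Bool)).offDiag,
        sgn (z p.1) * sgn (z p.2) * a p.1 p.2 := by
    intro z
    have h2 : (B ×ˢ B').filter (fun p => p.1 ≠ p.2)
        = (Finset.univ : Finset (Fin k → Bool)).offDiag.filter fun p => p.1 ∈ B ∧ p.2 ∈ B' := by
      ext p
      simp [and_comm]
    rw [h2, Finset.sum_filter]
    refine Finset.sum_congr rfl fun p _ => ?_
    have h3 : ∀ K : Fin k → Bool, (act l' z θ).toTree k K = xor (θ.toTree k K) (z K) :=
      fun K => toTree_act_self l' z θ K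
    have h4 : ∀ K : Fin k → Bool, twistNode (act l' z θ).toTree K = twistNode θ.toTree K :=
      fun K => twistNode_act (l := l') le_rfl z θ K
    simp only [h3, h4, sgn_xor, a]
    split_ifs
    · ring
    · ring
  simp only [h1]
  refine (sum_signs_offDiag_sq_le a).trans ?_
  refine mul_le_mul_of_nonneg_left ?_ hpos.le
  refine mul_le_mul_of_nonneg_left ?_ zero_le_two
  have hb := twistNode_bijective θ.toTree k
  rw [← hb.sum_comp fun K => ∑ L, t K L ^ 2]
  refine Finset.sum_le_sum fun K _ => ?_
  rw [← hb.sum_comp fun L => t (twistNode θ.toTree K) L ^ 2]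
  refine Finset.sum_le_sum fun L _ => ?_
  simp only [a]
  split_ifs
  · simp only [mul_pow, sgn_sq, one_mul, le_refl]
  · rw [zero_pow two_ne_zero]; positivity

end FinTree

/-! ### Averages of a bounded function over random selected nodes -/

theorem twistNode_pre (t : Tree) {l j : ℕ} (hlj : l ≤ j) (K : Fin j → Bool) :
    twistNode t (pre (ext K) l) = pre (ext (twistNode t K)) l := by
  rw [← pre_twistPath, pre_eq_pre]
  intro i hi
  simp [ext, twistNode, pre, hi.trans_le hlj]

theorem ext_twistNode (t : Tree) {l j : ℕ} (hlj : l < j) (K : Fin j → Bool) :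
    ext (twistNode t K) l = xor (ext K l) (t l (pre (ext K) l)) := by
  simp [ext, twistNode, pre, hlj, twistPath]

/-- The number of extensions of a node of level `l` to a node of level `j`. -/
theorem card_extensions {l j : ℕ} (hlj : l ≤ j) (L : Fin l → Bool) :
    ((Finset.univ.filter fun K : Fin j → Bool => pre (ext K) l = L).card : ℝ) * 2 ^ l = 2 ^ j := by
  -- With this choice of levels, the extensions of `L` form a fiber of `selNode`.
  let k : ℕ → ℕ := fun i => if i < l then i else j + (i - l)
  have hk : StrictMono k := by
    intro a b hab
    simp only [k]
    split_ifs <;> omega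
  have hkl : k l = j := by simp [k]
  have h := card_fiber hk L
  have key : ∀ j', k l = j' →
      (fiber k L).card = (Finset.univ.filter fun K : Fin j' → Bool => pre (ext K) l = L).card := by
    rintro _ rfl
    rw [fiber]
    congr 2
    funext K
    have : selNode k l K = pre (ext K) l := by
      rw [selNode, pre_eq_pre]
      intro i hi
      simp [k, hi]
    rw [this]
  rw [key j hkl, hkl] at h
  exact_mod_cast h

namespace FinTree

variable {M : ℕ}

/-- The signs of the choices at level `l`, summed against a bounded function of the twisted node. -/
theorem sum_sq_sgn_le {l j : ℕ} (hl : l ≤ M) (hlj : l < j) (B : Finset (Fin l → Bool))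
    (d : (Fin j → Bool) → ℝ) {Γ : ℝ} (hd : ∀ K, |d K| ≤ Γ) :
    ∑ θ : FinTree M, (∑ K ∈ Finset.univ.filter fun K : Fin j → Bool => pre (ext K) l ∈ B,
        sgn (ext K l) * d (twistNode θ.toTree K)) ^ 2
      ≤ Fintype.card (FinTree M) * (4 ^ j / 2 ^ l * Γ ^ 2) := by
  let Z : (Fin l → Bool) → ℝ := fun L =>
    ∑ K ∈ Finset.univ.filter fun K : Fin j → Bool => pre (ext K) l = L, sgn (ext K l) * d K
  have h1 : ∀ θ : FinTree M,
      ∑ K ∈ Finset.univ.filter fun K : Fin j → Bool => pre (ext K) l ∈ B,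
        sgn (ext K l) * d (twistNode θ.toTree K)
      = ∑ L ∈ B, sgn (θ.toTree l L) * Z (twistNode θ.toTree L) := by
    intro θ
    rw [← Finset.sum_fiberwise_of_maps_to (t := B) (g := fun K : Fin j → Bool => pre (ext K) l)
      fun K hK => (Finset.mem_filter.1 hK).2]
    refine Finset.sum_congr rfl fun L hL => ?_
    simp only [Z, Finset.mul_sum, Finset.filter_filter]
    refine Finset.sum_nbij (twistNode θ.toTree) ?_ (twistNode_injective _ _).injOn ?_ ?_
    · intro K hK
      simp only [Finset.mem_filter, Finset.mem_univ, true_and] at hK ⊢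
      rw [← twistNode_pre _ hlj.le, hK.2]
    · intro K hK
      obtain ⟨K', rfl⟩ := (twistNode_bijective θ.toTree j).2 K
      refine ⟨K', ?_, rfl⟩
      simp only [Finset.coe_filter, Finset.mem_univ, true_and, Set.mem_ofPred_eq] at hK ⊢
      rw [← twistNode_pre _ hlj.le] at hK
      have := twistNode_injective _ _ hK
      exact ⟨this ▸ hL, this⟩
    · intro K hK
      simp only [Finset.mem_filter, Finset.mem_univ, true_and] at hK
      rw [ext_twistNode _ hlj, sgn_xor, hK.2]
      linear_combination (-(sgn (ext K l) * d (twistNode θ.toTree K)))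
        * sgn_mul_self (θ.toTree l L)
  simp only [h1]
  refine (sum_sq_single_le hl B Z).trans ?_
  refine mul_le_mul_of_nonneg_left ?_ (Nat.cast_nonneg _)
  have hΓ : 0 ≤ Γ := (abs_nonneg _).trans (hd fun _ => false)
  have h2 : ∀ L, Z L ^ 2 ≤ (2 ^ j / 2 ^ l * Γ) ^ 2 := by
    intro L
    apply sq_le_sq'
    all_goals
      have h3 : |Z L| ≤ 2 ^ j / 2 ^ l * Γ := by
        refine (Finset.abs_sum_le_sum_abs _ _).trans ?_
        refine (Finset.sum_le_sum (g := fun _ => Γ) fun K _ => ?_).trans ?_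
        · rw [abs_mul, abs_sgn, one_mul]
          exact hd K
        · rw [Finset.sum_const, nsmul_eq_mul]
          refine mul_le_mul_of_nonneg_right ?_ hΓ
          rw [le_div_iff₀ (by positivity), card_extensions hlj.le]
    · exact (abs_le.1 h3).1
    · exact (abs_le.1 h3).2
  refine (Finset.sum_le_sum fun L _ => h2 L).trans ?_
  rw [Finset.sum_const, Finset.card_univ, Fintype.card_fun, Fintype.card_bool, Fintype.card_fin,
    nsmul_eq_mul]
  push_cast
  apply le_of_eq
  have h4 : (4 : ℝ) ^ j = 2 ^ j * 2 ^ j := by rw [← mul_pow]; norm_num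
  rw [h4]
  field_simp

/-- The average of a bounded function over the nodes that are randomly selected by a twist is
close to the full average. The `j` choices at the levels `k 0, …, k (j - 1)` are made one after the
other, and each of them changes the average by a sum of many independent small terms. -/
theorem sum_sq_average_le {k : ℕ → ℕ} (hk : StrictMono k) {j : ℕ} (hj : k j ≤ M)
    (I : Fin j → Bool) (d : (Fin (k j) → Bool) → ℝ) {Γ : ℝ} (hd : ∀ K, |d K| ≤ Γ) :
    ∑ θ : FinTree M, ((2 : ℝ) ^ j / 2 ^ k j * ∑ K ∈ fiber k I, d (twistNode θ.toTree K)
        - (2 ^ k j)⁻¹ * ∑ K, d K) ^ 2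
      ≤ Fintype.card (FinTree M) * (j * (∑ i ∈ Finset.range j, 4 ^ i / 2 ^ k i) * Γ ^ 2) := by
  -- `avg θ i` is the average after the first `i` choices.
  let P : ℕ → Finset (Fin (k j) → Bool) := fun i =>
    Finset.univ.filter fun K => ∀ l < i, ext K (k l) = ext I l
  let avg : FinTree M → ℕ → ℝ := fun θ i =>
    (2 : ℝ) ^ i / 2 ^ k j * ∑ K ∈ P i, d (twistNode θ.toTree K)
  have h0 : ∀ θ, avg θ 0 = (2 ^ k j)⁻¹ * ∑ K, d K := by
    intro θ
    have : P 0 = Finset.univ := by simp [P]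
    simp only [avg, this]
    rw [(twistNode_bijective θ.toTree (k j)).sum_comp d, pow_zero, one_div]
  have hj' : ∀ θ, avg θ j = (2 : ℝ) ^ j / 2 ^ k j * ∑ K ∈ fiber k I, d (twistNode θ.toTree K) := by
    intro θ
    have : P j = fiber k I := by
      ext K
      simp only [P, Finset.mem_filter, Finset.mem_univ, true_and, mem_fiber, selNode]
      conv_rhs => rw [← pre_ext I]
      rw [pre_eq_pre]
      rfl
    simp only [avg, this]
  have hstep : ∀ θ, ∀ i < j, avg θ (i + 1) - avg θ i = (2 : ℝ) ^ i / 2 ^ k j * sgn (ext I i)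
      * ∑ K ∈ P i, sgn (ext K (k i)) * d (twistNode θ.toTree K) := by
    intro θ i hi
    have h1 : P (i + 1) = (P i).filter fun K => ext K (k i) = ext I i := by
      ext K
      simp only [P, Finset.mem_filter, Finset.mem_univ, true_and]
      constructor
      · exact fun h => ⟨fun l hl => h l (by omega), h i (by omega)⟩
      · rintro ⟨h1, h2⟩ l hl
        rcases Nat.lt_succ_iff_lt_or_eq.1 hl with h | rfl
        exacts [h1 l h, h2]
    simp only [avg, h1, Finset.sum_filter, Finset.mul_sum]
    rw [← Finset.sum_sub_distrib]
    refine Finset.sum_congr rfl fun K _ => ?_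
    cases ext K (k i) <;> cases ext I i <;> simp [sgn] <;> ring
  have hP : ∀ i < j, P i = Finset.univ.filter fun K : Fin (k j) → Bool => pre (ext K) (k i) ∈
      Finset.univ.filter fun L : Fin (k i) → Bool => ∀ l < i, ext L (k l) = ext I l := by
    intro i hi
    ext K
    simp only [P, Finset.mem_filter, Finset.mem_univ, true_and]
    refine forall₂_congr fun l hl => ?_
    have : ext (pre (ext K) (k i)) (k l) = ext K (k l) := by
      have h1 := hk hl
      have h2 := hk (hl.trans hi)
      simp [ext, pre, h1]
    rw [this]
  have hsum : ∀ i < j, ∑ θ : FinTree M, (avg θ (i + 1) - avg θ i) ^ 2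
      ≤ Fintype.card (FinTree M) * (4 ^ i / 2 ^ k i * Γ ^ 2) := by
    intro i hi
    have h1 := sum_sq_sgn_le (M := M) (((hk hi).le).trans hj) (hk hi)
      (Finset.univ.filter fun L : Fin (k i) → Bool => ∀ l < i, ext L (k l) = ext I l) d hd
    rw [← hP i hi] at h1
    have h2 : ∀ θ, (avg θ (i + 1) - avg θ i) ^ 2 = ((2 : ℝ) ^ i / 2 ^ k j) ^ 2
        * (∑ K ∈ P i, sgn (ext K (k i)) * d (twistNode θ.toTree K)) ^ 2 := by
      intro θ
      rw [hstep θ i hi, mul_pow, mul_pow, sgn_sq, mul_one]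
    simp only [h2]
    rw [← Finset.mul_sum]
    refine (mul_le_mul_of_nonneg_left h1 (by positivity)).trans (le_of_eq ?_)
    have h4 : ∀ n : ℕ, (4 : ℝ) ^ n = 2 ^ n * 2 ^ n := fun n => by rw [← mul_pow]; norm_num
    rw [h4, h4]
    field_simp
  have h1 : ∀ θ, ((2 : ℝ) ^ j / 2 ^ k j * ∑ K ∈ fiber k I, d (twistNode θ.toTree K)
        - (2 ^ k j)⁻¹ * ∑ K, d K) ^ 2
      ≤ j * ∑ i ∈ Finset.range j, (avg θ (i + 1) - avg θ i) ^ 2 := by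
    intro θ
    rw [← h0 θ, ← hj' θ, ← Finset.sum_range_sub (avg θ) j]
    have := sq_sum_le_card_mul_sum_sq (s := Finset.range j)
      (f := fun i => avg θ (i + 1) - avg θ i)
    rwa [Finset.card_range] at this
  refine (Finset.sum_le_sum fun θ _ => h1 θ).trans ?_
  rw [← Finset.mul_sum, Finset.sum_comm]
  refine (mul_le_mul_of_nonneg_left (Finset.sum_le_sum fun i hi => hsum i (Finset.mem_range.1 hi))
    (Nat.cast_nonneg _)).trans (le_of_eq ?_)
  rw [← Finset.mul_sum, ← Finset.sum_mul]
  ring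

end FinTree

/-! ### Two-level decay -/

/-- Positive sequences `a`, `b` that decrease and satisfy `a k * b k = 2⁻ᵏ`: one of them tends to
`0`, and this makes the bounds for the second moments of the matrix entries between any two of
suitably chosen levels small. -/
theorem exists_level_bound {a b : ℕ → ℝ} (ha : ∀ k, 0 < a k) (hb : ∀ k, 0 < b k)
    (ha' : Antitone a) (hb' : Antitone b) (hab : ∀ k, 2 ^ k * (a k * b k) = 1) {ε : ℝ}
    (hε : 0 < ε) :
    ∃ k₀, ∀ l ≥ k₀, a l * b l * min (2 ^ l * a l) (2 ^ l * b l) ≤ ε ∧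
      ∀ᶠ k in atTop, a l * b k * min (2 ^ l * a l) (2 ^ k * b k) ≤ ε ∧
        a k * b l * min (2 ^ k * a k) (2 ^ l * b l) ≤ ε := by
  have key : ∀ {a b : ℕ → ℝ}, (∀ k, 0 < a k) → (∀ k, 0 < b k) →
      Antitone a → Antitone b → (∀ k, 2 ^ k * (a k * b k) = 1) → Tendsto a atTop (𝓝 0) →
      ∃ k₀, ∀ l ≥ k₀, a l * b l * min (2 ^ l * a l) (2 ^ l * b l) ≤ ε ∧
      ∀ᶠ k in atTop, a l * b k * min (2 ^ l * a l) (2 ^ k * b k) ≤ ε ∧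
        a k * b l * min (2 ^ k * a k) (2 ^ l * b l) ≤ ε := by
    intro a b ha hb ha' hb' hab hlim
    obtain ⟨k₀, hk₀⟩ := eventually_atTop.1 (hlim.eventually (eventually_le_nhds hε))
    have h1 : ∀ l ≥ k₀, ∀ k ≥ l, a l * b k * min (2 ^ l * a l) (2 ^ k * b k) ≤ ε := by
      intro l hl k hk
      calc a l * b k * min (2 ^ l * a l) (2 ^ k * b k) ≤ a l * b l * (2 ^ l * a l) := by
            refine mul_le_mul ?_ (min_le_left _ _) ?_ ?_
            · exact mul_le_mul_of_nonneg_left (hb' hk) (ha l).le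
            · have := ha l; have := hb k; positivity
            · have := ha l; have := hb l; positivity
        _ = 2 ^ l * (a l * b l) * a l := by ring
        _ = a l := by rw [hab, one_mul]
        _ ≤ ε := hk₀ l hl
    refine ⟨k₀, fun l hl => ⟨h1 l hl l le_rfl, ?_⟩⟩
    have h2 : Tendsto (fun k => a k * (b l * (2 ^ l * b l))) atTop (𝓝 0) := by
      simpa using hlim.mul_const (b l * (2 ^ l * b l))
    filter_upwards [eventually_ge_atTop l, h2.eventually (eventually_le_nhds hε)] with k hk hk2
    refine ⟨h1 l hl k hk, le_trans ?_ hk2⟩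
    rw [mul_assoc]
    refine mul_le_mul_of_nonneg_left ?_ (ha k).le
    exact mul_le_mul_of_nonneg_left (min_le_right _ _) (hb l).le
  by_cases hlim : Tendsto a atTop (𝓝 0)
  · exact key ha hb ha' hb' hab hlim
  · -- Then `a` is bounded below, and `b k = 2⁻ᵏ / a k` tends to `0`.
    have hlim' : Tendsto b atTop (𝓝 0) := by
      obtain ⟨c, hc, hac⟩ : ∃ c > 0, ∀ k, c ≤ a k := by
        by_contra! hcon
        apply hlim
        rw [Metric.tendsto_atTop]
        intro η hη
        obtain ⟨k, hk⟩ := hcon η hη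
        refine ⟨k, fun n hn => ?_⟩
        rw [Real.dist_eq, sub_zero, abs_of_pos (ha n)]
        exact (ha' hn).trans_lt hk
      have h1 : Tendsto (fun k : ℕ => c⁻¹ * (1 / 2 : ℝ) ^ k) atTop (𝓝 0) := by
        simpa using (tendsto_pow_atTop_nhds_zero_of_lt_one (by norm_num : (0 : ℝ) ≤ 1 / 2)
          (by norm_num)).const_mul c⁻¹
      refine squeeze_zero (fun k => (hb k).le) (fun k => ?_) h1
      have h2 : b k * a k = (1 / 2) ^ k := by
        have h3 := hab k
        rw [one_div, inv_pow]
        apply eq_inv_of_mul_eq_one_right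
        linarith
      rw [← h2, inv_mul_eq_div, le_div_iff₀ hc]
      exact mul_le_mul_of_nonneg_left (hac k) (hb k).le
    obtain ⟨k₀, hk₀⟩ := key hb ha hb' ha' (fun k => by rw [mul_comm (b k)]; exact hab k) hlim'
    refine ⟨k₀, fun l hl => ⟨?_, ?_⟩⟩
    · rw [mul_comm (a l), min_comm]
      exact (hk₀ l hl).1
    · filter_upwards [(hk₀ l hl).2] with k hk
      refine ⟨?_, ?_⟩
      · rw [mul_comm (a l), min_comm]; exact hk.2
      · rw [mul_comm (a k), min_comm]; exact hk.1

/-! ### Randomly chosen blocks -/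

/-- The place of a copy of a block of the independent sum: the block of number `m` in which it
lives, the levels `k j` that are used, and a twist `θ` of the binary tree. -/
structure Place where
  m : ℕ
  k : ℕ → ℕ
  θ : Tree

section Place

variable {E : Type*} [NormedAddCommGroup E] [NormedSpace ℝ E]

/-- The basis vector of a node of level `k` in the block `m`, and `0` if the block is too short. -/
noncomputable def basisAt (e : Idx → E) (m : ℕ) {k : ℕ} (K : Fin k → Bool) : E :=
  if h : k ≤ m then e ⟨m, k, h, K⟩ else 0

/-- The coordinate functional of a node of level `k` in the block `m`, and `0` if the block is too
short. -/
noncomputable def coordAt (e : Idx → E) (m : ℕ) {k : ℕ} (K : Fin k → Bool) : E →L[ℝ] ℝ :=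
  if h : k ≤ m then coord e ⟨m, k, h, K⟩ else 0

namespace Place

variable (e : Idx → E) (β : Place)

/-- The vector that takes the place of the basis vector with the level and the node of `q`. -/
noncomputable def vec (q : Idx) : E :=
  ∑ K ∈ fiber β.k q.K, sgn (β.θ (β.k q.j) K) • basisAt e β.m (twistNode β.θ K)

/-- The functional that takes the place of the coordinate functional with the level and the node
of `p`. -/
noncomputable def func (p : Idx) : E →L[ℝ] ℝ :=
  ((2 : ℝ) ^ p.j / 2 ^ β.k p.j) •
    ∑ K ∈ fiber β.k p.K, sgn (β.θ (β.k p.j) K) • coordAt e β.m (twistNode β.θ K)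

/-- The average of the diagonal entries of an operator over the nodes that are selected by the node
of `p`. -/
noncomputable def diagAvg (T : E →L[ℝ] E) (p : Idx) : ℝ :=
  (2 : ℝ) ^ p.j / 2 ^ β.k p.j * ∑ K ∈ fiber β.k p.K,
    coordAt e β.m (twistNode β.θ K) (T (basisAt e β.m (twistNode β.θ K)))

end Place

/-- The average of the diagonal entries of an operator along the level `k` of the block `m`. -/
noncomputable def levelAvg (e : Idx → E) (T : E →L[ℝ] E) (m k : ℕ) : ℝ :=
  (2 ^ k)⁻¹ * ∑ K : Fin k → Bool, coordAt e m K (T (basisAt e m K))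

/-- The matrix entries of an operator between two levels of a block, weighted by the length of the
intervals of the level of the coordinate functional. -/
noncomputable def entry (e : Idx → E) (T : E →L[ℝ] E) (m : ℕ) {k l : ℕ} (K : Fin k → Bool)
    (L : Fin l → Bool) : ℝ :=
  (2 ^ k)⁻¹ * coordAt e m K (T (basisAt e m L))

theorem Place.func_vec (e : Idx → E) (β : Place) (T : E →L[ℝ] E) (p q : Idx) :
    β.func e p (T (β.vec e q)) = 2 ^ p.j * ∑ K ∈ fiber β.k p.K, ∑ L ∈ fiber β.k q.K,
      sgn (β.θ (β.k p.j) K) * sgn (β.θ (β.k q.j) L)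
        * entry e T β.m (twistNode β.θ K) (twistNode β.θ L) := by
  simp only [Place.func, Place.vec, entry, _root_.smul_apply, _root_.sum_apply, map_sum, map_smul,
    smul_eq_mul, Finset.mul_sum]
  rw [Finset.sum_comm]
  refine Finset.sum_congr rfl fun K _ => ?_
  refine Finset.sum_congr rfl fun L _ => ?_
  ring

theorem Place.diagAvg_eq (e : Idx → E) (β : Place) (T : E →L[ℝ] E) (p : Idx) :
    β.diagAvg e T p = 2 ^ p.j * ∑ K ∈ fiber β.k p.K,
      entry e T β.m (twistNode β.θ K) (twistNode β.θ K) := by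
  simp only [Place.diagAvg, entry, Finset.mul_sum]
  refine Finset.sum_congr rfl fun K _ => ?_
  ring

end Place

namespace Model

variable {E : Type*} [NormedAddCommGroup E] [NormedSpace ℝ E] {e : Idx → E} (M : Model e)

/-- The number `2⁻ᵏ / ‖h_I‖`, `I ∈ 𝒟_k`. It bounds the norm of the functional `f ↦ ∫ f h_I`, the
coordinate functional multiplied by the length of `I`. -/
noncomputable def dualSize (k : ℕ) : ℝ := (2 ^ k * M.levelSize k)⁻¹

theorem dualSize_pos (k : ℕ) : 0 < M.dualSize k :=
  inv_pos.2 (mul_pos (by positivity) (M.levelSize_pos k))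

theorem dualSize_antitone : Antitone M.dualSize := by
  refine antitone_nat_of_succ_le fun k => ?_
  apply inv_anti₀ (mul_pos (by positivity) (M.levelSize_pos k))
  rw [pow_succ, mul_assoc]
  exact mul_le_mul_of_nonneg_left (M.levelSize_le_two_mul k) (by positivity)

theorem two_pow_mul_dualSize (k : ℕ) : 2 ^ k * (M.levelSize k * M.dualSize k) = 1 := by
  have := M.levelSize_pos k
  rw [dualSize]
  field_simp

section Entries

variable (hd : DenseRange (Finsupp.linearCombination ℝ e)) (T : E →L[ℝ] E)

include M hd

theorem abs_coordAt_le (m : ℕ) {k l : ℕ} (K : Fin k → Bool) (L : Fin l → Bool) :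
    |coordAt e m K (T (basisAt e m L))| ≤ (M.levelSize k)⁻¹ * (‖T‖ * M.levelSize l) := by
  have hk := M.levelSize_pos k
  have hl := M.levelSize_pos l
  rw [coordAt, basisAt]
  split_ifs with h1 h2
  · rw [← Real.norm_eq_abs]
    refine (ContinuousLinearMap.le_of_opNorm_le _ (M.norm_coord_le hd _) _).trans ?_
    refine mul_le_mul_of_nonneg_left ?_ (inv_nonneg.2 hk.le)
    refine (T.le_opNorm _).trans ?_
    rw [M.norm_basis_eq]
  · rw [map_zero, map_zero, abs_zero]; positivity
  · rw [_root_.zero_apply, abs_zero]; positivity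
  · rw [_root_.zero_apply, abs_zero]; positivity

theorem abs_entry_le (m : ℕ) {k l : ℕ} (K : Fin k → Bool) (L : Fin l → Bool) :
    |entry e T m K L| ≤ ‖T‖ * (M.levelSize l * M.dualSize k) := by
  rw [entry, abs_mul, abs_of_pos (by positivity), dualSize, mul_inv]
  refine (mul_le_mul_of_nonneg_left (M.abs_coordAt_le hd T m K L) (by positivity)).trans
    (le_of_eq ?_)
  ring

theorem abs_coordAt_self_le (m : ℕ) {k : ℕ} (K : Fin k → Bool) :
    |coordAt e m K (T (basisAt e m K))| ≤ ‖T‖ := by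
  refine (M.abs_coordAt_le hd T m K K).trans (le_of_eq ?_)
  have := M.levelSize_pos k
  field_simp

theorem abs_levelAvg_le (m k : ℕ) : |levelAvg e T m k| ≤ ‖T‖ := by
  rw [levelAvg, abs_mul, abs_of_pos (by positivity), inv_mul_le_iff₀ (by positivity)]
  refine (Finset.abs_sum_le_sum_abs _ _).trans ?_
  refine (Finset.sum_le_sum fun K _ => M.abs_coordAt_self_le hd T m K).trans (le_of_eq ?_)
  rw [Finset.sum_const, Finset.card_univ, Fintype.card_fun, Fintype.card_bool, Fintype.card_fin,
    nsmul_eq_mul]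
  push_cast
  rfl

theorem sum_abs_entry_left_le [CompleteSpace E] {m k l : ℕ} (hk : k ≤ m) (hl : l ≤ m)
    (L : Fin l → Bool) :
    ∑ K : Fin k → Bool, |entry e T m K L| ≤ ‖T‖ * M.levelSize l := by
  simp only [entry, coordAt, dif_pos hk, basisAt, dif_pos hl, abs_mul]
  rw [← Finset.mul_sum, abs_of_pos (by positivity), inv_mul_le_iff₀ (by positivity)]
  refine (M.sum_abs_coord_le hd hk _).trans ?_
  refine mul_le_mul_of_nonneg_left ?_ (by positivity)
  refine (T.le_opNorm _).trans ?_
  rw [M.norm_basis_eq]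

theorem sum_abs_entry_right_le {m k l : ℕ} (hk : k ≤ m) (hl : l ≤ m) (K : Fin k → Bool) :
    ∑ L : Fin l → Bool, |entry e T m K L| ≤ ‖T‖ * M.dualSize k := by
  let φ : (Fin l → Bool) → ℝ := fun L => coord e ⟨m, k, hk, K⟩ (T (e ⟨m, l, hl, L⟩))
  let σ : (Fin l → Bool) → ℝ := fun L => if 0 ≤ φ L then 1 else -1
  have hσ : ∀ L, |σ L| = 1 := fun L => by simp only [σ]; split_ifs <;> simp
  have h1 : ∑ L, |φ L| = coord e ⟨m, k, hk, K⟩ (T (∑ L, σ L • e ⟨m, l, hl, L⟩)) := by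
    simp only [map_sum, map_smul, smul_eq_mul]
    refine Finset.sum_congr rfl fun L _ => ?_
    change |φ L| = σ L * φ L
    simp only [σ]
    split_ifs with h
    · rw [abs_of_nonneg h, one_mul]
    · rw [abs_of_neg (not_le.1 h), neg_one_mul]
  have h2 : ∀ L, |entry e T m K L| = (2 ^ k)⁻¹ * |φ L| := fun L => by
    rw [entry, abs_mul, abs_of_pos (by positivity), coordAt, dif_pos hk, basisAt, dif_pos hl]
  simp only [h2]
  rw [← Finset.mul_sum, h1, dualSize, mul_inv, mul_left_comm]
  refine mul_le_mul_of_nonneg_left ?_ (by positivity)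
  refine (le_abs_self _).trans ?_
  rw [← Real.norm_eq_abs, mul_comm]
  refine (ContinuousLinearMap.le_of_opNorm_le _ (M.norm_coord_le hd _) _).trans ?_
  refine mul_le_mul_of_nonneg_left ?_ (inv_nonneg.2 (M.levelSize_nonneg k))
  refine (T.le_opNorm _).trans ?_
  rw [M.norm_sum_signs hl σ hσ, mul_one]

/-- The second moment of the weighted matrix entries between two levels is at most the largest
entry times the sum of the entries, which is computed by rows or by columns. -/
theorem sum_sq_entry_le [CompleteSpace E] {m k l : ℕ} (hk : k ≤ m) (hl : l ≤ m) :
    ∑ K : Fin k → Bool, ∑ L : Fin l → Bool, entry e T m K L ^ 2 ≤ ‖T‖ ^ 2 *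
      (M.levelSize l * M.dualSize k *
        min (2 ^ l * M.levelSize l) (2 ^ k * M.dualSize k)) := by
  have ha := M.levelSize_pos l
  have hb := M.dualSize_pos k
  have hΓ := norm_nonneg T
  have h1 : ∑ K : Fin k → Bool, ∑ L : Fin l → Bool, |entry e T m K L|
      ≤ ‖T‖ * min (2 ^ l * M.levelSize l) (2 ^ k * M.dualSize k) := by
    rw [mul_min_of_nonneg _ _ hΓ]
    apply le_min
    · rw [Finset.sum_comm]
      refine (Finset.sum_le_sum fun L _ => M.sum_abs_entry_left_le hd T hk hl L).trans
        (le_of_eq ?_)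
      rw [Finset.sum_const, Finset.card_univ, Fintype.card_fun, Fintype.card_bool,
        Fintype.card_fin, nsmul_eq_mul]
      push_cast
      ring
    · refine (Finset.sum_le_sum fun K _ => M.sum_abs_entry_right_le hd T hk hl K).trans
        (le_of_eq ?_)
      rw [Finset.sum_const, Finset.card_univ, Fintype.card_fun, Fintype.card_bool,
        Fintype.card_fin, nsmul_eq_mul]
      push_cast
      ring
  have h2 : ∀ (K : Fin k → Bool) (L : Fin l → Bool), entry e T m K L ^ 2
      ≤ ‖T‖ * (M.levelSize l * M.dualSize k) * |entry e T m K L| := by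
    intro K L
    rw [← sq_abs, sq]
    exact mul_le_mul_of_nonneg_right (M.abs_entry_le hd T m K L) (abs_nonneg _)
  refine (Finset.sum_le_sum fun K _ => Finset.sum_le_sum fun L _ => h2 K L).trans ?_
  simp only [← Finset.mul_sum]
  refine (mul_le_mul_of_nonneg_left h1 (by positivity)).trans (le_of_eq ?_)
  ring

/-- For a random twist, the matrix entries between two nodes of the copy are small, apart from the
contribution of the diagonal. -/
theorem sum_sq_func_vec_le [CompleteSpace E] {m n : ℕ} {k : ℕ → ℕ} (hk : StrictMono k)
    (hkm : k n ≤ m) {ε : ℝ} (hε : ∀ i ≤ n, ∀ j ≤ n, M.levelSize (k j) * M.dualSize (k i) *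
      min (2 ^ k j * M.levelSize (k j)) (2 ^ k i * M.dualSize (k i)) ≤ ε)
    {p q : Idx} (hp : p.n = n) (hq : q.n = n) [Decidable (p = q)] :
    ∑ θ : FinTree m, (Place.func e ⟨m, k, θ.toTree⟩ p (T (Place.vec e ⟨m, k, θ.toTree⟩ q))
        - if p = q then Place.diagAvg e ⟨m, k, θ.toTree⟩ T p else 0) ^ 2
      ≤ Fintype.card (FinTree m) * (2 * 4 ^ n * ‖T‖ ^ 2 * ε) := by
  classical
  obtain ⟨n', j, hj, I⟩ := p
  obtain ⟨n'', i, hi, I'⟩ := q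
  obtain rfl : n' = n := hp
  obtain rfl : n'' = n' := hq
  have hjm : k j ≤ m := (hk.monotone hj).trans hkm
  have him : k i ≤ m := (hk.monotone hi).trans hkm
  have hmom := M.sum_sq_entry_le hd T hjm him
  have hmom' := hmom.trans (mul_le_mul_of_nonneg_left (hε j hj i hi) (sq_nonneg _))
  have hc : (0 : ℝ) ≤ Fintype.card (FinTree m) := Nat.cast_nonneg _
  have hε0 : 0 ≤ ‖T‖ ^ 2 * ε := le_trans (Finset.sum_nonneg fun K _ => Finset.sum_nonneg fun L _ =>
    sq_nonneg _) hmom'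
  have h4 : ((2 : ℝ) ^ j) ^ 2 ≤ 4 ^ n'' := by
    rw [← pow_mul, mul_comm, pow_mul]
    norm_num
    exact pow_le_pow_right₀ (by norm_num) hj
  have hfin : ∀ {S : ℝ}, S ≤ Fintype.card (FinTree m) * (2 * (‖T‖ ^ 2 * ε)) →
      ((2 : ℝ) ^ j) ^ 2 * S ≤ Fintype.card (FinTree m) * (2 * 4 ^ n'' * ‖T‖ ^ 2 * ε) := by
    intro S hS
    refine (mul_le_mul_of_nonneg_left hS (by positivity)).trans ?_
    refine (mul_le_mul_of_nonneg_right h4 (by positivity)).trans (le_of_eq ?_)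
    ring
  simp only [Place.func_vec, Place.diagAvg_eq]
  rcases lt_trichotomy i j with hij | rfl | hij
  · have hne : ¬ (⟨n'', j, hj, I⟩ : Idx) = ⟨n'', i, hi, I'⟩ := fun h => by
      simp only [Idx.mk.injEq] at h
      omega
    simp only [if_neg hne, sub_zero, mul_pow]
    rw [← Finset.mul_sum]
    refine hfin ((FinTree.sum_sq_pair_le hjm (hk hij) _ _ fun K L => entry e T m K L).trans ?_)
    exact mul_le_mul_of_nonneg_left (by linarith) hc
  · have h1 : ∀ θ : FinTree m, (2 ^ i * ∑ K ∈ fiber k I, ∑ L ∈ fiber k I',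
        sgn (θ.toTree (k i) K) * sgn (θ.toTree (k i) L)
          * entry e T m (twistNode θ.toTree K) (twistNode θ.toTree L)
        - if (⟨n'', i, hj, I⟩ : Idx) = ⟨n'', i, hi, I'⟩ then 2 ^ i * ∑ K ∈ fiber k I,
          entry e T m (twistNode θ.toTree K) (twistNode θ.toTree K) else 0)
        = 2 ^ i * ∑ p ∈ (fiber k I ×ˢ fiber k I').filter fun p => p.1 ≠ p.2,
          sgn (θ.toTree (k i) p.1) * sgn (θ.toTree (k i) p.2)
            * entry e T m (twistNode θ.toTree p.1) (twistNode θ.toTree p.2) := by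
      intro θ
      rw [sub_eq_iff_eq_add, ← Finset.sum_product', ← Finset.sum_filter_not_add_sum_filter
        (fiber k I ×ˢ fiber k I') fun p => p.1 = p.2, mul_add]
      congr 1
      split_ifs with h
      · obtain rfl : I = I' := by simpa using h
        congr 1
        refine Finset.sum_nbij' Prod.fst (fun K => (K, K)) ?_ ?_ ?_ ?_ ?_
        · rintro ⟨K, L⟩ h
          simp only [Finset.mem_filter, Finset.mem_product] at h
          exact h.1.1
        · intro K hK
          simp [hK]
        · rintro ⟨K, L⟩ h
          simp only [Finset.mem_filter] at h
          simp [h.2]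
        · intro K _; rfl
        · rintro ⟨K, L⟩ h
          simp only [Finset.mem_filter] at h
          obtain rfl := h.2
          rw [sgn_mul_self, one_mul]
      · rw [Finset.sum_eq_zero, mul_zero]
        rintro ⟨K, L⟩ hKL
        simp only [Finset.mem_filter, Finset.mem_product, mem_fiber] at hKL
        obtain ⟨⟨rfl, rfl⟩, rfl⟩ := hKL
        exact absurd rfl h
    simp only [h1, mul_pow]
    rw [← Finset.mul_sum]
    refine hfin ((FinTree.sum_sq_offDiag_le hjm _ _ fun K L => entry e T m K L).trans ?_)
    exact mul_le_mul_of_nonneg_left (by linarith) hc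
  · have hne : ¬ (⟨n'', j, hj, I⟩ : Idx) = ⟨n'', i, hi, I'⟩ := fun h => by
      simp only [Idx.mk.injEq] at h
      omega
    simp only [if_neg hne, sub_zero, mul_pow]
    rw [← Finset.mul_sum]
    apply hfin
    have h1 := FinTree.sum_sq_pair_le him (hk hij) (fiber k I') (fiber k I)
      fun L K => entry e T m K L
    rw [Finset.sum_comm (f := fun L K => entry e T m K L ^ 2)] at h1
    refine le_trans (le_of_eq ?_) (h1.trans (mul_le_mul_of_nonneg_left ?_ hc))
    · refine Finset.sum_congr rfl fun θ _ => ?_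
      rw [Finset.sum_comm]
      congr 1
      refine Finset.sum_congr rfl fun L _ => Finset.sum_congr rfl fun K _ => ?_
      ring
    · linarith

/-- If the levels are chosen well, then some twist turns a block of the operator into almost a
multiple of the identity. -/
theorem exists_tree [CompleteSpace E] {m n : ℕ} {k : ℕ → ℕ} (hk : StrictMono k)
    (hkm : k n ≤ m) {ε η d : ℝ} (hε : ∀ i ≤ n, ∀ j ≤ n, M.levelSize (k j) * M.dualSize (k i) *
      min (2 ^ k j * M.levelSize (k j)) (2 ^ k i * M.dualSize (k i)) ≤ ε)
    (hsum : ∀ j ≤ n, ∑ i ∈ Finset.range j, (4 : ℝ) ^ i / 2 ^ k i ≤ ε)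
    (hη : 0 ≤ η) (hεη : ((blockIdx n).card : ℝ) ^ 2 * ((2 * 4 ^ n + n) * ‖T‖ ^ 2 * ε) ≤ η ^ 2)
    (hdiag : ∀ j ≤ n, |levelAvg e T m (k j) - d| ≤ η) :
    ∃ θ : Tree, ∀ p ∈ blockIdx n, ∀ q ∈ blockIdx n, ∀ _ : Decidable (p = q),
      |Place.func e ⟨m, k, θ⟩ p (T (Place.vec e ⟨m, k, θ⟩ q)) - if p = q then d else 0|
        ≤ 3 * η := by
  classical
  let X : FinTree m → Idx × Idx → ℝ := fun θ z =>
    Place.func e ⟨m, k, θ.toTree⟩ z.1 (T (Place.vec e ⟨m, k, θ.toTree⟩ z.2))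
      - if z.1 = z.2 then Place.diagAvg e ⟨m, k, θ.toTree⟩ T z.1 else 0
  let Y : FinTree m → Idx × Idx → ℝ := fun θ z =>
    Place.diagAvg e ⟨m, k, θ.toTree⟩ T z.1 - levelAvg e T m (k z.1.j)
  let s := blockIdx n ×ˢ blockIdx n
  have hX : ∀ z ∈ s, ∑ θ, X θ z ^ 2 ≤ Fintype.card (FinTree m) * (2 * 4 ^ n * ‖T‖ ^ 2 * ε) := by
    intro z hz
    rw [Finset.mem_product, mem_blockIdx, mem_blockIdx] at hz
    exact M.sum_sq_func_vec_le hd T hk hkm hε hz.1 hz.2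
  have hY : ∀ z ∈ s, ∑ θ, Y θ z ^ 2 ≤ Fintype.card (FinTree m) * (n * ‖T‖ ^ 2 * ε) := by
    intro z hz
    rw [Finset.mem_product, mem_blockIdx] at hz
    have hj : z.1.j ≤ n := hz.1 ▸ z.1.le
    have h1 := FinTree.sum_sq_average_le hk ((hk.monotone hj).trans hkm) z.1.K
      (fun K => coordAt e m K (T (basisAt e m K))) fun K => M.abs_coordAt_self_le hd T m K
    refine h1.trans (mul_le_mul_of_nonneg_left ?_ (Nat.cast_nonneg _))
    have h2 : (z.1.j : ℝ) ≤ n := by exact_mod_cast hj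
    have h3 : 0 ≤ ∑ i ∈ Finset.range z.1.j, (4 : ℝ) ^ i / 2 ^ k i :=
      Finset.sum_nonneg fun i _ => by positivity
    rw [mul_right_comm _ _ ε]
    refine mul_le_mul_of_nonneg_right ?_ (sq_nonneg _)
    exact mul_le_mul h2 (hsum _ hj) h3 (Nat.cast_nonneg _)
  obtain ⟨θ, -, hθ⟩ : ∃ θ ∈ (Finset.univ : Finset (FinTree m)),
      ∑ z ∈ s, (X θ z ^ 2 + Y θ z ^ 2) ≤ η ^ 2 := by
    apply Finset.exists_le_of_sum_le Finset.univ_nonempty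
    rw [Finset.sum_comm, Finset.sum_const, Finset.card_univ, nsmul_eq_mul]
    refine le_trans ?_ (mul_le_mul_of_nonneg_left hεη (Nat.cast_nonneg _))
    have h1 : ∀ z ∈ s, ∑ θ, (X θ z ^ 2 + Y θ z ^ 2)
        ≤ Fintype.card (FinTree m) * ((2 * 4 ^ n + n) * ‖T‖ ^ 2 * ε) := by
      intro z hz
      rw [Finset.sum_add_distrib]
      refine (add_le_add (hX z hz) (hY z hz)).trans (le_of_eq ?_)
      ring
    refine (Finset.sum_le_sum h1).trans (le_of_eq ?_)
    rw [Finset.sum_const, Finset.card_product, nsmul_eq_mul]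
    push_cast
    ring
  refine ⟨θ.toTree, fun p hp q hq dec => ?_⟩
  have hz : (p, q) ∈ s := Finset.mem_product.2 ⟨hp, hq⟩
  have h1 := (Finset.single_le_sum (f := fun z => X θ z ^ 2 + Y θ z ^ 2)
    (fun z _ => add_nonneg (sq_nonneg _) (sq_nonneg _)) hz).trans hθ
  have hX1 : |X θ (p, q)| ≤ η := abs_le_of_sq_le_sq (by linarith [sq_nonneg (Y θ (p, q))]) hη
  have hY1 : |Y θ (p, q)| ≤ η := abs_le_of_sq_le_sq (by linarith [sq_nonneg (X θ (p, q))]) hη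
  have hD := hdiag p.j (mem_blockIdx.1 hp ▸ p.le)
  simp only [X, Y] at hX1 hY1
  rw [abs_le] at hX1 hY1 hD ⊢
  by_cases hpq : p = q
  · simp only [if_pos hpq] at hX1 ⊢
    constructor <;> linarith [hX1.1, hX1.2, hY1.1, hY1.2, hD.1, hD.2]
  · simp only [if_neg hpq] at hX1 ⊢
    constructor <;> linarith [hX1.1, hX1.2]

end Entries

end Model

/-! ### The choice of the copy -/

/-- A sequence in a compact interval converges along a nonprincipal ultrafilter. -/
theorem exists_tendsto_hyperfilter {f : ℕ → ℝ} {C : ℝ} (hf : ∀ n, |f n| ≤ C) :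
    ∃ x, Tendsto f (hyperfilter ℕ) (𝓝 x) := by
  obtain ⟨x, -, hx⟩ := (isCompact_Icc (a := -C) (b := C)).ultrafilter_le_nhds
    ((hyperfilter ℕ).map f) (by
      rw [Ultrafilter.coe_map, le_principal_iff, mem_map]
      exact Eventually.of_forall fun n => abs_le.1 (hf n))
  exact ⟨x, hx⟩

namespace Model

variable {E : Type*} [NormedAddCommGroup E] [NormedSpace ℝ E] {e : Idx → E} (M : Model e)

/-- The choice of the levels: along them the diagonal averages are close to `d`, the second moments
of the matrix entries are small, and the levels increase fast. -/
theorem exists_levels {D : ℕ → ℝ} {d ε : ℝ} (hD : Tendsto D (hyperfilter ℕ) (𝓝 d)) (hε : 0 < ε) :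
    ∃ k : ℕ → ℕ, StrictMono k ∧ (∀ i, |D (k i) - d| ≤ ε) ∧
      (∀ i j, M.levelSize (k j) * M.dualSize (k i) *
        min (2 ^ k j * M.levelSize (k j)) (2 ^ k i * M.dualSize (k i)) ≤ ε) ∧
      ∀ j, ∑ i ∈ Finset.range j, (4 : ℝ) ^ i / 2 ^ k i ≤ ε := by
  set a := M.levelSize
  set b := M.dualSize
  obtain ⟨k₀, hk₀⟩ := exists_level_bound M.levelSize_pos M.dualSize_pos M.levelSize_antitone
    M.dualSize_antitone M.two_pow_mul_dualSize hε
  have hfreq : ∃ᶠ x in atTop, |D x - d| ≤ ε := by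
    have h1 : ∀ᶠ x in (hyperfilter ℕ : Filter ℕ), |D x - d| ≤ ε := by
      filter_upwards [hD.eventually (Metric.closedBall_mem_nhds d hε)] with x hx
      exact hx
    exact h1.frequently.filter_mono Nat.hyperfilter_le_atTop
  have hhalf : ∀ᶠ x : ℕ in atTop, 2 * (1 / 2 : ℝ) ^ x ≤ ε := by
    have h1 : Tendsto (fun x : ℕ => 2 * (1 / 2 : ℝ) ^ x) atTop (𝓝 0) := by
      simpa using (tendsto_pow_atTop_nhds_zero_of_lt_one (by norm_num : (0 : ℝ) ≤ 1 / 2)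
        (by norm_num)).const_mul 2
    exact h1.eventually (eventually_le_nhds hε)
  obtain ⟨k, hk1, hk2⟩ := exists_seq_of_forall_finset_exists
    (fun x => (k₀ ≤ x ∧ 2 * (1 / 2 : ℝ) ^ x ≤ ε) ∧ |D x - d| ≤ ε)
    (fun x y => x + 3 ≤ y ∧ a x * b y * min (2 ^ x * a x) (2 ^ y * b y) ≤ ε ∧
      a y * b x * min (2 ^ y * a y) (2 ^ x * b x) ≤ ε) (by
      intro s hs
      have h1 : ∀ᶠ y in atTop, ∀ x ∈ s, x + 3 ≤ y ∧
          a x * b y * min (2 ^ x * a x) (2 ^ y * b y) ≤ ε ∧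
          a y * b x * min (2 ^ y * a y) (2 ^ x * b x) ≤ ε := by
        rw [Filter.eventually_all_finset]
        exact fun x hx => (eventually_ge_atTop (x + 3)).and (hk₀ x (hs x hx).1.1).2
      obtain ⟨y, hy1, ⟨hy2, hy3⟩, hy4⟩ :=
        (hfreq.and_eventually (((eventually_ge_atTop k₀).and hhalf).and h1)).exists
      exact ⟨y, ⟨⟨hy2, hy3⟩, hy1⟩, hy4⟩)
  have hmono : StrictMono k := strictMono_nat_of_lt_succ fun n => by
    have := (hk2 n (n + 1) n.lt_succ_self).1
    omega
  refine ⟨k, hmono, fun i => (hk1 i).2, fun i j => ?_, fun j => ?_⟩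
  · rcases lt_trichotomy i j with h | rfl | h
    · exact (hk2 i j h).2.2
    · exact (hk₀ _ (hk1 i).1.1).1
    · exact (hk2 j i h).2.1
  · have h3 : ∀ i, k 0 + 3 * i ≤ k i := by
      intro i
      induction i with
      | zero => simp
      | succ i ih =>
        have := (hk2 i (i + 1) i.lt_succ_self).1
        omega
    have h4 : ∀ i, (4 : ℝ) ^ i / 2 ^ k i ≤ (1 / 2) ^ k 0 * (1 / 2) ^ i := by
      intro i
      have h5 : (2 : ℝ) ^ (k 0 + 3 * i) ≤ 2 ^ k i := pow_le_pow_right₀ (by norm_num) (h3 i)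
      rw [div_le_iff₀ (by positivity)]
      refine le_trans (le_of_eq ?_) (mul_le_mul_of_nonneg_left h5 (by positivity))
      rw [pow_add, pow_mul]
      have h6 : (2 : ℝ) ^ 3 = 4 * 2 := by norm_num
      rw [h6, mul_pow, one_div, inv_pow, inv_pow]
      field_simp
    refine (Finset.sum_le_sum fun i _ => h4 i).trans ?_
    rw [← Finset.mul_sum]
    refine (mul_le_mul_of_nonneg_left (sum_geometric_two_le j) (by positivity)).trans ?_
    rw [mul_comm]
    exact (hk1 0).1.2

section Choice

variable (hd : DenseRange (Finsupp.linearCombination ℝ e)) [CompleteSpace E]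
  (hw : ∀ (j : ℕ) (φ : E →L[ℝ] ℝ), Tendsto (fun m => φ (∑ K : Fin j → Bool,
    e ⟨j + m, j, Nat.le_add_right j m, K⟩)) atTop (𝓝 0))

include M hd hw in
theorem eventually_sum_abs_le (φ : E →L[ℝ] ℝ) (k : ℕ) {η : ℝ} (hη : 0 < η) :
    ∀ᶠ m in atTop, ∑ K : Fin k → Bool, |φ (basisAt e m K)| ≤ η := by
  have h1 := M.tendsto_sum_abs hd (hw k) φ
  have h2 : Tendsto (fun m => ∑ K : Fin k → Bool, |φ (basisAt e m K)|) atTop (𝓝 0) := by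
    rw [← tendsto_add_atTop_iff_nat k]
    refine h1.congr fun m => Finset.sum_congr rfl fun K _ => ?_
    rw [basisAt, dif_pos (Nat.le_add_left k m)]
    congr 4
    exact Nat.add_comm k m
  exact h2.eventually (eventually_le_nhds hη)

include M hd in
theorem eventually_sum_abs_coordAt_le (y : E) (k : ℕ) {η : ℝ} (hη : 0 < η) :
    ∀ᶠ m in atTop, ∑ K : Fin k → Bool, |coordAt e m K y| ≤ η := by
  have h1 := M.tendsto_sum_abs_coord hd k y
  have h2 : Tendsto (fun m => ∑ K : Fin k → Bool, |coordAt e m K y|) atTop (𝓝 0) := by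
    rw [← tendsto_add_atTop_iff_nat k]
    refine h1.congr fun m => Finset.sum_congr rfl fun K _ => ?_
    rw [coordAt, dif_pos (Nat.le_add_left k m)]
    congr 4
    exact Nat.add_comm k m
  exact h2.eventually (eventually_le_nhds hη)

end Choice

end Model

section Place

variable {E : Type*} [NormedAddCommGroup E] [NormedSpace ℝ E]

theorem Place.abs_apply_vec_le (e : Idx → E) (β : Place) (φ : E →L[ℝ] ℝ) (q : Idx) :
    |φ (β.vec e q)| ≤ ∑ K : Fin (β.k q.j) → Bool, |φ (basisAt e β.m K)| := by
  rw [Place.vec, map_sum, ← (twistNode_bijective β.θ (β.k q.j)).sum_comp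
    fun K => |φ (basisAt e β.m K)|]
  refine (Finset.abs_sum_le_sum_abs _ _).trans ?_
  refine (Finset.sum_le_univ_sum_of_nonneg fun _ => abs_nonneg _).trans (le_of_eq ?_)
  refine Finset.sum_congr rfl fun K _ => ?_
  rw [map_smul, smul_eq_mul, abs_mul, abs_sgn, one_mul]

theorem Place.abs_func_le (e : Idx → E) (β : Place) (hk : StrictMono β.k) (y : E) (p : Idx) :
    |β.func e p y| ≤ ∑ K : Fin (β.k p.j) → Bool, |coordAt e β.m K y| := by
  rw [Place.func, _root_.smul_apply, smul_eq_mul, abs_mul, _root_.sum_apply,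
    ← (twistNode_bijective β.θ (β.k p.j)).sum_comp fun K => |coordAt e β.m K y|]
  have h1 : |(2 : ℝ) ^ p.j / 2 ^ β.k p.j| ≤ 1 := by
    rw [abs_of_pos (by positivity)]
    exact div_le_one_of_le₀ (pow_le_pow_right₀ (by norm_num) (hk.id_le _)) (by positivity)
  refine (mul_le_of_le_one_left (abs_nonneg _) h1).trans ?_
  refine (Finset.abs_sum_le_sum_abs _ _).trans ?_
  refine (Finset.sum_le_univ_sum_of_nonneg fun _ => abs_nonneg _).trans (le_of_eq ?_)
  refine Finset.sum_congr rfl fun K _ => ?_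
  rw [_root_.smul_apply, smul_eq_mul, abs_mul, abs_sgn, one_mul]

end Place

namespace Model

variable {E : Type*} [NormedAddCommGroup E] [NormedSpace ℝ E] {e : Idx → E} (M : Model e)
  (hd : DenseRange (Finsupp.linearCombination ℝ e)) [CompleteSpace E]
  (hw : ∀ (j : ℕ) (φ : E →L[ℝ] ℝ), Tendsto (fun m => φ (∑ K : Fin j → Bool,
    e ⟨j + m, j, Nat.le_add_right j m, K⟩)) atTop (𝓝 0))
  (T : E →L[ℝ] E) {D : ℕ → ℝ} {d : ℝ}
  (hD : ∀ k, Tendsto (fun m => levelAvg e T m k) (hyperfilter ℕ) (𝓝 (D k)))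
  (hDd : Tendsto D (hyperfilter ℕ) (𝓝 d))

include M hd hw hD hDd

/-- The choice of a copy of one block: the operator is almost a multiple of the identity on it, and
it almost does not interact with finitely many given functionals and vectors. -/
theorem exists_place (n m₀ : ℕ) {η : ℝ} (hη : 0 < η) (F : Finset (E →L[ℝ] ℝ)) (V : Finset E) :
    ∃ β : Place, StrictMono β.k ∧ β.k n ≤ β.m ∧ m₀ ≤ β.m ∧
      (∀ p ∈ blockIdx n, ∀ q ∈ blockIdx n, ∀ _ : Decidable (p = q),
        |β.func e p (T (β.vec e q)) - if p = q then d else 0| ≤ η) ∧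
      (∀ φ ∈ F, ∀ q : Idx, q.j ≤ n → |φ (β.vec e q)| ≤ η) ∧
      ∀ y ∈ V, ∀ p : Idx, p.j ≤ n → |β.func e p y| ≤ η := by
  have hη3 : 0 < η / 3 := by positivity
  -- The tolerance for the second moments and for the diagonal averages.
  obtain ⟨ε, hε, hε1, hε2⟩ : ∃ ε > 0, ε ≤ η / 6 ∧
      ((blockIdx n).card : ℝ) ^ 2 * ((2 * 4 ^ n + n) * ‖T‖ ^ 2 * ε) ≤ (η / 3) ^ 2 := by
    have h1 : Tendsto (fun ε : ℝ => ((blockIdx n).card : ℝ) ^ 2 *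
        ((2 * 4 ^ n + n) * ‖T‖ ^ 2 * ε)) (𝓝[>] 0) (𝓝 0) := by
      refine Tendsto.mono_left ?_ nhdsWithin_le_nhds
      have : Continuous fun ε : ℝ => ((blockIdx n).card : ℝ) ^ 2 *
        ((2 * 4 ^ n + n) * ‖T‖ ^ 2 * ε) := by fun_prop
      simpa using this.tendsto 0
    have h2 : Tendsto (fun ε : ℝ => ε) (𝓝[>] 0) (𝓝 0) := tendsto_id.mono_left nhdsWithin_le_nhds
    obtain ⟨ε, h3, h4, h5⟩ := (eventually_mem_nhdsWithin.and
      ((h2.eventually (eventually_le_nhds (by positivity : 0 < η / 6))).and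
      (h1.eventually (eventually_le_nhds (by positivity : 0 < (η / 3) ^ 2))))).exists
    exact ⟨ε, h3, h4, h5⟩
  -- The levels `k` are chosen first, then the number `m` of the block, and the twist at the end.
  obtain ⟨k, hk, hkD, hkR, hksum⟩ := M.exists_levels hDd hε
  have hev : ∀ᶠ m in (hyperfilter ℕ : Filter ℕ), (k n ≤ m ∧ m₀ ≤ m) ∧
      ∀ j ∈ Finset.range (n + 1), |levelAvg e T m (k j) - D (k j)| ≤ η / 6 ∧
        (∀ φ ∈ F, ∑ K : Fin (k j) → Bool, |φ (basisAt e m K)| ≤ η) ∧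
        ∀ y ∈ V, ∑ K : Fin (k j) → Bool, |coordAt e m K y| ≤ η := by
    have hat : ∀ {P : ℕ → Prop}, (∀ᶠ m in atTop, P m) → ∀ᶠ m in (hyperfilter ℕ : Filter ℕ), P m :=
      fun h => h.filter_mono Nat.hyperfilter_le_atTop
    refine ((hat (eventually_ge_atTop (k n))).and (hat (eventually_ge_atTop m₀))).and ?_
    rw [Filter.eventually_all_finset]
    intro j _
    refine Eventually.and ?_ (Eventually.and (hat ?_) (hat ?_))
    · filter_upwards [(hD (k j)).eventually
        (Metric.closedBall_mem_nhds (D (k j)) (by positivity : 0 < η / 6))] with m hm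
      exact hm
    · rw [Filter.eventually_all_finset]
      exact fun φ _ => M.eventually_sum_abs_le hd hw φ (k j) hη
    · rw [Filter.eventually_all_finset]
      exact fun y _ => M.eventually_sum_abs_coordAt_le hd y (k j) hη
  obtain ⟨m, ⟨hkm, hm₀⟩, hm⟩ := hev.exists
  have hm' : ∀ j ≤ n, _ := fun j hj => hm j (Finset.mem_range.2 (Nat.lt_succ_of_le hj))
  obtain ⟨θ, hθ⟩ := M.exists_tree hd T hk hkm (η := η / 3) (d := d) (fun i _ j _ => hkR i j)
    (fun j _ => hksum j) hη3.le hε2 fun j hj => by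
      have h1 := (hm' j hj).1
      have h2 := hkD j
      rw [abs_le] at h1 h2 ⊢
      constructor <;> linarith [h1.1, h1.2, h2.1, h2.2]
  refine ⟨⟨m, k, θ⟩, hk, hkm, hm₀, fun p hp q hq dec => ?_, fun φ hφ q hq => ?_,
    fun y hy p hp => ?_⟩
  · have := hθ p hp q hq dec
    rwa [mul_div_cancel₀ _ (three_ne_zero)] at this
  · exact (Place.abs_apply_vec_le e _ φ q).trans ((hm' q.j hq).2.1 φ hφ)
  · exact (Place.abs_func_le e _ hk y p).trans ((hm' p.j hp).2.2 y hy)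

/-- The choice of a copy of the whole independent sum on which the operator is almost a multiple of
the identity, in the sense of matrix entries. -/
theorem exists_places {η : ℕ → ℝ} (hη : ∀ n, 0 < η n) (hη' : Antitone η) :
    ∃ β : ℕ → Place, StrictMono (fun n => (β n).m) ∧ (∀ n, StrictMono (β n).k) ∧
      (∀ n, (β n).k n ≤ (β n).m) ∧ ∀ p q : Idx, ∀ _ : Decidable (p = q),
        |(β p.n).func e p (T ((β q.n).vec e q)) - if p = q then d else 0| ≤ η (max p.n q.n) := by
  classical
  -- A longer block than needed is chosen in each step; its short initial part is used.
  obtain ⟨f, hf1, hf2⟩ := exists_seq_of_forall_finset_exists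
    (fun x : ℕ × Place => StrictMono x.2.k ∧ x.2.k x.1 ≤ x.2.m ∧
      ∀ p ∈ blockIdx x.1, ∀ q ∈ blockIdx x.1, ∀ _ : Decidable (p = q),
        |x.2.func e p (T (x.2.vec e q)) - if p = q then d else 0| ≤ η x.1)
    (fun x y => x.1 < y.1 ∧ x.2.m < y.2.m ∧ ∀ p q : Idx, p.j ≤ x.1 → q.j ≤ y.1 →
      |x.2.func e p (T (y.2.vec e q))| ≤ η y.1 ∧ |y.2.func e q (T (x.2.vec e p))| ≤ η y.1) (by
      intro s _
      let n := s.sup Prod.fst + 1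
      let m₀ := (s.sup fun x => x.2.m) + 1
      let F := s.biUnion fun x => (blockIdx x.1).image fun p => (x.2.func e p).comp T
      let V := s.biUnion fun x => (blockIdx x.1).image fun p => T (x.2.vec e p)
      obtain ⟨β, h1, h2, h3, h4, h5, h6⟩ := M.exists_place hd hw T hD hDd n m₀ (hη n) F V
      refine ⟨(n, β), ⟨h1, h2, h4⟩, fun x hx => ⟨?_, ?_, fun p q hp hq => ⟨?_, ?_⟩⟩⟩
      · exact Nat.lt_succ_of_le (Finset.le_sup (f := Prod.fst) hx)
      · exact (Nat.lt_succ_of_le (Finset.le_sup (f := fun x : ℕ × Place => x.2.m) hx)).trans_le h3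
      · exact h5 ((x.2.func e ⟨x.1, p.j, hp, p.K⟩).comp T) (Finset.mem_biUnion.2 ⟨x, hx,
          Finset.mem_image.2 ⟨_, mem_blockIdx.2 rfl, rfl⟩⟩) q hq
      · exact h6 (T (x.2.vec e ⟨x.1, p.j, hp, p.K⟩)) (Finset.mem_biUnion.2 ⟨x, hx,
          Finset.mem_image.2 ⟨_, mem_blockIdx.2 rfl, rfl⟩⟩) q hq)
  have hdim : ∀ n, n ≤ (f n).1 := by
    have : StrictMono fun n => (f n).1 := fun a b hab => (hf2 a b hab).1
    exact this.id_le
  refine ⟨fun n => (f n).2, fun a b hab => (hf2 a b hab).2.1, fun n => (hf1 n).1,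
    fun n => ((hf1 n).1.monotone (hdim n)).trans (hf1 n).2.1, fun p q dec => ?_⟩
  have hpj : p.j ≤ (f p.n).1 := p.le.trans (hdim _)
  have hqj : q.j ≤ (f q.n).1 := q.le.trans (hdim _)
  rcases lt_trichotomy p.n q.n with h | h | h
  · rw [if_neg fun hpq => h.ne (congrArg Idx.n hpq), sub_zero, max_eq_right h.le]
    exact ((hf2 _ _ h).2.2 p q hpj hqj).1.trans (hη' (hdim _))
  · obtain ⟨n, j, hj, I⟩ := p
    obtain ⟨n', i, hi, I'⟩ := q
    obtain rfl : n = n' := h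
    have h1 := (hf1 n).2.2 ⟨(f n).1, j, hpj, I⟩ (mem_blockIdx.2 rfl) ⟨(f n).1, i, hqj, I'⟩
      (mem_blockIdx.2 rfl) (Classical.dec _)
    have h2 : ((⟨(f n).1, j, hpj, I⟩ : Idx) = ⟨(f n).1, i, hqj, I'⟩)
        ↔ (⟨n, j, hj, I⟩ : Idx) = ⟨n, i, hi, I'⟩ := by
      simp only [Idx.mk.injEq, true_and]
    simp only [h2] at h1
    rw [max_self]
    exact h1.trans (hη' (hdim n))
  · rw [if_neg fun hpq => h.ne' (congrArg Idx.n hpq), sub_zero, max_eq_left h.le]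
    exact ((hf2 _ _ h).2.2 q p hqj hpj).2.trans (hη' (hdim _))

end Model

/-! ### The operators onto and from the copy -/

theorem twistIdx_bijective (θ : ℕ → Tree) : Function.Bijective (twistIdx θ) := by
  constructor
  · rintro ⟨n, j, hj, K⟩ ⟨n', j', hj', K'⟩ h
    simp only [twistIdx, Idx.mk.injEq] at h
    obtain ⟨rfl, rfl, h⟩ := h
    rw [twistNode_injective _ _ (eq_of_heq h)]
  · rintro ⟨n, j, hj, K⟩
    obtain ⟨K', rfl⟩ := (twistNode_bijective (θ n) j).2 K
    exact ⟨⟨n, j, hj, K'⟩, rfl⟩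

namespace Model

variable {E : Type*} [NormedAddCommGroup E] [NormedSpace ℝ E] {e : Idx → E} (M : Model e)
  (hd : DenseRange (Finsupp.linearCombination ℝ e)) [CompleteSpace E]

include M hd

/-- The inverse of a twist. -/
theorem exists_untwist (θ : ℕ → Tree) : ∃ S : E →L[ℝ] E,
    (∀ q, S (e (twistIdx θ q)) = twistSign θ q • e q) ∧ ‖S‖ ≤ 1 := by
  let σ := (Equiv.ofBijective _ (twistIdx_bijective θ)).symm
  have hσ : ∀ q, σ (twistIdx θ q) = q :=
    (Equiv.ofBijective _ (twistIdx_bijective θ)).symm_apply_apply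
  have hσ' : ∀ q, twistIdx θ (σ q) = q :=
    (Equiv.ofBijective _ (twistIdx_bijective θ)).apply_symm_apply
  obtain ⟨S, hS, hS1⟩ := exists_clm hd (fun q => twistSign θ (σ q) • e (σ q)) zero_le_one
    fun a => by
      let b : Idx →₀ ℝ := Finsupp.linearCombination ℝ
        (fun q => Finsupp.single (σ q) (twistSign θ (σ q))) a
      have h1 := M.norm_twist θ b
      have h2 : Finsupp.linearCombination ℝ (fun q => twistSign θ q • e (twistIdx θ q)) b
          = Finsupp.linearCombination ℝ e a := by
        simp only [b, Finsupp.linearCombination_apply ℝ a, Finsupp.sum, map_sum, map_smul,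
          Finsupp.linearCombination_single, smul_smul, hσ']
        refine Finset.sum_congr rfl fun q _ => ?_
        rw [twistSign, sgn_mul_self, mul_one]
      have h3 : Finsupp.linearCombination ℝ e b
          = Finsupp.linearCombination ℝ (fun q => twistSign θ (σ q) • e (σ q)) a := by
        simp only [b, Finsupp.linearCombination_apply ℝ a, Finsupp.sum, map_sum, map_smul,
          Finsupp.linearCombination_single]
      rw [← h3, ← h1, h2, one_mul]
  refine ⟨S, fun q => ?_, hS1⟩
  rw [hS, hσ]

/-- The contractions between the space and the copy given by a sequence of places: `B` selects the
levels and twists the tree, `A` undoes the twist and averages. -/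
theorem exists_operators (β : ℕ → Place) (hm : Function.Injective fun n => (β n).m)
    (hk : ∀ n, StrictMono (β n).k) (hle : ∀ n, (β n).k n ≤ (β n).m) :
    ∃ A B : E →L[ℝ] E, ‖A‖ ≤ 1 ∧ ‖B‖ ≤ 1 ∧ A.comp B = ContinuousLinearMap.id ℝ E ∧
      (∀ q, B (e q) = (β q.n).vec e q) ∧ ∀ p, (coord e p).comp A = (β p.n).func e p := by
  classical
  let D : Selection :=
    { S := Set.univ
      m := fun n => (β n).m
      k := fun n => (β n).k
      m_inj := hm
      k_mono := hk
      le := fun n _ => hle n }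
  have hmem : ∀ n, n ∈ D.S := Set.mem_univ
  let θ : ℕ → Tree := Function.extend D.m (fun n => (β n).θ) fun _ _ _ => false
  have hθ : ∀ n, θ (β n).m = (β n).θ := fun n => D.m_inj.extend_apply _ _ n
  obtain ⟨S, hS, hS1⟩ := M.exists_twist hd θ
  obtain ⟨S', hS', hS'1⟩ := M.exists_untwist hd θ
  obtain ⟨A₀, hA₀, hA₀1⟩ := exists_clm hd
    (fun q => Finsupp.linearCombination ℝ e (D.avgCoeff q)) zero_le_one
    fun a => by rw [one_mul]; exact M.norm_avg_le D a
  obtain ⟨B₀, hB₀, hB₀1⟩ := exists_clm hd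
    (fun q => ∑ K ∈ fiber (D.k q.n) q.K, e (D.idx (hmem q.n) q.le K)) zero_le_one
    fun a => by rw [one_mul]; exact (M.norm_select D hmem a).le
  have hcomp : ∀ {P Q : E →L[ℝ] E}, ‖P‖ ≤ 1 → ‖Q‖ ≤ 1 → ‖P.comp Q‖ ≤ 1 := fun hP hQ =>
    (ContinuousLinearMap.opNorm_comp_le _ _).trans (mul_le_one₀ hP (norm_nonneg _) hQ)
  have hS'S : ∀ q, S' (S (e q)) = e q := fun q => by
    rw [hS, map_smul, hS', smul_smul, twistSign, sgn_mul_self, one_smul]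
  refine ⟨A₀.comp S', S.comp B₀, hcomp hA₀1 hS'1, hcomp hS1 hB₀1, ?_, fun q => ?_, fun p => ?_⟩
  · refine clm_ext hd fun q => ?_
    simp only [ContinuousLinearMap.comp_apply, hB₀, map_sum, hS'S, hA₀,
      ContinuousLinearMap.id_apply]
    have h1 : ∀ K ∈ fiber (D.k q.n) q.K, Finsupp.linearCombination ℝ e
        (D.avgCoeff (D.idx (hmem q.n) q.le K))
        = ((2 : ℝ) ^ q.j / 2 ^ D.k q.n q.j) • e q := by
      intro K hK
      rw [D.avgCoeff_idx, mem_fiber.1 hK, map_smul, Finsupp.linearCombination_single, one_smul]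
    rw [Finset.sum_congr rfl h1, Finset.sum_const, ← Nat.cast_smul_eq_nsmul ℝ, smul_smul]
    have h2 : ((fiber (D.k q.n) q.K).card : ℝ) * 2 ^ q.j = 2 ^ D.k q.n q.j := by
      exact_mod_cast card_fiber (D.k_mono q.n) q.K
    rw [← mul_div_assoc, h2, div_self (by positivity), one_smul]
  · have hkm : (β q.n).k q.j ≤ (β q.n).m := ((hk _).monotone q.le).trans (hle _)
    simp only [ContinuousLinearMap.comp_apply, hB₀, map_sum, hS, Place.vec]
    refine Finset.sum_congr rfl fun K _ => ?_
    rw [basisAt, dif_pos hkm]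
    simp only [twistSign, twistIdx, Selection.idx, D, hθ]
  · have hkm : (β p.n).k p.j ≤ (β p.n).m := ((hk _).monotone p.le).trans (hle _)
    refine clm_ext hd fun r => ?_
    obtain ⟨r, rfl⟩ := (twistIdx_bijective θ).2 r
    simp only [ContinuousLinearMap.comp_apply, hS', map_smul, hA₀, M.coord_linearCombination hd,
      smul_eq_mul, Place.func, _root_.smul_apply, _root_.sum_apply]
    have h1 : ∀ K : Fin ((β p.n).k p.j) → Bool,
        coordAt e (β p.n).m (twistNode (β p.n).θ K) (e (twistIdx θ r))
          = if r = D.idx (hmem p.n) p.le K then 1 else 0 := by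
      intro K
      have h2 : (⟨(β p.n).m, (β p.n).k p.j, hkm, twistNode (β p.n).θ K⟩ : Idx)
          = twistIdx θ (D.idx (hmem p.n) p.le K) := by
        simp only [twistIdx, Selection.idx, D, hθ]
      rw [coordAt, dif_pos hkm, h2, M.coord_basis hd]
      simp only [(twistIdx_bijective θ).1.eq_iff]
    simp only [h1, mul_ite, mul_one, mul_zero]
    by_cases hr : ∃ K ∈ fiber (β p.n).k p.K, r = D.idx (hmem p.n) p.le K
    · obtain ⟨K, hK, rfl⟩ := hr
      have h3 : ∀ L : Fin ((β p.n).k p.j) → Bool, D.idx (hmem p.n) p.le K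
          = D.idx (hmem p.n) p.le L ↔ K = L := by
        intro L
        simp only [Selection.idx, Idx.mk.injEq, true_and, heq_eq_eq]
      simp only [h3]
      rw [Finset.sum_ite_eq, if_pos hK, D.avgCoeff_idx]
      have h4 : selNode (D.k p.n) p.j K = p.K := mem_fiber.1 hK
      rw [h4]
      simp only [Finsupp.smul_apply, Finsupp.single_eq_same, smul_eq_mul, mul_one, twistSign,
        Selection.idx, D, hθ]
      ring
    · rw [Finset.sum_eq_zero, mul_zero]
      · have h5 : D.avgCoeff r p = 0 := by
          by_cases hu : (r.n, r.j) ∈ D.used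
          · obtain ⟨n, hn, j, hj, h6⟩ := hu
            obtain ⟨rn, rj, hrj, K⟩ := r
            simp only [Selection.map, Prod.mk.injEq] at h6
            obtain ⟨rfl, rfl⟩ := h6
            have h7 := D.avgCoeff_idx hn hj K
            simp only [Selection.idx] at h7
            rw [h7, Finsupp.smul_apply, Finsupp.single_apply, if_neg, smul_zero]
            rintro rfl
            exact hr ⟨K, mem_fiber.2 rfl, rfl⟩
          · rw [D.avgCoeff_of_notMem hu]; rfl
        rw [h5, mul_zero]
      · intro K hK
        rw [if_neg fun h => hr ⟨K, hK, h⟩]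

/-- An operator with very small matrix entries is small. -/
theorem norm_le_of_abs_coord_le (R : E →L[ℝ] E) {ε : ℝ} (hε : 0 ≤ ε)
    (hR : ∀ p q : Idx, |coord e p (R (e q))| ≤ ε / 64 ^ (max p.n q.n + 1)) : ‖R‖ ≤ ε := by
  classical
  -- The block `n` has at most `2 ^ (n + 1)` indices, so the sum of these weights is at most `1`.
  let w : Idx → ℝ := fun p => (1 / 4) ^ (p.n + 1)
  have hw0 : ∀ p, 0 ≤ w p := fun p => by positivity
  have hw : ∀ F : Finset Idx, ∑ p ∈ F, w p ≤ 1 := by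
    intro F
    have h1 : F ⊆ (Finset.range (F.sup Idx.n + 1)).biUnion blockIdx := fun p hp => by
      have := Finset.le_sup (f := Idx.n) hp
      exact Finset.mem_biUnion.2 ⟨p.n, Finset.mem_range.2 (by omega), mem_blockIdx.2 rfl⟩
    refine (Finset.sum_le_sum_of_subset_of_nonneg h1 fun p _ _ => hw0 p).trans ?_
    rw [Finset.sum_biUnion]
    · have h2 : ∀ n, ∑ p ∈ blockIdx n, w p ≤ 1 / 2 * (1 / 2) ^ n := by
        intro n
        have h3 : ∀ p ∈ blockIdx n, w p = (1 / 4) ^ (n + 1) := fun p hp => by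
          simp only [w, mem_blockIdx.1 hp]
        rw [Finset.sum_congr rfl h3, Finset.sum_const, nsmul_eq_mul]
        have h4 : ((blockIdx n).card : ℝ) ≤ 2 ^ (n + 1) := by exact_mod_cast card_blockIdx_le n
        refine (mul_le_mul_of_nonneg_right h4 (by positivity)).trans (le_of_eq ?_)
        rw [← mul_pow, pow_succ]
        norm_num
        ring
      refine (Finset.sum_le_sum fun n _ => h2 n).trans ?_
      rw [← Finset.mul_sum]
      linarith [sum_geometric_two_le (F.sup Idx.n + 1)]
    · intro n _ n' _ hnn
      simp only [Function.onFun, Finset.disjoint_left, mem_blockIdx]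
      exact fun p h1 h2 => hnn (h1.symm.trans h2)
  have hent : ∀ p q : Idx, |coord e p (R (e q))| * 2 ^ q.n ≤ ε * w p * w q := by
    intro p q
    have h1 : (64 : ℝ) ^ (max p.n q.n + 1) ≥ 4 ^ (p.n + 1) * 4 ^ (q.n + 1) * 2 ^ q.n := by
      have h2 : (64 : ℝ) ^ (max p.n q.n + 1)
          = 4 ^ (max p.n q.n + 1) * 4 ^ (max p.n q.n + 1) * 4 ^ (max p.n q.n + 1) := by
        rw [← mul_pow, ← mul_pow]; norm_num
      have h3 : (2 : ℝ) ^ q.n ≤ 4 ^ (max p.n q.n + 1) :=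
        (pow_le_pow_left₀ (by norm_num) (by norm_num) _).trans
          (pow_le_pow_right₀ (by norm_num) (by omega))
      rw [h2]
      gcongr
      · norm_num
      · exact le_max_left _ _
      · norm_num
      · exact le_max_right _ _
    have h4 : ε / 64 ^ (max p.n q.n + 1) ≤ ε / (4 ^ (p.n + 1) * 4 ^ (q.n + 1) * 2 ^ q.n) :=
      div_le_div_of_nonneg_left hε (by positivity) h1
    refine (mul_le_mul_of_nonneg_right ((hR p q).trans h4) (by positivity)).trans (le_of_eq ?_)
    simp only [w, one_div, inv_pow]
    field_simp
  have hcoord : ∀ (q : Idx), ‖coord e q‖ ≤ 2 ^ q.n := by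
    intro q
    refine (M.norm_coord_le hd q).trans ?_
    rw [inv_le_iff_one_le_mul₀ (M.levelSize_pos _)]
    refine (M.one_le_two_pow_mul_levelSize q.j).trans ?_
    exact mul_le_mul_of_nonneg_right (pow_le_pow_right₀ (by norm_num) q.le) (M.levelSize_nonneg _)
  refine R.opNorm_le_bound hε fun y => ?_
  refine hd.induction_on y (isClosed_le (by fun_prop) (by fun_prop)) fun a => ?_
  set y := Finsupp.linearCombination ℝ e a with hy
  refine M.norm_le_of_sum_coord_le hd fun F => ?_
  have h1 : ∀ p, |coord e p (R y)| ≤ ∑ q ∈ a.support, ε * w p * w q * ‖y‖ := by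
    intro p
    have h2 : coord e p (R y) = ∑ q ∈ a.support, a q * coord e p (R (e q)) := by
      simp only [hy, Finsupp.linearCombination_apply, Finsupp.sum, map_sum, map_smul, smul_eq_mul]
    rw [h2]
    refine (Finset.abs_sum_le_sum_abs _ _).trans (Finset.sum_le_sum fun q _ => ?_)
    have h3 : |a q| ≤ 2 ^ q.n * ‖y‖ := by
      rw [← M.coord_linearCombination hd q a, ← Real.norm_eq_abs]
      exact ContinuousLinearMap.le_of_opNorm_le _ (hcoord q) _
    rw [abs_mul]
    calc |a q| * |coord e p (R (e q))| ≤ 2 ^ q.n * ‖y‖ * |coord e p (R (e q))| :=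
          mul_le_mul_of_nonneg_right h3 (abs_nonneg _)
      _ = |coord e p (R (e q))| * 2 ^ q.n * ‖y‖ := by ring
      _ ≤ ε * w p * w q * ‖y‖ := mul_le_mul_of_nonneg_right (hent p q) (norm_nonneg _)
  refine (Finset.sum_le_sum fun p _ => h1 p).trans ?_
  have h2 : ∑ p ∈ F, ∑ q ∈ a.support, ε * w p * w q * ‖y‖
      = (∑ p ∈ F, w p) * (∑ q ∈ a.support, w q) * (ε * ‖y‖) := by
    rw [Finset.sum_mul_sum, Finset.sum_mul]
    refine Finset.sum_congr rfl fun p _ => ?_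
    rw [Finset.sum_mul]
    refine Finset.sum_congr rfl fun q _ => ?_
    ring
  rw [h2]
  refine mul_le_of_le_one_left (by positivity) ?_
  exact mul_le_one₀ (hw _) (Finset.sum_nonneg fun q _ => hw0 q) (hw _)

/-- Every operator is almost a multiple of the identity on a well complemented copy of the space,
and the factor is bounded below by the diagonal entries. -/
theorem exists_almost_scalar (hw : ∀ (j : ℕ) (φ : E →L[ℝ] ℝ), Tendsto (fun m =>
      φ (∑ K : Fin j → Bool, e ⟨j + m, j, Nat.le_add_right j m, K⟩)) atTop (𝓝 0))
    (T : E →L[ℝ] E) :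
    ∃ d : ℝ, (∀ δ, (∀ q, δ ≤ coord e q (T (e q))) → δ ≤ d) ∧ ∀ ε > 0, ∃ A B : E →L[ℝ] E,
      ‖A‖ ≤ 1 ∧ ‖B‖ ≤ 1 ∧ A.comp B = ContinuousLinearMap.id ℝ E ∧
        ‖A.comp (T.comp B) - d • ContinuousLinearMap.id ℝ E‖ ≤ ε := by
  classical
  choose D hD using fun k => exists_tendsto_hyperfilter (f := fun m => levelAvg e T m k)
    fun m => M.abs_levelAvg_le hd T m k
  obtain ⟨d, hDd⟩ := exists_tendsto_hyperfilter (f := D) (C := ‖T‖) fun k =>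
    le_of_tendsto (hD k).abs (Eventually.of_forall fun m => M.abs_levelAvg_le hd T m k)
  refine ⟨d, fun δ hδ => ?_, fun ε hε => ?_⟩
  · refine ge_of_tendsto hDd (Eventually.of_forall fun k => ge_of_tendsto (hD k) ?_)
    refine Eventually.filter_mono Nat.hyperfilter_le_atTop ?_
    filter_upwards [eventually_ge_atTop k] with m hm
    rw [levelAvg, le_inv_mul_iff₀ (by positivity)]
    have h1 : ∑ _K : Fin k → Bool, δ = 2 ^ k * δ := by
      simp
    rw [← h1]
    refine Finset.sum_le_sum fun K _ => ?_
    rw [coordAt, dif_pos hm, basisAt, dif_pos hm]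
    exact hδ _
  · obtain ⟨β, hβm, hβk, hβle, hβ⟩ := M.exists_places hd hw T hD hDd
      (η := fun n => ε / 64 ^ (n + 1)) (fun n => by positivity) (fun a b hab =>
        div_le_div_of_nonneg_left hε.le (by positivity)
          (pow_le_pow_right₀ (by norm_num) (by omega)))
    obtain ⟨A, B, hA, hB, hAB, hBe, hAc⟩ := M.exists_operators hd β hβm.injective hβk hβle
    refine ⟨A, B, hA, hB, hAB, M.norm_le_of_abs_coord_le hd _ hε.le fun p q => ?_⟩
    refine le_trans (le_of_eq ?_) (hβ p q (Classical.dec _))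
    congr 1
    have h1 : ∀ y, coord e p (A y) = (β p.n).func e p y := fun y => by
      rw [← hAc p]; rfl
    simp only [_root_.sub_apply, ContinuousLinearMap.comp_apply,
      _root_.smul_apply, ContinuousLinearMap.id_apply, map_sub, map_smul, hBe, h1,
      M.coord_basis hd, smul_eq_mul, mul_ite, mul_one, mul_zero, eq_comm (a := q)]

end Model

/-! ### Factorization -/

/-- An operator that is almost a multiple `c` of the identity on a copy factors the identity. -/
theorem factorsThrough_id {E : Type*} [NormedAddCommGroup E] [NormedSpace ℝ E] [CompleteSpace E]
    (S : E →L[ℝ] E) {c C η : ℝ} (hC : 0 < C) (hη : 0 < η) (hc : 1 ≤ C * |c|) {A B : E →L[ℝ] E}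
    (hA : ‖A‖ ≤ 1) (hB : ‖B‖ ≤ 1)
    (h : ‖A.comp (S.comp B) - c • ContinuousLinearMap.id ℝ E‖ ≤ |c| * (η / (C + η))) :
    FactorsThrough (ContinuousLinearMap.id ℝ E) S (C + η) 0 := by
  have hc0 : 0 < |c| := by
    by_contra hcon
    have : C * |c| ≤ 0 := mul_nonpos_of_nonneg_of_nonpos hC.le (not_lt.1 hcon)
    linarith
  have hc1 : c ≠ 0 := abs_pos.1 hc0
  -- `c⁻¹ • A S B = 1 - R` is inverted by a Neumann series.
  set R : E →L[ℝ] E := 1 - c⁻¹ • A.comp (S.comp B) with hR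
  have hRn : ‖R‖ ≤ η / (C + η) := by
    have h1 : R = -(c⁻¹ • (A.comp (S.comp B) - c • ContinuousLinearMap.id ℝ E)) := by
      rw [hR, smul_sub, smul_smul, inv_mul_cancel₀ hc1, one_smul, neg_sub]
      rfl
    rw [h1, norm_neg, norm_smul, norm_inv, Real.norm_eq_abs, inv_mul_le_iff₀ hc0]
    exact h
  have hCη : 0 < C + η := by positivity
  have hR1 : ‖R‖ < 1 := hRn.trans_lt ((div_lt_one hCη).2 (by linarith))
  let u := Units.oneSub R hR1
  let W : E →L[ℝ] E := ↑u⁻¹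
  have hW : W * (1 - R) = 1 := u.inv_mul
  have hWn : ‖W‖ ≤ (C + η) / C := by
    have h1 : W = 1 + W * R := by
      rw [mul_sub, mul_one, sub_eq_iff_eq_add] at hW
      exact hW
    have h2 : ‖W‖ ≤ 1 + ‖W‖ * (η / (C + η)) := by
      calc ‖W‖ = ‖1 + W * R‖ := by rw [← h1]
        _ ≤ 1 + ‖W‖ * (η / (C + η)) := by
          refine (norm_add_le _ _).trans (add_le_add ContinuousLinearMap.norm_id_le ?_)
          exact (norm_mul_le _ _).trans (mul_le_mul_of_nonneg_left hRn (norm_nonneg _))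
    have h3 : ‖W‖ * (1 - η / (C + η)) ≤ 1 := by linarith
    have h4 : 1 - η / (C + η) = C / (C + η) := by field_simp; ring
    rw [h4, ← mul_div_assoc, div_le_one hCη] at h3
    rwa [le_div_iff₀ hC]
  refine ⟨B, c⁻¹ • W.comp A, ?_, ?_⟩
  · have h1 : ‖c⁻¹ • W.comp A‖ ≤ |c|⁻¹ * ((C + η) / C) := by
      rw [norm_smul, norm_inv, Real.norm_eq_abs]
      refine mul_le_mul_of_nonneg_left ?_ (inv_nonneg.2 (abs_nonneg _))
      refine (ContinuousLinearMap.opNorm_comp_le _ _).trans ?_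
      exact (mul_le_of_le_one_right (norm_nonneg _) hA).trans hWn
    refine (mul_le_of_le_one_right (norm_nonneg _) hB).trans (h1.trans ?_)
    rw [inv_mul_le_iff₀ hc0, div_le_iff₀ hC]
    nlinarith
  · have h1 : (c⁻¹ • W.comp A).comp (S.comp B) = ContinuousLinearMap.id ℝ E := by
      have h2 : 1 - R = c⁻¹ • A.comp (S.comp B) := by rw [hR, sub_sub_cancel]
      rw [h2] at hW
      ext y
      have h3 := congrArg (fun f : E →L[ℝ] E => f y) hW
      simpa using h3
    rw [h1, sub_self, norm_zero]

end HaarHardy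

theorem mainTheorem2 (N : HaarHardy.HaarSystemNorm) (r : HaarHardy.RademacherKind)
    (τ : ℕ → Finset ℕ) (hτ_card : ∀ n, (τ n).card = n + 1)
    (hτ_disj : ∀ m n, m ≠ n → Disjoint (τ m) (τ n))
    (hr : HaarHardy.WeaklyNull (HaarHardy.rademacherY N r)) :
    (∀ T : HaarHardy.YOmega N r τ →L[ℝ] HaarHardy.YOmega N r τ,
      HaarHardy.FactorsThroughPlus (ContinuousLinearMap.id ℝ (HaarHardy.YOmega N r τ)) T 2 ∨
      HaarHardy.FactorsThroughPlus (ContinuousLinearMap.id ℝ (HaarHardy.YOmega N r τ))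
        (ContinuousLinearMap.id ℝ (HaarHardy.YOmega N r τ) - T) 2) ∧
    (∀ δ : ℝ, 0 < δ → ∀ T : HaarHardy.YOmega N r τ →L[ℝ] HaarHardy.YOmega N r τ,
      HaarHardy.HasLargePositiveDiagonal (HaarHardy.hOmega N r τ) δ T →
      HaarHardy.FactorsThroughPlus (ContinuousLinearMap.id ℝ (HaarHardy.YOmega N r τ)) T
        (1 / δ)) := by
  open HaarHardy in
  have M := omegaModel N r hτ_card hτ_disj
  have hd := denseRange_linearCombination_omegaBasis N r τ
  have key := M.exists_almost_scalar hd
    fun j φ => tendsto_sum_omegaBasis N r hτ_card hτ_disj hr j φ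
  constructor
  · intro T
    obtain ⟨d, -, hd'⟩ := key T
    have hcase : 1 / 2 ≤ |d| ∨ 1 / 2 ≤ |1 - d| := by
      rcases le_total (1 / 2) d with h | h
      · exact Or.inl (h.trans (le_abs_self d))
      · exact Or.inr ((by linarith : (1 : ℝ) / 2 ≤ 1 - d).trans (le_abs_self _))
    rcases hcase with h | h
    · refine Or.inl fun η hη => ?_
      obtain ⟨A, B, hA, hB, -, hAB⟩ := hd' (|d| * (η / (2 + η))) (by positivity)
      exact factorsThrough_id T zero_lt_two hη (by linarith) hA hB hAB
    · refine Or.inr fun η hη => ?_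
      obtain ⟨A, B, hA, hB, hid, hAB⟩ := hd' (|1 - d| * (η / (2 + η))) (by positivity)
      refine factorsThrough_id _ zero_lt_two hη (c := 1 - d) (by linarith) hA hB ?_
      have h1 : A.comp ((ContinuousLinearMap.id ℝ (YOmega N r τ) - T).comp B)
          - (1 - d) • ContinuousLinearMap.id ℝ (YOmega N r τ)
          = -(A.comp (T.comp B) - d • ContinuousLinearMap.id ℝ (YOmega N r τ)) := by
        rw [ContinuousLinearMap.sub_comp, ContinuousLinearMap.comp_sub,
          ContinuousLinearMap.id_comp, hid, sub_smul, one_smul]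
        abel
      rw [h1, norm_neg]
      exact hAB
  · intro δ hδ T hT η hη
    obtain ⟨d, hδd, hd'⟩ := key T
    have h1 : δ ≤ d := by
      refine hδd δ fun q => hT (omegaIdx q) (coord (omegaBasis N r τ) q) ⟨?_, fun i hi => ?_⟩
      · have := M.coord_basis hd q q
        rwa [if_pos rfl] at this
      · obtain ⟨p, rfl⟩ := omegaIdx_surjective i
        have := M.coord_basis hd q p
        rwa [if_neg fun h => hi (congrArg omegaIdx h)] at this
    have hd0 : 0 < d := hδ.trans_le h1
    obtain ⟨A, B, hA, hB, -, hAB⟩ := hd' (|d| * (η / (1 / δ + η))) (by positivity)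
    refine factorsThrough_id T (by positivity) hη ?_ hA hB hAB
    rw [abs_of_pos hd0, one_div, le_inv_mul_iff₀ hδ, mul_one]
    exact h1
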